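/- **Language.** First-order language with constants, an unlimited stock of parameters (free variables), predicate letters, identity $=$, an existence predicate $\exists!$, the connectives and quantifiers $\bot,\land,\lor,\to,\forall,\exists$ (with $\neg A := A\to\bot$), and description terms $\iota xF$. Parameters and constants are the *atomic* terms. *Atomic* formulas are $Rt_1\ldots t_n$, $\exists!t$, $t_1=t_2$ with arbitrary terms; *prime* formulas are those with atomic terms only. **System $\mathbf{INF}^{\iota\prime}$.** Natural deduction (with assumption classes, vacuous discharge allowed) with Gentzen's intuitionist introduction and elimination rules for $\land,\lor,\to$ and: * $(\bot E)$: from $\bot$ infer any prime $B$. * $(\forall I)$: from a deduction of $A_a^x$ infer $\forall xA$, discharging $\exists!a$; $(\forall E)$: from $\forall xA$ and $\exists!t$ infer $A_t^x$, $t$ atomic. * $(\exists I)$: from $A_t^x$ and $\exists!t$ infer $\exists xA$, $t$ atomic; $(\exists E)$: from $\exists xA$ and a deduction of $C$ infer $C$, discharging $A_a^x$ and $\exists!a$. * $(=I^{nG})$: from $\exists!t$ and a deduction of $C$ infer $C$, discharging $a=t$; $(=E)$: from $t_1=t_2$ and $A_{t_1}^x$ infer $A_{t_2}^x$, $A$ atomic.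 * $(AD)$: from $Rt_1\ldots t_n$ infer $\exists!t_i$, where $R$ is a predicate letter or $=$. The inference from $\iota xF=t$ to $\exists!t$ for the right-hand term counts as $(\iota E_3)$ instead. * $(\iota I)$: from $\exists!t$, a deduction of $F_a^x$ discharging $a=t$, and a deduction of $a=t$ discharging $F_a^x$ and $\exists!a$, infer $\iota xF=t$, $t$ atomic; $(\iota E_1)$: from $\iota xF=t$ and $u=t$ infer $F_u^x$, and $(\iota E_2)$: from $\iota xF=t$, $F_u^x$ and $\exists!u$ infer $u=t$, with $t,u$ atomic; $(\iota E_3)$: from $\iota xF=t$ infer $\exists!t$. Here $a$ is a parameter that is used only for the application of the rule in question. The leftmost premise of an elimination rule or of $(=I^{nG})$ is its *major* premise, the others are *minor*. **Segments.** A *segment* is a sequence $C_1,\ldots,C_n$ of formula occurrences in a deduction such that $C_1$ is not the conclusion, and $C_n$ not a minor premise, of $(\lor E)$, $(\exists E)$ or $(=I^{nG})$, and for $i<n$, $C_i$ is a minor premise of such a rule with conclusion $C_{i+1}$. A *maximal segment* is one of the following. 1. A segment whose last formula is the major premise of an elimination rule and which, if $n=1$, is the conclusion of an introduction rule. (An identity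 that is concluded by $(\iota I)$ and is the major premise of $(=E)$ is not maximal.) 2. A segment of formulas $t=t$, one of which is the minor premise of $(=I^{nG})$, whose last formula is the premise of $(AD)$ or $(\iota E_3)$; or a segment of formulas $a=t$ whose first formula is discharged by $(=I^{nG})$ and whose last formula is the premise of $(AD)$ or $(\iota E_3)$ with conclusion $\exists!t$. 3. A segment of formulas $\exists!t$ whose first formula is concluded from $t=t$ by $(AD)$ or $(\iota E_3)$ and whose last formula is the major premise of an application of $(=I^{nG})$ with conclusion $t=t$. 4. A sequence of at least two segments in which each but the last is the minor premise of an application of $(=E)$ with the next as conclusion, the first is not the conclusion of $(=E)$, the last is not the minor premise of $(=E)$, and either the last is the premise of $(AD)$ or $(\iota E_3)$ or all its formulas have the form $\exists!t$. A deduction is in *normal form* if it contains no maximal segments and no application of $(=E)$ with a major premise $t=t$. **Theorem.** Deductions in $\mathbf{INF}^{\iota\prime}$ can be brought into normal form: for every deduction $D$ of $A$ with open assumptions among $\Gamma$ there is a deduction $D'$ of $A$ in normal form with open assumptions among $\Gamma$. Moreover, if the applications of $(=E)$ in $D$ replace terms only where they are arguments of the predicate letter, of $\exists!$ or of $=$ (not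 inside description terms), then $D'$ can be obtained from $D$ by finitely many steps, applied to subdeductions, of the following kinds: * the reductions of an introduction rule followed by the elimination rule for the same symbol, for $\land,\lor,\to,\forall,\exists$ (Prawitz's) and $\iota$ (Tennant's); * permuting an elimination rule, $(AD)$ or $(=I^{nG})$ upwards when its leftmost premise is concluded by $(\lor E)$, $(\exists E)$ or $(=I^{nG})$; * removing an application of $(\lor E)$, $(\exists E)$ or $(=I^{nG})$ together with all its subdeductions except one for a minor premise in which nothing is discharged, and removing an application of $(=E)$ whose minor premise and conclusion are identical; * if $\exists!r$ is inferred by $(AD)$ or $(\iota E_3)$ from the conclusion of $(=E)$, inferring it from the minor or the major premise of $(=E)$ instead; if $\exists!r$ is the conclusion of $(=E)$, inferring it from the major premise by $(AD)$ or $(\iota E_3)$; * if $\exists!t$ is inferred by $(AD)$ or $(\iota E_3)$ from $t=t$, which is concluded by $(=I^{nG})$ with major premise $\exists!t$, keeping only the deduction of that premise; if $\exists!t$ is inferred by $(AD)$ from assumptions $a=t$ discharged by $(=I^{nG})$, using the deduction of the major premise $\exists!t$ instead; if $(=I^{nG})$ concludes $t=t$ and its major premise $\exists!t$ is inferred from $t=t$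 by $(AD)$ or $(\iota E_3)$, keeping only the deduction of the latter $t=t$. -/

import Mathlib

namespace FreeLogic

universe u v

/-! ### The language -/

/-- A first-order signature: individual constants, and predicate letters with their arities.
Identity and the existence predicate are logical symbols and do not belong to the signature. -/
structure Signature where
  Const : Type u
  Pred : Type v
  arity : Pred → ℕ

/- Terms and formulas up to renaming of bound variables, in de Bruijn notation: the quantifiers and
the description operator bind the index `0` of their scope.  Indices that are not bound are the
parameters, so there is an unlimited stock of parameters.  `iota F` is the description term
"the `x` such that `F`", `exist t` is `∃! t`, and `¬ A` is `imp A bot`. -/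
mutual
  inductive Tm (L : Signature.{u, v}) : Type (max u v)
    | var (i : ℕ) : Tm L
    | const (c : L.Const) : Tm L
    | iota (F : Fm L) : Tm L
  inductive Fm (L : Signature.{u, v}) : Type (max u v)
    | bot : Fm L
    | pred (P : L.Pred) (ts : Fin (L.arity P) → Tm L) : Fm L
    | exist (t : Tm L) : Fm L
    | eq (s t : Tm L) : Fm L
    | and (A B : Fm L) : Fm L
    | or (A B : Fm L) : Fm L
    | imp (A B : Fm L) : Fm L
    | all (A : Fm L) : Fm L
    | ex (A : Fm L) : Fm L
end

variable {L : Signature.{u, v}}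

/-- Prepend a value to a sequence. -/
def scons {α : Type*} (a : α) (f : ℕ → α) : ℕ → α
  | 0 => a
  | i + 1 => f i

/-- The renaming that a renaming induces below one binder. -/
def upRen (f : ℕ → ℕ) : ℕ → ℕ := scons 0 (fun i => f i + 1)

mutual
  def Tm.rename (f : ℕ → ℕ) : Tm L → Tm L
    | .var i => .var (f i)
    | .const c => .const c
    | .iota F => .iota (Fm.rename (upRen f) F)
  def Fm.rename (f : ℕ → ℕ) : Fm L → Fm L
    | .bot => .bot
    | .pred P ts => .pred P (fun i => Tm.rename f (ts i))
    | .exist t => .exist (Tm.rename f t)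
    | .eq s t => .eq (Tm.rename f s) (Tm.rename f t)
    | .and A B => .and (Fm.rename f A) (Fm.rename f B)
    | .or A B => .or (Fm.rename f A) (Fm.rename f B)
    | .imp A B => .imp (Fm.rename f A) (Fm.rename f B)
    | .all A => .all (Fm.rename (upRen f) A)
    | .ex A => .ex (Fm.rename (upRen f) A)
end

/-- The same term, read in a context with one new parameter `0`. -/
def Tm.shift (t : Tm L) : Tm L := t.rename Nat.succ

/-- The same formula, read in a context with one new parameter `0`. -/
def Fm.shift (A : Fm L) : Fm L := A.rename Nat.succ

/-- The substitution that a substitution induces below one binder. -/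
def upSub (σ : ℕ → Tm L) : ℕ → Tm L := scons (.var 0) (fun i => (σ i).shift)

mutual
  def Tm.subst (σ : ℕ → Tm L) : Tm L → Tm L
    | .var i => σ i
    | .const c => .const c
    | .iota F => .iota (Fm.subst (upSub σ) F)
  def Fm.subst (σ : ℕ → Tm L) : Fm L → Fm L
    | .bot => .bot
    | .pred P ts => .pred P (fun i => Tm.subst σ (ts i))
    | .exist t => .exist (Tm.subst σ t)
    | .eq s t => .eq (Tm.subst σ s) (Tm.subst σ t)
    | .and A B => .and (Fm.subst σ A) (Fm.subst σ B)
    | .or A B => .or (Fm.subst σ A) (Fm.subst σ B)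
    | .imp A B => .imp (Fm.subst σ A) (Fm.subst σ B)
    | .all A => .all (Fm.subst (upSub σ) A)
    | .ex A => .ex (Fm.subst (upSub σ) A)
end

/-- The formula `A_t^x`, where `x` is the index `0` of `A`. -/
def Fm.inst (A : Fm L) (t : Tm L) : Fm L := A.subst (scons t .var)

def Tm.IsIota : Tm L → Prop
  | .iota _ => True
  | _ => False

/-- Atomic terms: parameters and constants. -/
def Tm.IsAtomic (t : Tm L) : Prop := ¬ t.IsIota

/-- Atomic formulas: a predicate letter, `∃!` or `=`, applied to arbitrary terms. -/
def Fm.IsAtomic : Fm L → Prop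
  | .pred _ _ => True
  | .exist _ => True
  | .eq _ _ => True
  | _ => False

/-- Prime formulas: a predicate letter, `∃!` or `=`, applied to parameters and constants. -/
def Fm.IsPrime : Fm L → Prop
  | .pred _ ts => ∀ i, (ts i).IsAtomic
  | .exist t => t.IsAtomic
  | .eq s t => s.IsAtomic ∧ t.IsAtomic
  | _ => False

/-- `A.DenotesAD r`: from `A` one may infer `∃! r` by atomic denotation.  Here `A` is formed by a
predicate letter or by identity, and `r` is one of its terms.  Inferring from an identity whose left
term is a description term that its right term exists is not an application of this rule but of the
third elimination rule for descriptions. -/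
def Fm.DenotesAD : Fm L → Tm L → Prop
  | .pred _ ts, r => ∃ i, ts i = r
  | .eq s t, r => r = s ∨ (r = t ∧ ¬ s.IsIota)
  | _, _ => False

/-! ### Deductions -/

/-- Trees of applications of rules; the arguments other than deductions determine the formulas at
the nodes.  Assumption classes are referred to by de Bruijn indices, independently of parameters.
A rule with an eigenparameter binds the parameter `0` in the subdeduction in which it is used, so
that this parameter occurs nowhere else.  `eqI` is the general introduction rule for identity. -/
inductive Ded (L : Signature.{u, v}) : Type (max u v)
  | hyp (i : ℕ) : Ded L
  | andI (d e : Ded L) : Ded L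
  | andE₁ (A B : Fm L) (d : Ded L) : Ded L
  | andE₂ (A B : Fm L) (d : Ded L) : Ded L
  | orI₁ (B : Fm L) (d : Ded L) : Ded L
  | orI₂ (A : Fm L) (d : Ded L) : Ded L
  | orE (A B C : Fm L) (d e₁ e₂ : Ded L) : Ded L
  | impI (A : Fm L) (d : Ded L) : Ded L
  | impE (A B : Fm L) (d e : Ded L) : Ded L
  | botE (A : Fm L) (d : Ded L) : Ded L
  | allI (A : Fm L) (d : Ded L) : Ded L
  | allE (A : Fm L) (t : Tm L) (d e : Ded L) : Ded L
  | exI (A : Fm L) (t : Tm L) (d e : Ded L) : Ded L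
  | exE (A C : Fm L) (d e : Ded L) : Ded L
  | eqI (t : Tm L) (C : Fm L) (d e : Ded L) : Ded L
  | eqE (A : Fm L) (s t : Tm L) (d e : Ded L) : Ded L
  | ad (A : Fm L) (r : Tm L) (d : Ded L) : Ded L
  | iotaI (F : Fm L) (t : Tm L) (d e f : Ded L) : Ded L
  | iotaE₁ (F : Fm L) (t w : Tm L) (d e : Ded L) : Ded L
  | iotaE₂ (F : Fm L) (t w : Tm L) (d e f : Ded L) : Ded L
  | iotaE₃ (F : Fm L) (t : Tm L) (d : Ded L) : Ded L

/-- `Proves Γ D A`: `D` is a correct deduction of `A` whose open assumptions are among `Γ`, in the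
intuitionist negative free logic with descriptions in which the introduction rule for identity is
the general one, the terms of the quantifier and description rules are atomic, and the conclusions
of `eqE` and `botE` are atomic and prime respectively. -/
inductive Proves : List (Fm L) → Ded L → Fm L → Prop
  | hyp {Γ i A} : Γ[i]? = some A → Proves Γ (.hyp i) A
  | andI {Γ d e A B} : Proves Γ d A → Proves Γ e B → Proves Γ (.andI d e) (.and A B)
  | andE₁ {Γ d A B} : Proves Γ d (.and A B) → Proves Γ (.andE₁ A B d) A
  | andE₂ {Γ d A B} : Proves Γ d (.and A B) → Proves Γ (.andE₂ A B d) B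
  | orI₁ {Γ d A B} : Proves Γ d A → Proves Γ (.orI₁ B d) (.or A B)
  | orI₂ {Γ d A B} : Proves Γ d B → Proves Γ (.orI₂ A d) (.or A B)
  | orE {Γ d e₁ e₂ A B C} : Proves Γ d (.or A B) → Proves (A :: Γ) e₁ C →
      Proves (B :: Γ) e₂ C → Proves Γ (.orE A B C d e₁ e₂) C
  | impI {Γ d A B} : Proves (A :: Γ) d B → Proves Γ (.impI A d) (.imp A B)
  | impE {Γ d e A B} : Proves Γ d (.imp A B) → Proves Γ e A → Proves Γ (.impE A B d e) B
  | botE {Γ d A} : A.IsPrime → Proves Γ d .bot → Proves Γ (.botE A d) A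
  | allI {Γ d A} : Proves (.exist (.var 0) :: Γ.map Fm.shift) d A →
      Proves Γ (.allI A d) (.all A)
  | allE {Γ d e A t} : t.IsAtomic → Proves Γ d (.all A) → Proves Γ e (.exist t) →
      Proves Γ (.allE A t d e) (A.inst t)
  | exI {Γ d e A t} : t.IsAtomic → Proves Γ d (A.inst t) → Proves Γ e (.exist t) →
      Proves Γ (.exI A t d e) (.ex A)
  | exE {Γ d e A C} : Proves Γ d (.ex A) →
      Proves (.exist (.var 0) :: A :: Γ.map Fm.shift) e C.shift → Proves Γ (.exE A C d e) C
  | eqI {Γ d e t C} : Proves Γ d (.exist t) →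
      Proves (.eq (.var 0) t.shift :: Γ.map Fm.shift) e C.shift → Proves Γ (.eqI t C d e) C
  | eqE {Γ d e A s t} : A.IsAtomic → Proves Γ d (.eq s t) → Proves Γ e (A.inst s) →
      Proves Γ (.eqE A s t d e) (A.inst t)
  | ad {Γ d A r} : A.DenotesAD r → Proves Γ d A → Proves Γ (.ad A r d) (.exist r)
  | iotaI {Γ d e f F t} : t.IsAtomic → Proves Γ d (.exist t) →
      Proves (.eq (.var 0) t.shift :: Γ.map Fm.shift) e F →
      Proves (.exist (.var 0) :: F :: Γ.map Fm.shift) f (.eq (.var 0) t.shift) →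
      Proves Γ (.iotaI F t d e f) (.eq (.iota F) t)
  | iotaE₁ {Γ d e F t w} : t.IsAtomic → w.IsAtomic → Proves Γ d (.eq (.iota F) t) →
      Proves Γ e (.eq w t) → Proves Γ (.iotaE₁ F t w d e) (F.inst w)
  | iotaE₂ {Γ d e f F t w} : t.IsAtomic → w.IsAtomic → Proves Γ d (.eq (.iota F) t) →
      Proves Γ e (F.inst w) → Proves Γ f (.exist w) →
      Proves Γ (.iotaE₂ F t w d e f) (.eq w t)
  | iotaE₃ {Γ d F t} : Proves Γ d (.eq (.iota F) t) → Proves Γ (.iotaE₃ F t d) (.exist t)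

namespace Ded

/-- Premises of elimination rules, and of the general introduction rule for identity, are major
(the leftmost one) or minor; those of all other rules are plain. -/
inductive Role
  | major
  | minor
  | plain

/-- The immediate subdeductions, with the role of their conclusion as a premise of the last rule,
and with the number of assumption classes of the subdeduction that the last rule may discharge. -/
def premises : Ded L → List (Role × ℕ × Ded L)
  | hyp _ => []
  | andI d e => [(.plain, 0, d), (.plain, 0, e)]
  | andE₁ _ _ d => [(.major, 0, d)]
  | andE₂ _ _ d => [(.major, 0, d)]
  | orI₁ _ d => [(.plain, 0, d)]
  | orI₂ _ d => [(.plain, 0, d)]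
  | orE _ _ _ d e₁ e₂ => [(.major, 0, d), (.minor, 1, e₁), (.minor, 1, e₂)]
  | impI _ d => [(.plain, 1, d)]
  | impE _ _ d e => [(.major, 0, d), (.minor, 0, e)]
  | botE _ d => [(.major, 0, d)]
  | allI _ d => [(.plain, 1, d)]
  | allE _ _ d e => [(.major, 0, d), (.minor, 0, e)]
  | exI _ _ d e => [(.plain, 0, d), (.plain, 0, e)]
  | exE _ _ d e => [(.major, 0, d), (.minor, 2, e)]
  | eqI _ _ d e => [(.major, 0, d), (.minor, 1, e)]
  | eqE _ _ _ d e => [(.major, 0, d), (.minor, 0, e)]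
  | ad _ _ d => [(.plain, 0, d)]
  | iotaI _ _ d e f => [(.plain, 0, d), (.plain, 1, e), (.plain, 2, f)]
  | iotaE₁ _ _ _ d e => [(.major, 0, d), (.minor, 0, e)]
  | iotaE₂ _ _ _ d e f => [(.major, 0, d), (.minor, 0, e), (.minor, 0, f)]
  | iotaE₃ _ _ d => [(.major, 0, d)]

/-- `D.Occurs k d`: the deduction `d` occurs in `D` as a subdeduction, in the scope of `k`
assumption classes that are discharged between the end of `d` and the end of `D`. -/
inductive Occurs (D : Ded L) : ℕ → Ded L → Prop
  | root : Occurs D 0 D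
  | premise {k j r d e} : Occurs D k d → (r, j, e) ∈ d.premises → Occurs D (k + j) e

/-! ### Segments -/

/-- The last rule is an introduction rule. -/
def EndsInIntro : Ded L → Prop
  | andI .. | orI₁ .. | orI₂ .. | impI .. | allI .. | exI .. | eqI .. | iotaI .. => True
  | _ => False

/-- The last rule is an elimination rule. -/
def EndsInElim : Ded L → Prop
  | andE₁ .. | andE₂ .. | orE .. | impE .. | botE .. | allE .. | exE .. | eqE .. | iotaE₁ ..
  | iotaE₂ .. | iotaE₃ .. => True
  | _ => False

/-- The last rule is the elimination rule for identity. -/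
def EndsInEqE : Ded L → Prop
  | eqE .. => True
  | _ => False

/-- The last rule is the general introduction rule for identity. -/
def EndsInEqI : Ded L → Prop
  | eqI .. => True
  | _ => False

/-- The last rule repeats its minor premise as its conclusion: it is the elimination rule for
disjunction or the existential quantifier, or the general introduction rule for identity. -/
def EndsInDel : Ded L → Prop
  | orE .. | exE .. | eqI .. => True
  | _ => False

/-- `Segment l k d`: the conclusions of the members of `l` are the formulas, from first to last, of
a segment whose last formula is the conclusion of `d`; between the first formula and the last one
lies the scope of `k` assumption classes.  That the last formula is not a minor premise of one of
the three rules of `EndsInDel` depends on where `d` occurs: it holds wherever `Segment` is used. -/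
inductive Segment : List (Ded L) → ℕ → Ded L → Prop
  | first {d} : ¬ d.EndsInDel → Segment [d] 0 d
  | next {l k j d e} : d.EndsInDel → (.minor, j, e) ∈ d.premises → Segment l k e →
      Segment (l ++ [d]) (k + j) d

/-- `EqESegment As d`: a sequence of segments, the last of which ends with the conclusion of `d`, in
which every segment but the last is the minor premise of an application of `eqE` that concludes the
next one, and the first is not a conclusion of `eqE`.  There are at least two segments, and the
formulas on them are `As`, listed from first to last. -/
inductive EqESegment : List (Fm L) → Ded L → Prop
  | two {A s t m e l l' f k k' d} : Segment l' k' e → l'.head? = some f → ¬ f.EndsInEqE →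
      Segment l k d → l.head? = some (.eqE A s t m e) → EqESegment [A.inst s, A.inst t] d
  | more {A s t m e l k d As} : EqESegment As e →
      Segment l k d → l.head? = some (.eqE A s t m e) → EqESegment (As ++ [A.inst t]) d

/-- `D` infers `∃! r` from the conclusion `A` of `d` by atomic denotation or by the third elimination
rule for descriptions. -/
inductive Denotes : Fm L → Tm L → Ded L → Ded L → Prop
  | ad {A r d} : A.DenotesAD r → Denotes A r d (ad A r d)
  | iotaE₃ {F t d} : Denotes (.eq (.iota F) t) t d (iotaE₃ F t d)

/-! ### Maximal segments and normal form -/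

/-- There is a segment whose last formula is the major premise of an elimination rule and which, if
its length is one, is the conclusion of an introduction rule.  An identity between a description
term and a term that is concluded by the introduction rule for descriptions and is the major premise
of the elimination rule for identity is not maximal: the two rules govern different symbols. -/
def HasMaximalIE (D : Ded L) : Prop :=
  ∃ k c j d l n, D.Occurs k c ∧ c.EndsInElim ∧ (.major, j, d) ∈ c.premises ∧ Segment l n d ∧
    (l.length = 1 → d.EndsInIntro ∧ ¬ c.EndsInEqE)

/-- There is a segment of formulas `t = t`, one of which is the minor premise of the general
introduction rule for identity, and the last of which is a premise from which `∃! t` is inferred. -/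
def HasMaximalEq₁ (D : Ded L) : Prop :=
  ∃ k c t d l n, D.Occurs k c ∧ Denotes (.eq t t) t d c ∧ Segment l n d ∧ ∃ e ∈ l, e.EndsInEqI

/-- There is a segment of formulas `a = t` such that the first is an assumption discharged by an
application of the general introduction rule for identity with eigenparameter `a` and the last is a
premise from which `∃! t` is inferred. -/
def HasMaximalEq₂ (D : Ded L) : Prop :=
  ∃ k t C m e j c s r d l n, D.Occurs k (.eqI t C m e) ∧ e.Occurs j c ∧
    Denotes (.eq s r) r d c ∧ Segment l n d ∧ l.head? = some (.hyp (j + n))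

/-- There is a segment of formulas `∃! t` such that the first is inferred from `t = t` and the last
is the major premise of an application of the general introduction rule for identity with
conclusion `t = t`. -/
def HasMaximalExist (D : Ded L) : Prop :=
  ∃ k t m e l n u d c, D.Occurs k (.eqI t (.eq t t) m e) ∧ Segment l n m ∧
    l.head? = some c ∧ Denotes (.eq u u) u d c

/-- The conclusion of `d`, at some place where `d` occurs in `D`, is a last formula both of a segment
and of a sequence of segments that are linked by `eqE`. -/
def IsEqESegmentEnd (D d : Ded L) : Prop :=
  d = D ∨ ∃ k c r j, D.Occurs k c ∧ (r, j, d) ∈ c.premises ∧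
    ¬ (r = .minor ∧ (c.EndsInDel ∨ c.EndsInEqE))

/-- There is a sequence of segments linked by `eqE` the last of which is a premise from which a
formula `∃! r` is inferred, or all formulas of which have the form `∃! r`. -/
def HasMaximalEqE (D : Ded L) : Prop :=
  (∃ k c A r d As, D.Occurs k c ∧ Denotes A r d c ∧ EqESegment As d) ∨
  (∃ d As, D.IsEqESegmentEnd d ∧ EqESegment As d ∧ ∀ B ∈ As, ∃ r, B = .exist r)

/-- There is an application of `eqE` with a major premise `t = t`. -/
def HasVacuousEqE (D : Ded L) : Prop := ∃ k A t d e, D.Occurs k (.eqE A t t d e)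

/-- Normal form: there are no maximal segments of any kind, and no vacuous applications of `eqE`. -/
def IsNormal (D : Ded L) : Prop :=
  ¬ D.HasMaximalIE ∧ ¬ D.HasMaximalEq₁ ∧ ¬ D.HasMaximalEq₂ ∧ ¬ D.HasMaximalExist ∧
    ¬ D.HasMaximalEqE ∧ ¬ D.HasVacuousEqE

/-! ### Substitution in deductions -/

/-- Substitute terms for parameters. -/
def psubst : (ℕ → Tm L) → Ded L → Ded L
  | _, hyp i => hyp i
  | σ, andI d e => andI (psubst σ d) (psubst σ e)
  | σ, andE₁ A B d => andE₁ (A.subst σ) (B.subst σ) (psubst σ d)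
  | σ, andE₂ A B d => andE₂ (A.subst σ) (B.subst σ) (psubst σ d)
  | σ, orI₁ B d => orI₁ (B.subst σ) (psubst σ d)
  | σ, orI₂ A d => orI₂ (A.subst σ) (psubst σ d)
  | σ, orE A B C d e₁ e₂ =>
      orE (A.subst σ) (B.subst σ) (C.subst σ) (psubst σ d) (psubst σ e₁) (psubst σ e₂)
  | σ, impI A d => impI (A.subst σ) (psubst σ d)
  | σ, impE A B d e => impE (A.subst σ) (B.subst σ) (psubst σ d) (psubst σ e)
  | σ, botE A d => botE (A.subst σ) (psubst σ d)
  | σ, allI A d => allI (A.subst (upSub σ)) (psubst (upSub σ) d)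
  | σ, allE A t d e => allE (A.subst (upSub σ)) (t.subst σ) (psubst σ d) (psubst σ e)
  | σ, exI A t d e => exI (A.subst (upSub σ)) (t.subst σ) (psubst σ d) (psubst σ e)
  | σ, exE A C d e => exE (A.subst (upSub σ)) (C.subst σ) (psubst σ d) (psubst (upSub σ) e)
  | σ, eqI t C d e => eqI (t.subst σ) (C.subst σ) (psubst σ d) (psubst (upSub σ) e)
  | σ, eqE A s t d e =>
      eqE (A.subst (upSub σ)) (s.subst σ) (t.subst σ) (psubst σ d) (psubst σ e)
  | σ, ad A r d => ad (A.subst σ) (r.subst σ) (psubst σ d)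
  | σ, iotaI F t d e f => iotaI (F.subst (upSub σ)) (t.subst σ) (psubst σ d)
      (psubst (upSub σ) e) (psubst (upSub σ) f)
  | σ, iotaE₁ F t w d e =>
      iotaE₁ (F.subst (upSub σ)) (t.subst σ) (w.subst σ) (psubst σ d) (psubst σ e)
  | σ, iotaE₂ F t w d e f => iotaE₂ (F.subst (upSub σ)) (t.subst σ) (w.subst σ) (psubst σ d)
      (psubst σ e) (psubst σ f)
  | σ, iotaE₃ F t d => iotaE₃ (F.subst (upSub σ)) (t.subst σ) (psubst σ d)

/-- The same deduction, read in a context with one new parameter `0`. -/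
def pshift (d : Ded L) : Ded L := d.psubst (fun i => .var (i + 1))

/-- Rename assumption classes. -/
def hrename : (ℕ → ℕ) → Ded L → Ded L
  | f, hyp i => hyp (f i)
  | f, andI d e => andI (hrename f d) (hrename f e)
  | f, andE₁ A B d => andE₁ A B (hrename f d)
  | f, andE₂ A B d => andE₂ A B (hrename f d)
  | f, orI₁ B d => orI₁ B (hrename f d)
  | f, orI₂ A d => orI₂ A (hrename f d)
  | f, orE A B C d e₁ e₂ =>
      orE A B C (hrename f d) (hrename (upRen f) e₁) (hrename (upRen f) e₂)
  | f, impI A d => impI A (hrename (upRen f) d)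
  | f, impE A B d e => impE A B (hrename f d) (hrename f e)
  | f, botE A d => botE A (hrename f d)
  | f, allI A d => allI A (hrename (upRen f) d)
  | f, allE A t d e => allE A t (hrename f d) (hrename f e)
  | f, exI A t d e => exI A t (hrename f d) (hrename f e)
  | f, exE A C d e => exE A C (hrename f d) (hrename (upRen (upRen f)) e)
  | f, eqI t C d e => eqI t C (hrename f d) (hrename (upRen f) e)
  | f, eqE A s t d e => eqE A s t (hrename f d) (hrename f e)
  | f, ad A r d => ad A r (hrename f d)
  | f, iotaI F t d e g =>
      iotaI F t (hrename f d) (hrename (upRen f) e) (hrename (upRen (upRen f)) g)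
  | f, iotaE₁ F t w d e => iotaE₁ F t w (hrename f d) (hrename f e)
  | f, iotaE₂ F t w d e g => iotaE₂ F t w (hrename f d) (hrename f e) (hrename f g)
  | f, iotaE₃ F t d => iotaE₃ F t (hrename f d)

/-- The same deduction, read in a context with `n` new assumption classes `0, …, n - 1`. -/
def hshift (n : ℕ) (d : Ded L) : Ded L := d.hrename (fun i => i + n)

/-- The substitution for assumptions that is induced in the scope of a new assumption class. -/
def upH (τ : ℕ → Ded L) : ℕ → Ded L := scons (hyp 0) (fun i => (τ i).hshift 1)

/-- The substitution for assumptions that is induced in the scope of a new parameter. -/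
def upP (τ : ℕ → Ded L) : ℕ → Ded L := fun i => (τ i).pshift

/-- Use the deduction `τ i` to conclude the assumptions in the class `i`, for all `i`. -/
def hsubst : (ℕ → Ded L) → Ded L → Ded L
  | τ, hyp i => τ i
  | τ, andI d e => andI (hsubst τ d) (hsubst τ e)
  | τ, andE₁ A B d => andE₁ A B (hsubst τ d)
  | τ, andE₂ A B d => andE₂ A B (hsubst τ d)
  | τ, orI₁ B d => orI₁ B (hsubst τ d)
  | τ, orI₂ A d => orI₂ A (hsubst τ d)
  | τ, orE A B C d e₁ e₂ => orE A B C (hsubst τ d) (hsubst (upH τ) e₁) (hsubst (upH τ) e₂)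
  | τ, impI A d => impI A (hsubst (upH τ) d)
  | τ, impE A B d e => impE A B (hsubst τ d) (hsubst τ e)
  | τ, botE A d => botE A (hsubst τ d)
  | τ, allI A d => allI A (hsubst (upH (upP τ)) d)
  | τ, allE A t d e => allE A t (hsubst τ d) (hsubst τ e)
  | τ, exI A t d e => exI A t (hsubst τ d) (hsubst τ e)
  | τ, exE A C d e => exE A C (hsubst τ d) (hsubst (upH (upH (upP τ))) e)
  | τ, eqI t C d e => eqI t C (hsubst τ d) (hsubst (upH (upP τ)) e)
  | τ, eqE A s t d e => eqE A s t (hsubst τ d) (hsubst τ e)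
  | τ, ad A r d => ad A r (hsubst τ d)
  | τ, iotaI F t d e g =>
      iotaI F t (hsubst τ d) (hsubst (upH (upP τ)) e) (hsubst (upH (upH (upP τ))) g)
  | τ, iotaE₁ F t w d e => iotaE₁ F t w (hsubst τ d) (hsubst τ e)
  | τ, iotaE₂ F t w d e g => iotaE₂ F t w (hsubst τ d) (hsubst τ e) (hsubst τ g)
  | τ, iotaE₃ F t d => iotaE₃ F t (hsubst τ d)

/-- Substitute the term `t` for the parameter `0`. -/
def pinst (d : Ded L) (t : Tm L) : Ded L := d.psubst (scons t .var)

/-- Use `e` to conclude the assumptions in the class `0`. -/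
def hinst (d e : Ded L) : Ded L := d.hsubst (scons e hyp)

/-- Use `e₀` and `e₁` to conclude the assumptions in the classes `0` and `1`. -/
def hinst₂ (d e₀ e₁ : Ded L) : Ded L := d.hsubst (scons e₀ (scons e₁ hyp))

/-! ### Reduction -/

/-- An application of a rule with a gap for the deduction of its leftmost premise: an elimination
rule, atomic denotation, or the general introduction rule for identity. -/
inductive Frame (L : Signature.{u, v}) : Type (max u v)
  | andE₁ (A B : Fm L) : Frame L
  | andE₂ (A B : Fm L) : Frame L
  | orE (A B C : Fm L) (e₁ e₂ : Ded L) : Frame L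
  | impE (A B : Fm L) (e : Ded L) : Frame L
  | botE (A : Fm L) : Frame L
  | allE (A : Fm L) (t : Tm L) (e : Ded L) : Frame L
  | exE (A C : Fm L) (e : Ded L) : Frame L
  | eqI (t : Tm L) (C : Fm L) (e : Ded L) : Frame L
  | eqE (A : Fm L) (s t : Tm L) (e : Ded L) : Frame L
  | ad (A : Fm L) (r : Tm L) : Frame L
  | iotaE₁ (F : Fm L) (t w : Tm L) (e : Ded L) : Frame L
  | iotaE₂ (F : Fm L) (t w : Tm L) (e f : Ded L) : Frame L
  | iotaE₃ (F : Fm L) (t : Tm L) : Frame L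

namespace Frame

/-- Fill the gap. -/
def plug (d : Ded L) : Frame L → Ded L
  | andE₁ A B => .andE₁ A B d
  | andE₂ A B => .andE₂ A B d
  | orE A B C e₁ e₂ => .orE A B C d e₁ e₂
  | impE A B e => .impE A B d e
  | botE A => .botE A d
  | allE A t e => .allE A t d e
  | exE A C e => .exE A C d e
  | eqI t C e => .eqI t C d e
  | eqE A s t e => .eqE A s t d e
  | ad A r => .ad A r d
  | iotaE₁ F t w e => .iotaE₁ F t w d e
  | iotaE₂ F t w e f => .iotaE₂ F t w d e f
  | iotaE₃ F t => .iotaE₃ F t d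

/-- The conclusion of the rule. -/
def concl : Frame L → Fm L
  | andE₁ A _ => A
  | andE₂ _ B => B
  | orE _ _ C _ _ => C
  | impE _ B _ => B
  | botE A => A
  | allE A t _ => A.inst t
  | exE _ C _ => C
  | eqI _ C _ => C
  | eqE A _ t _ => A.inst t
  | ad _ r => .exist r
  | iotaE₁ F _ w _ => F.inst w
  | iotaE₂ _ t w _ _ => .eq w t
  | iotaE₃ _ t => .exist t

/-- Substitute terms for parameters. -/
def psubst (σ : ℕ → Tm L) : Frame L → Frame L
  | andE₁ A B => andE₁ (A.subst σ) (B.subst σ)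
  | andE₂ A B => andE₂ (A.subst σ) (B.subst σ)
  | orE A B C e₁ e₂ =>
      orE (A.subst σ) (B.subst σ) (C.subst σ) (e₁.psubst σ) (e₂.psubst σ)
  | impE A B e => impE (A.subst σ) (B.subst σ) (e.psubst σ)
  | botE A => botE (A.subst σ)
  | allE A t e => allE (A.subst (upSub σ)) (t.subst σ) (e.psubst σ)
  | exE A C e => exE (A.subst (upSub σ)) (C.subst σ) (e.psubst (upSub σ))
  | eqI t C e => eqI (t.subst σ) (C.subst σ) (e.psubst (upSub σ))
  | eqE A s t e => eqE (A.subst (upSub σ)) (s.subst σ) (t.subst σ) (e.psubst σ)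
  | ad A r => ad (A.subst σ) (r.subst σ)
  | iotaE₁ F t w e => iotaE₁ (F.subst (upSub σ)) (t.subst σ) (w.subst σ) (e.psubst σ)
  | iotaE₂ F t w e f =>
      iotaE₂ (F.subst (upSub σ)) (t.subst σ) (w.subst σ) (e.psubst σ) (f.psubst σ)
  | iotaE₃ F t => iotaE₃ (F.subst (upSub σ)) (t.subst σ)

/-- The same frame, read in a context with one new parameter `0`. -/
def pshift (E : Frame L) : Frame L := E.psubst (fun i => .var (i + 1))

/-- Rename assumption classes. -/
def hrename (g : ℕ → ℕ) : Frame L → Frame L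
  | orE A B C e₁ e₂ => orE A B C (e₁.hrename (upRen g)) (e₂.hrename (upRen g))
  | impE A B e => impE A B (e.hrename g)
  | allE A t e => allE A t (e.hrename g)
  | exE A C e => exE A C (e.hrename (upRen (upRen g)))
  | eqI t C e => eqI t C (e.hrename (upRen g))
  | eqE A s t e => eqE A s t (e.hrename g)
  | iotaE₁ F t w e => iotaE₁ F t w (e.hrename g)
  | iotaE₂ F t w e f => iotaE₂ F t w (e.hrename g) (f.hrename g)
  | E => E

/-- The same frame, read in a context with `n` new assumption classes `0, …, n - 1`. -/
def hshift (n : ℕ) (E : Frame L) : Frame L := E.hrename (fun i => i + n)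

end Frame

/-- The reduction procedures, applied to a whole deduction. -/
inductive Reduct : Ded L → Ded L → Prop
  /- An introduction rule followed by an elimination rule for the same symbol. -/
  | and₁ {A B d e} : Reduct (andE₁ A B (andI d e)) d
  | and₂ {A B d e} : Reduct (andE₂ A B (andI d e)) e
  | or₁ {A B C d e₁ e₂} : Reduct (orE A B C (orI₁ B d) e₁ e₂) (e₁.hinst d)
  | or₂ {A B C d e₁ e₂} : Reduct (orE A B C (orI₂ A d) e₁ e₂) (e₂.hinst d)
  | imp {A B d e} : Reduct (impE A B (impI A d) e) (d.hinst e)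
  | all {A t d e} : Reduct (allE A t (allI A d) e) ((d.pinst t).hinst e)
  | ex {A t C d p e} : Reduct (exE A C (exI A t d p) e) ((e.pinst t).hinst₂ p d)
  | iota₁ {F t w d e f q} :
      Reduct (iotaE₁ F t w (iotaI F t d e f) q) ((e.pinst w).hinst q)
  | iota₂ {F t w d e f q p} :
      Reduct (iotaE₂ F t w (iotaI F t d e f) q p) ((f.pinst w).hinst₂ p q)
  | iota₃ {F t d e f} : Reduct (iotaE₃ F t (iotaI F t d e f)) d
  /- Permuting an application of a rule upwards. -/
  | perm_orE {E : Frame L} {A B C d e₁ e₂} : Reduct (E.plug (orE A B C d e₁ e₂))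
      (orE A B E.concl d ((E.hshift 1).plug e₁) ((E.hshift 1).plug e₂))
  | perm_exE {E : Frame L} {A C d e} : Reduct (E.plug (exE A C d e))
      (exE A E.concl d ((E.pshift.hshift 2).plug e))
  | perm_eqI {E : Frame L} {t C d e} : Reduct (E.plug (eqI t C d e))
      (eqI t E.concl d ((E.pshift.hshift 1).plug e))
  /- Removing applications of rules that discharge nothing in a subdeduction. -/
  | drop_orE₁ {A B C d} {e₁ e₂ : Ded L} : Reduct (orE A B C d (e₁.hshift 1) e₂) e₁
  | drop_orE₂ {A B C d} {e₁ e₂ : Ded L} : Reduct (orE A B C d e₁ (e₂.hshift 1)) e₂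
  | drop_exE {A C d e} : Reduct (exE A C d (e.pshift.hshift 2)) e
  | drop_eqI {t C d e} : Reduct (eqI t C d (e.pshift.hshift 1)) e
  /- Removing applications of `eqE` with identical minor premise and conclusion. -/
  | drop_eqE {A s t d e} : A.inst s = A.inst t → Reduct (eqE A s t d e) e
  /- Segments linked by `eqE` from which `∃! r` is inferred, or which consist of such formulas. -/
  | eqE_minor {A s t r d e D D'} : Denotes (A.inst t) r (eqE A s t d e) D →
      Denotes (A.inst s) r e D' → Reduct D D'
  | eqE_major {A s t r d e D D'} : Denotes (A.inst t) r (eqE A s t d e) D →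
      Denotes (.eq s t) r d D' → Reduct D D'
  | eqE_exist {w s t d e D} : Denotes (.eq s t) (w.subst (scons t .var)) d D →
      Reduct (eqE (.exist w) s t d e) D
  /- The general introduction rule for identity followed by an inference of `∃! t`, with `t = t`
  as its conclusion or `a = t` as its assumption, and the converse order. -/
  | eqI_denotes {t d e D} : Denotes (.eq t t) t (eqI t (.eq t t) d e) D → Reduct D d
  | eqI_hyp {t C d} {e : Ded L} :
      Reduct (eqI t C d (e.hinst (ad (.eq (.var 0) t.shift) t.shift (hyp 0))))
        (eqI t C d (e.hinst (d.pshift.hshift 1)))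
  | denotes_eqI {t d e D} : Denotes (.eq t t) t d D → Reduct (eqI t (.eq t t) D e) d

/-- One reduction step: a reduction procedure is applied to a subdeduction. -/
inductive Step : Ded L → Ded L → Prop
  | reduct {d d'} : Reduct d d' → Step d d'
  | andI_l {d d' e} : Step d d' → Step (andI d e) (andI d' e)
  | andI_r {d e e'} : Step e e' → Step (andI d e) (andI d e')
  | andE₁ {A B d d'} : Step d d' → Step (andE₁ A B d) (andE₁ A B d')
  | andE₂ {A B d d'} : Step d d' → Step (andE₂ A B d) (andE₂ A B d')
  | orI₁ {B d d'} : Step d d' → Step (orI₁ B d) (orI₁ B d')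
  | orI₂ {A d d'} : Step d d' → Step (orI₂ A d) (orI₂ A d')
  | orE_m {A B C d d' e₁ e₂} : Step d d' → Step (orE A B C d e₁ e₂) (orE A B C d' e₁ e₂)
  | orE_l {A B C d e₁ e₁' e₂} : Step e₁ e₁' → Step (orE A B C d e₁ e₂) (orE A B C d e₁' e₂)
  | orE_r {A B C d e₁ e₂ e₂'} : Step e₂ e₂' → Step (orE A B C d e₁ e₂) (orE A B C d e₁ e₂')
  | impI {A d d'} : Step d d' → Step (impI A d) (impI A d')
  | impE_l {A B d d' e} : Step d d' → Step (impE A B d e) (impE A B d' e)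
  | impE_r {A B d e e'} : Step e e' → Step (impE A B d e) (impE A B d e')
  | botE {A d d'} : Step d d' → Step (botE A d) (botE A d')
  | allI {A d d'} : Step d d' → Step (allI A d) (allI A d')
  | allE_l {A t d d' e} : Step d d' → Step (allE A t d e) (allE A t d' e)
  | allE_r {A t d e e'} : Step e e' → Step (allE A t d e) (allE A t d e')
  | exI_l {A t d d' e} : Step d d' → Step (exI A t d e) (exI A t d' e)
  | exI_r {A t d e e'} : Step e e' → Step (exI A t d e) (exI A t d e')
  | exE_l {A C d d' e} : Step d d' → Step (exE A C d e) (exE A C d' e)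
  | exE_r {A C d e e'} : Step e e' → Step (exE A C d e) (exE A C d e')
  | eqI_l {t C d d' e} : Step d d' → Step (eqI t C d e) (eqI t C d' e)
  | eqI_r {t C d e e'} : Step e e' → Step (eqI t C d e) (eqI t C d e')
  | eqE_l {A s t d d' e} : Step d d' → Step (eqE A s t d e) (eqE A s t d' e)
  | eqE_r {A s t d e e'} : Step e e' → Step (eqE A s t d e) (eqE A s t d e')
  | ad {A r d d'} : Step d d' → Step (ad A r d) (ad A r d')
  | iotaI_l {F t d d' e f} : Step d d' → Step (iotaI F t d e f) (iotaI F t d' e f)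
  | iotaI_m {F t d e e' f} : Step e e' → Step (iotaI F t d e f) (iotaI F t d e' f)
  | iotaI_r {F t d e f f'} : Step f f' → Step (iotaI F t d e f) (iotaI F t d e f')
  | iotaE₁_l {F t w d d' e} : Step d d' → Step (iotaE₁ F t w d e) (iotaE₁ F t w d' e)
  | iotaE₁_r {F t w d e e'} : Step e e' → Step (iotaE₁ F t w d e) (iotaE₁ F t w d e')
  | iotaE₂_l {F t w d d' e f} : Step d d' → Step (iotaE₂ F t w d e f) (iotaE₂ F t w d' e f)
  | iotaE₂_m {F t w d e e' f} : Step e e' → Step (iotaE₂ F t w d e f) (iotaE₂ F t w d e' f)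
  | iotaE₂_r {F t w d e f f'} : Step f f' → Step (iotaE₂ F t w d e f) (iotaE₂ F t w d e f')
  | iotaE₃ {F t d d'} : Step d d' → Step (iotaE₃ F t d) (iotaE₃ F t d')

/-- `D.ReducesTo D'`: a finite sequence of reduction steps leads from `D` to `D'`. -/
def ReducesTo (D D' : Ded L) : Prop := Relation.ReflTransGen Step D D'

end Ded

/-- The index `0` is the term `r`, or does not occur in it: it does not occur inside a description
term. -/
def Tm.IsPlainIn (r : Tm L) : Prop := r = .var 0 ∨ ∃ r' : Tm L, r = r'.shift

/-- The replaced variable of an atomic formula occurs in it only as an argument. -/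
def Fm.IsPlainIn : Fm L → Prop
  | .pred _ ts => ∀ i, (ts i).IsPlainIn
  | .exist t => t.IsPlainIn
  | .eq s t => s.IsPlainIn ∧ t.IsPlainIn
  | _ => False

/-- In all applications of `eqE`, terms are replaced only where they are arguments of the predicate
letter, of `∃!` or of `=`, not inside description terms. -/
def Ded.PlainEqE (D : Ded L) : Prop := ∀ k A s t d e, D.Occurs k (.eqE A s t d e) → A.IsPlainIn

end FreeLogic

/-!
The proof is by computability predicates, followed by two passes that concern the general
introduction rule for identity.

**Replacement inside descriptions.**  `eqE` restricted to arguments of atomic formulas already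
derives replacement everywhere (`Fm.prov_of_link`): if `ιxF` denotes `a`, a description `ιxF'` of
the replaced formula denotes `a` as well, by the introduction and elimination rules for
descriptions, and `ιxF = a` for some `a` may be assumed by the general introduction rule for
identity.  So every derivable formula has a deduction in the sense of `PlainProves`
(`Prov.of_proves`), and only such deductions need to be reduced to normal form.

**Computability.**  An induction on the degree of maximal formulas is obstructed by `eqE`.  When a
term is substituted for an eigenparameter, an application of `eqE` may come to have identical minor
premise and conclusion.  It is then removed, and removing it may bring an introduction of a
description into contact with an elimination rule for it, where the described formula is of any
complexity.  A Kripke style predicate avoids this: a deduction is computable (`Red`) if after all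
substitutions of atomic terms for its parameters and all renamings of its assumption classes (`Mor`)
it reduces to a value.  In a value, rules that repeat their minor premise lead from the leaves to
the conclusion; their major premises are normal and are concluded neither by an introduction rule
nor by such a rule (`Neutral`).  The leaves are normal and neutral, or introductions with computable
components.  This is a recursion on the skeleton of the formula, which counts the described formula
as a component of `ιxF = t` and is not changed by atomic substitutions, so that the recursion covers
all instances of a quantified formula at once.

A rule applied to a value is permuted up to the leaves (`FrameRed.exists_val`), so that only leaves
have to be considered for each rule.  An inference of `∃! r` does not stop there: it is moved on
from the conclusion of `eqE` to one of its premises (`Denotes.exists_pre`).  All rules preserve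
computability (`PlainProves.red`), and computable deductions reduce to deductions that satisfy the
conditions `Pre` on the leftmost premise of every rule (`PlainProves.exists_pre`).

**The general introduction rule for identity.**  Two kinds of maximal segments are not excluded by
`Pre`.  First, inferences of `∃! t` from assumptions `a = t` discharged by this rule are replaced by
its major premise, in innermost applications first (`PlainProves.exists_cleaned`); that premise is
neutral, hence `Pre` is kept.  Then applications that conclude `t = t` from `∃! t` as inferred from
`t = t` are removed, again innermost first (`PlainProves.exists_collapsed`); the deduction of
`t = t` that remains is not the leftmost premise of any rule, since otherwise a rule that repeats
its minor premise would have concluded a leftmost premise.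

**Normal form.**  By `Pre`, a segment whose last formula is the premise of an elimination rule, of
the general introduction rule for identity as its major premise, or of an inference of `∃! r`, has
length one.  Hence the local conditions exclude all maximal segments (`Pre.isNormal`).
-/

namespace FreeLogic

universe u v

variable {L : Signature.{u, v}}

/-! ### Substitution in terms and formulas -/

@[simp] theorem scons_zero {α : Type*} (a : α) (f : ℕ → α) : scons a f 0 = a := rfl

@[simp] theorem scons_succ {α : Type*} (a : α) (f : ℕ → α) (i : ℕ) :
    scons a f (i + 1) = f i := rfl

theorem upSub_var_comp (f : ℕ → ℕ) :
    upSub (fun i => (.var (f i) : Tm L)) = fun i => .var (upRen f i) := by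
  funext i; cases i <;> rfl

mutual
  theorem Tm.rename_eq_subst (f : ℕ → ℕ) : ∀ t : Tm L, t.rename f = t.subst (fun i => .var (f i))
    | .var _ => rfl
    | .const _ => rfl
    | .iota F => by
        rw [Tm.rename, Tm.subst, Fm.rename_eq_subst (upRen f) F, upSub_var_comp]
  theorem Fm.rename_eq_subst (f : ℕ → ℕ) : ∀ A : Fm L, A.rename f = A.subst (fun i => .var (f i))
    | .bot => rfl
    | .pred P ts => by
        simp only [Fm.rename, Fm.subst]
        exact congrArg _ (funext fun i => Tm.rename_eq_subst f (ts i))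
    | .exist t => by simp only [Fm.rename, Fm.subst, Tm.rename_eq_subst f t]
    | .eq s t => by simp only [Fm.rename, Fm.subst, Tm.rename_eq_subst f s, Tm.rename_eq_subst f t]
    | .and A B | .or A B | .imp A B => by
        simp only [Fm.rename, Fm.subst, Fm.rename_eq_subst f A, Fm.rename_eq_subst f B]
    | .all A | .ex A => by
        simp only [Fm.rename, Fm.subst, Fm.rename_eq_subst (upRen f) A, upSub_var_comp]
end

theorem upSub_comp_upRen (σ : ℕ → Tm L) (f : ℕ → ℕ) :
    (fun i => upSub σ (upRen f i)) = upSub (fun i => σ (f i)) := by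
  funext i; cases i <;> rfl

mutual
  theorem Tm.subst_rename (σ : ℕ → Tm L) (f : ℕ → ℕ) :
      ∀ t : Tm L, (t.rename f).subst σ = t.subst (fun i => σ (f i))
    | .var _ => rfl
    | .const _ => rfl
    | .iota F => by
        simp only [Tm.rename, Tm.subst, Fm.subst_rename (upSub σ) (upRen f) F, upSub_comp_upRen]
  theorem Fm.subst_rename (σ : ℕ → Tm L) (f : ℕ → ℕ) :
      ∀ A : Fm L, (A.rename f).subst σ = A.subst (fun i => σ (f i))
    | .bot => rfl
    | .pred P ts => by
        simp only [Fm.rename, Fm.subst]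
        exact congrArg _ (funext fun i => Tm.subst_rename σ f (ts i))
    | .exist t => by simp only [Fm.rename, Fm.subst, Tm.subst_rename σ f t]
    | .eq s t => by simp only [Fm.rename, Fm.subst, Tm.subst_rename σ f s, Tm.subst_rename σ f t]
    | .and A B | .or A B | .imp A B => by
        simp only [Fm.rename, Fm.subst, Fm.subst_rename σ f A, Fm.subst_rename σ f B]
    | .all A | .ex A => by
        simp only [Fm.rename, Fm.subst, Fm.subst_rename (upSub σ) (upRen f) A, upSub_comp_upRen]
end

theorem Tm.shift_eq_subst (t : Tm L) : t.shift = t.subst (fun i => .var (i + 1)) :=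
  Tm.rename_eq_subst _ t

theorem Fm.shift_eq_subst (A : Fm L) : A.shift = A.subst (fun i => .var (i + 1)) :=
  Fm.rename_eq_subst _ A

theorem upSub_comp_rename (σ : ℕ → Tm L) (f : ℕ → ℕ) :
    (fun i => (upSub σ i).rename (upRen f)) = upSub (fun i => (σ i).rename f) := by
  funext i
  cases i with
  | zero => rfl
  | succ i =>
    simp only [upSub, scons_succ, Tm.shift, Tm.rename_eq_subst (upRen f), Tm.subst_rename,
      Tm.rename_eq_subst Nat.succ ((σ i).rename f)]
    rfl

mutual
  theorem Tm.rename_subst (f : ℕ → ℕ) (σ : ℕ → Tm L) :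
      ∀ t : Tm L, (t.subst σ).rename f = t.subst (fun i => (σ i).rename f)
    | .var _ => rfl
    | .const _ => rfl
    | .iota F => by
        simp only [Tm.rename, Tm.subst, Fm.rename_subst (upRen f) (upSub σ) F, upSub_comp_rename]
  theorem Fm.rename_subst (f : ℕ → ℕ) (σ : ℕ → Tm L) :
      ∀ A : Fm L, (A.subst σ).rename f = A.subst (fun i => (σ i).rename f)
    | .bot => rfl
    | .pred P ts => by
        simp only [Fm.rename, Fm.subst]
        exact congrArg _ (funext fun i => Tm.rename_subst f σ (ts i))
    | .exist t => by simp only [Fm.rename, Fm.subst, Tm.rename_subst f σ t]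
    | .eq s t => by simp only [Fm.rename, Fm.subst, Tm.rename_subst f σ s, Tm.rename_subst f σ t]
    | .and A B | .or A B | .imp A B => by
        simp only [Fm.rename, Fm.subst, Fm.rename_subst f σ A, Fm.rename_subst f σ B]
    | .all A | .ex A => by
        simp only [Fm.rename, Fm.subst, Fm.rename_subst (upRen f) (upSub σ) A, upSub_comp_rename]
end

theorem upSub_comp_subst (σ σ' : ℕ → Tm L) :
    (fun i => (upSub σ i).subst (upSub σ')) = upSub (fun i => (σ i).subst σ') := by
  funext i
  cases i with
  | zero => rfl
  | succ i =>
    simp only [upSub, scons_succ, Tm.shift, Tm.subst_rename, Tm.rename_subst]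

mutual
  theorem Tm.subst_subst (σ' σ : ℕ → Tm L) :
      ∀ t : Tm L, (t.subst σ).subst σ' = t.subst (fun i => (σ i).subst σ')
    | .var _ => rfl
    | .const _ => rfl
    | .iota F => by
        simp only [Tm.subst, Fm.subst_subst (upSub σ') (upSub σ) F, upSub_comp_subst]
  theorem Fm.subst_subst (σ' σ : ℕ → Tm L) :
      ∀ A : Fm L, (A.subst σ).subst σ' = A.subst (fun i => (σ i).subst σ')
    | .bot => rfl
    | .pred P ts => by
        simp only [Fm.subst]
        exact congrArg _ (funext fun i => Tm.subst_subst σ' σ (ts i))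
    | .exist t => by simp only [Fm.subst, Tm.subst_subst σ' σ t]
    | .eq s t => by simp only [Fm.subst, Tm.subst_subst σ' σ s, Tm.subst_subst σ' σ t]
    | .and A B | .or A B | .imp A B => by
        simp only [Fm.subst, Fm.subst_subst σ' σ A, Fm.subst_subst σ' σ B]
    | .all A | .ex A => by
        simp only [Fm.subst, Fm.subst_subst (upSub σ') (upSub σ) A, upSub_comp_subst]
end

@[simp] theorem upSub_var : upSub (Tm.var : ℕ → Tm L) = Tm.var := by
  funext i; cases i <;> rfl

mutual
  @[simp] theorem Tm.subst_var : ∀ t : Tm L, t.subst .var = t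
    | .var _ => rfl
    | .const _ => rfl
    | .iota F => by rw [Tm.subst, upSub_var, Fm.subst_var F]
  @[simp] theorem Fm.subst_var : ∀ A : Fm L, A.subst .var = A
    | .bot => rfl
    | .pred P ts => by
        rw [Fm.subst]
        exact congrArg _ (funext fun i => Tm.subst_var (ts i))
    | .exist t => by rw [Fm.subst, Tm.subst_var t]
    | .eq s t => by rw [Fm.subst, Tm.subst_var s, Tm.subst_var t]
    | .and A B | .or A B | .imp A B => by rw [Fm.subst, Fm.subst_var A, Fm.subst_var B]
    | .all A | .ex A => by rw [Fm.subst, upSub_var, Fm.subst_var A]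
end

theorem scons_comp_subst (t : Tm L) (σ σ' : ℕ → Tm L) :
    (fun i => (scons t σ i).subst σ') = scons (t.subst σ') (fun i => (σ i).subst σ') := by
  funext i; cases i <;> rfl

theorem upSub_comp_scons (t : Tm L) (σ σ' : ℕ → Tm L) :
    (fun i => (upSub σ i).subst (scons t σ')) = scons t (fun i => (σ i).subst σ') := by
  funext i
  cases i with
  | zero => rfl
  | succ i => simp only [upSub, scons_succ, Tm.shift, Tm.subst_rename]

theorem Tm.shift_subst_scons (r t : Tm L) (σ : ℕ → Tm L) :
    r.shift.subst (scons t σ) = r.subst σ := by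
  rw [Tm.shift, Tm.subst_rename]; rfl

theorem Fm.shift_subst_scons (A : Fm L) (t : Tm L) (σ : ℕ → Tm L) :
    A.shift.subst (scons t σ) = A.subst σ := by
  rw [Fm.shift, Fm.subst_rename]; rfl

theorem Tm.shift_subst_upSub (r : Tm L) (σ : ℕ → Tm L) :
    r.shift.subst (upSub σ) = (r.subst σ).shift := by
  rw [Tm.shift, Tm.subst_rename, Tm.shift, Tm.rename_subst]; rfl

theorem Fm.shift_subst_upSub (A : Fm L) (σ : ℕ → Tm L) :
    A.shift.subst (upSub σ) = (A.subst σ).shift := by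
  rw [Fm.shift, Fm.subst_rename, Fm.shift, Fm.rename_subst]; rfl

theorem Fm.inst_subst (A : Fm L) (t : Tm L) (σ : ℕ → Tm L) :
    (A.inst t).subst σ = (A.subst (upSub σ)).inst (t.subst σ) := by
  simp only [Fm.inst, Fm.subst_subst, upSub_comp_scons, scons_comp_subst, Tm.subst, Tm.subst_var]

theorem Tm.shift_inst (r t : Tm L) : r.shift.subst (scons t .var) = r := by
  rw [Tm.shift_subst_scons, Tm.subst_var]

theorem Fm.shift_inst (A : Fm L) (t : Tm L) : A.shift.inst t = A := by
  rw [Fm.inst, Fm.shift_subst_scons, Fm.subst_var]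

theorem scons_var_succ : scons (.var 0) (fun i => (.var (i + 1) : Tm L)) = .var := by
  funext i; cases i <;> rfl

/-- Substitutions by parameters and constants. -/
def AtomicSub (σ : ℕ → Tm L) : Prop := ∀ i, (σ i).IsAtomic

theorem Tm.isAtomic_var (i : ℕ) : (Tm.var i : Tm L).IsAtomic := id

theorem atomicSub_var_comp (f : ℕ → ℕ) : AtomicSub (fun i => (.var (f i) : Tm L)) := fun _ => id

theorem atomicSub_var : AtomicSub (Tm.var : ℕ → Tm L) := fun _ => id

theorem AtomicSub.scons {t : Tm L} {σ : ℕ → Tm L} (ht : t.IsAtomic) (hσ : AtomicSub σ) :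
    AtomicSub (scons t σ) := by
  intro i; cases i
  · exact ht
  · exact hσ _

theorem Tm.isIota_subst {σ : ℕ → Tm L} (hσ : AtomicSub σ) (t : Tm L) :
    (t.subst σ).IsIota ↔ t.IsIota := by
  cases t with
  | var i => exact iff_of_false (hσ i) id
  | const c => exact Iff.rfl
  | iota F => exact Iff.rfl

theorem Tm.IsAtomic.subst {σ : ℕ → Tm L} (hσ : AtomicSub σ) {t : Tm L} (ht : t.IsAtomic) :
    (t.subst σ).IsAtomic := fun h => ht ((Tm.isIota_subst hσ t).1 h)

theorem Tm.isIota_shift (t : Tm L) : t.shift.IsIota ↔ t.IsIota := by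
  rw [Tm.shift_eq_subst]; exact Tm.isIota_subst (atomicSub_var_comp _) t

theorem Tm.IsAtomic.shift {t : Tm L} (ht : t.IsAtomic) : t.shift.IsAtomic :=
  fun h => ht ((Tm.isIota_shift t).1 h)

theorem AtomicSub.comp {σ σ' : ℕ → Tm L} (hσ' : AtomicSub σ') (hσ : AtomicSub σ) :
    AtomicSub (fun i => (σ i).subst σ') := fun i => (hσ i).subst hσ'

theorem AtomicSub.upSub {σ : ℕ → Tm L} (hσ : AtomicSub σ) : AtomicSub (upSub σ) :=
  AtomicSub.scons id fun i => (hσ i).shift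

theorem Fm.IsPrime.subst {A : Fm L} (h : A.IsPrime) {σ : ℕ → Tm L} (hσ : AtomicSub σ) :
    (A.subst σ).IsPrime := by
  cases A with
  | pred P ts => exact fun i => (h i).subst hσ
  | exist t => exact Tm.IsAtomic.subst hσ h
  | eq s t => exact ⟨h.1.subst hσ, h.2.subst hσ⟩
  | _ => exact h.elim

theorem Tm.IsPlainIn.subst {r : Tm L} (h : r.IsPlainIn) (σ : ℕ → Tm L) :
    (r.subst (upSub σ)).IsPlainIn := by
  rcases h with rfl | ⟨r, rfl⟩
  · exact Or.inl rfl
  · exact Or.inr ⟨_, Tm.shift_subst_upSub r σ⟩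

theorem Fm.IsPlainIn.subst {A : Fm L} (h : A.IsPlainIn) (σ : ℕ → Tm L) :
    (A.subst (FreeLogic.upSub σ)).IsPlainIn := by
  cases A with
  | pred P ts => exact fun i => (h i).subst σ
  | exist t => exact Tm.IsPlainIn.subst h σ
  | eq s t => exact ⟨h.1.subst σ, h.2.subst σ⟩
  | _ => exact h.elim

theorem Fm.IsPlainIn.isAtomic {A : Fm L} (h : A.IsPlainIn) : A.IsAtomic := by
  cases A <;> trivial

theorem Fm.DenotesAD.subst {A : Fm L} {r : Tm L} (h : A.DenotesAD r) {σ : ℕ → Tm L}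
    (hσ : AtomicSub σ) : (A.subst σ).DenotesAD (r.subst σ) := by
  cases A with
  | pred P ts => obtain ⟨i, rfl⟩ := h; exact ⟨i, rfl⟩
  | eq s t =>
    rcases h with rfl | ⟨rfl, h⟩
    · exact Or.inl rfl
    · exact Or.inr ⟨rfl, fun h' => h ((Tm.isIota_subst hσ s).1 h')⟩
  | _ => exact h.elim

/-! ### Substitution in deductions -/

namespace Ded

theorem psubst_psubst (σ' σ : ℕ → Tm L) (d : Ded L) :
    (d.psubst σ).psubst σ' = d.psubst (fun i => (σ i).subst σ') := by
  induction d generalizing σ σ' <;>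
    simp only [psubst, Fm.subst_subst, Tm.subst_subst, upSub_comp_subst, *]

@[simp] theorem psubst_var (d : Ded L) : d.psubst .var = d := by
  induction d <;> simp only [psubst, Fm.subst_var, Tm.subst_var, upSub_var, *]

theorem upRen_comp_upRen (g f : ℕ → ℕ) :
    (fun i => upRen g (upRen f i)) = upRen (fun i => g (f i)) := by
  funext i; cases i <;> rfl

theorem hrename_hrename (g f : ℕ → ℕ) (d : Ded L) :
    (d.hrename f).hrename g = d.hrename (fun i => g (f i)) := by
  induction d generalizing f g <;> simp only [hrename, upRen_comp_upRen, *]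

theorem psubst_hrename (σ : ℕ → Tm L) (f : ℕ → ℕ) (d : Ded L) :
    (d.hrename f).psubst σ = (d.psubst σ).hrename f := by
  induction d generalizing f σ <;> simp only [hrename, psubst, *]

theorem upH_comp_upRen (τ : ℕ → Ded L) (f : ℕ → ℕ) :
    (fun i => upH τ (upRen f i)) = upH (fun i => τ (f i)) := by
  funext i; cases i <;> rfl

theorem upP_comp (τ : ℕ → Ded L) (f : ℕ → ℕ) :
    (fun i => upP τ (f i)) = upP (fun i => τ (f i)) := rfl

theorem hsubst_hrename (τ : ℕ → Ded L) (f : ℕ → ℕ) (d : Ded L) :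
    (d.hrename f).hsubst τ = d.hsubst (fun i => τ (f i)) := by
  induction d generalizing f τ <;>
    simp only [hrename, hsubst, upH_comp_upRen, upP_comp, *]

theorem hshift_hrename_upRen (f : ℕ → ℕ) (d : Ded L) :
    (d.hshift 1).hrename (upRen f) = (d.hrename f).hshift 1 := by
  simp only [hshift, hrename_hrename]; rfl

theorem upH_comp_hrename (τ : ℕ → Ded L) (f : ℕ → ℕ) :
    (fun i => (upH τ i).hrename (upRen f)) = upH (fun i => (τ i).hrename f) := by
  funext i
  cases i with
  | zero => rfl
  | succ i => exact hshift_hrename_upRen f (τ i)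

theorem upP_comp_hrename (τ : ℕ → Ded L) (f : ℕ → ℕ) :
    (fun i => (upP τ i).hrename f) = upP (fun i => (τ i).hrename f) := by
  funext i; exact (psubst_hrename _ _ _).symm

theorem hrename_hsubst (f : ℕ → ℕ) (τ : ℕ → Ded L) (d : Ded L) :
    (d.hsubst τ).hrename f = d.hsubst (fun i => (τ i).hrename f) := by
  induction d generalizing f τ <;>
    simp only [hrename, hsubst, upH_comp_hrename, upP_comp_hrename, *]

theorem upH_comp_psubst (τ : ℕ → Ded L) (σ : ℕ → Tm L) :
    (fun i => (upH τ i).psubst σ) = upH (fun i => (τ i).psubst σ) := by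
  funext i
  cases i with
  | zero => rfl
  | succ i => exact psubst_hrename _ _ _

theorem pshift_psubst_upSub (d : Ded L) (σ : ℕ → Tm L) :
    d.pshift.psubst (upSub σ) = (d.psubst σ).pshift := by
  simp only [pshift, psubst_psubst]
  congr 1; funext i; exact Tm.shift_eq_subst _

theorem upP_comp_psubst (τ : ℕ → Ded L) (σ : ℕ → Tm L) :
    (fun i => (upP τ i).psubst (upSub σ)) = upP (fun i => (τ i).psubst σ) := by
  funext i; exact pshift_psubst_upSub _ _

theorem psubst_hsubst (σ : ℕ → Tm L) (τ : ℕ → Ded L) (d : Ded L) :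
    (d.hsubst τ).psubst σ = (d.psubst σ).hsubst (fun i => (τ i).psubst σ) := by
  induction d generalizing σ τ <;>
    simp only [psubst, hsubst, upH_comp_psubst, upP_comp_psubst, *]

theorem upH_comp_hsubst (τ' τ : ℕ → Ded L) :
    (fun i => (upH τ i).hsubst (upH τ')) = upH (fun i => (τ i).hsubst τ') := by
  funext i
  cases i with
  | zero => rfl
  | succ i => simp only [upH, scons_succ, hshift, hsubst_hrename, hrename_hsubst]

theorem upP_comp_hsubst (τ' τ : ℕ → Ded L) :
    (fun i => (upP τ i).hsubst (upP τ')) = upP (fun i => (τ i).hsubst τ') := by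
  funext i; exact (psubst_hsubst _ _ _).symm

theorem hsubst_hsubst (τ' τ : ℕ → Ded L) (d : Ded L) :
    (d.hsubst τ).hsubst τ' = d.hsubst (fun i => (τ i).hsubst τ') := by
  induction d generalizing τ' τ <;>
    simp only [hsubst, upH_comp_hsubst, upP_comp_hsubst, *]

theorem upH_hyp_comp (f : ℕ → ℕ) :
    upH (fun i => (hyp (f i) : Ded L)) = fun i => hyp (upRen f i) := by
  funext i; cases i <;> rfl

theorem upP_hyp_comp (f : ℕ → ℕ) :
    upP (fun i => (hyp (f i) : Ded L)) = fun i => hyp (f i) := rfl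

theorem hrename_eq_hsubst (f : ℕ → ℕ) (d : Ded L) :
    d.hrename f = d.hsubst (fun i => hyp (f i)) := by
  induction d generalizing f <;> simp only [hrename, hsubst, upH_hyp_comp, upP_hyp_comp, *]

@[simp] theorem upH_hyp : upH (hyp : ℕ → Ded L) = hyp := by
  funext i; cases i <;> rfl

@[simp] theorem upP_hyp : upP (hyp : ℕ → Ded L) = hyp := rfl

@[simp] theorem hsubst_hyp (d : Ded L) : d.hsubst hyp = d := by
  induction d <;> simp only [hsubst, upH_hyp, upP_hyp, *]

/-- Substitute simultaneously terms for parameters and deductions for assumptions. -/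
def sub (σ : ℕ → Tm L) (τ : ℕ → Ded L) (d : Ded L) : Ded L := (d.psubst σ).hsubst τ

theorem sub_sub (σ' σ : ℕ → Tm L) (τ' τ : ℕ → Ded L) (d : Ded L) :
    (d.sub σ τ).sub σ' τ' = d.sub (fun i => (σ i).subst σ') (fun i => (τ i).sub σ' τ') := by
  simp only [sub, psubst_hsubst, psubst_psubst, hsubst_hsubst]

@[simp] theorem sub_var_hyp (d : Ded L) : d.sub .var hyp = d := by simp [sub]

theorem pshift_eq_sub (d : Ded L) : d.pshift = d.sub (fun i => .var (i + 1)) hyp := by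
  simp [sub, pshift]

theorem hshift_eq_sub (n : ℕ) (d : Ded L) : d.hshift n = d.sub .var (fun i => hyp (i + n)) := by
  simp [sub, hshift, hrename_eq_hsubst]

theorem upH_comp_scons (τ τ' σ) (p : Ded L) :
    (fun i => (upH τ i).sub σ (scons p τ')) = scons p (fun i => (τ i).sub σ τ') := by
  funext i
  cases i with
  | zero => rfl
  | succ i =>
    simp only [upH, scons_succ, hshift_eq_sub, sub_sub]; rfl

theorem upP_comp_scons (τ τ' σ) (t : Tm L) :
    (fun i => (upP τ i).sub (scons t σ) τ') = fun i => (τ i).sub σ τ' := by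
  funext i
  simp only [upP, pshift_eq_sub, sub_sub]; rfl

/-! ### Reduction sequences -/

namespace ReducesTo

theorem refl (d : Ded L) : ReducesTo d d := Relation.ReflTransGen.refl

theorem trans {d e f : Ded L} (h : ReducesTo d e) (h' : ReducesTo e f) : ReducesTo d f :=
  Relation.ReflTransGen.trans h h'

theorem reduct {d e : Ded L} (h : Reduct d e) : ReducesTo d e :=
  Relation.ReflTransGen.single (.reduct h)

theorem lift {f : Ded L → Ded L} (hf : ∀ {d e}, Step d e → Step (f d) (f e)) {d e : Ded L}
    (h : ReducesTo d e) : ReducesTo (f d) (f e) :=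
  Relation.ReflTransGen.lift f (fun _ _ => hf) _ _ h

theorem andI {d d' e e' : Ded L}
    (h₁ : ReducesTo d d') (h₂ : ReducesTo e e') :
    ReducesTo (.andI d e) (.andI d' e') :=
  (lift (f := fun x => .andI x e) Step.andI_l h₁).trans
    (lift (f := fun x => .andI d' x) Step.andI_r h₂)

theorem andE₁ {A B : Fm L} {d d' : Ded L}
    (h₁ : ReducesTo d d') :
    ReducesTo (.andE₁ A B d) (.andE₁ A B d') :=
  lift (f := fun x => .andE₁ A B x) Step.andE₁ h₁

theorem andE₂ {A B : Fm L} {d d' : Ded L}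
    (h₁ : ReducesTo d d') :
    ReducesTo (.andE₂ A B d) (.andE₂ A B d') :=
  lift (f := fun x => .andE₂ A B x) Step.andE₂ h₁

theorem orI₁ {B : Fm L} {d d' : Ded L}
    (h₁ : ReducesTo d d') :
    ReducesTo (.orI₁ B d) (.orI₁ B d') :=
  lift (f := fun x => .orI₁ B x) Step.orI₁ h₁

theorem orI₂ {A : Fm L} {d d' : Ded L}
    (h₁ : ReducesTo d d') :
    ReducesTo (.orI₂ A d) (.orI₂ A d') :=
  lift (f := fun x => .orI₂ A x) Step.orI₂ h₁

theorem orE {A B C : Fm L} {d d' e e' f f' : Ded L}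
    (h₁ : ReducesTo d d') (h₂ : ReducesTo e e') (h₃ : ReducesTo f f') :
    ReducesTo (.orE A B C d e f) (.orE A B C d' e' f') :=
  ((lift (f := fun x => .orE A B C x e f) Step.orE_m h₁).trans
    (lift (f := fun x => .orE A B C d' x f) Step.orE_l h₂)).trans
    (lift (f := fun x => .orE A B C d' e' x) Step.orE_r h₃)

theorem impI {A : Fm L} {d d' : Ded L}
    (h₁ : ReducesTo d d') :
    ReducesTo (.impI A d) (.impI A d') :=
  lift (f := fun x => .impI A x) Step.impI h₁

theorem impE {A B : Fm L} {d d' e e' : Ded L}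
    (h₁ : ReducesTo d d') (h₂ : ReducesTo e e') :
    ReducesTo (.impE A B d e) (.impE A B d' e') :=
  (lift (f := fun x => .impE A B x e) Step.impE_l h₁).trans
    (lift (f := fun x => .impE A B d' x) Step.impE_r h₂)

theorem botE {A : Fm L} {d d' : Ded L}
    (h₁ : ReducesTo d d') :
    ReducesTo (.botE A d) (.botE A d') :=
  lift (f := fun x => .botE A x) Step.botE h₁

theorem allI {A : Fm L} {d d' : Ded L}
    (h₁ : ReducesTo d d') :
    ReducesTo (.allI A d) (.allI A d') :=
  lift (f := fun x => .allI A x) Step.allI h₁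

theorem allE {A : Fm L} {t : Tm L} {d d' e e' : Ded L}
    (h₁ : ReducesTo d d') (h₂ : ReducesTo e e') :
    ReducesTo (.allE A t d e) (.allE A t d' e') :=
  (lift (f := fun x => .allE A t x e) Step.allE_l h₁).trans
    (lift (f := fun x => .allE A t d' x) Step.allE_r h₂)

theorem exI {A : Fm L} {t : Tm L} {d d' e e' : Ded L}
    (h₁ : ReducesTo d d') (h₂ : ReducesTo e e') :
    ReducesTo (.exI A t d e) (.exI A t d' e') :=
  (lift (f := fun x => .exI A t x e) Step.exI_l h₁).trans
    (lift (f := fun x => .exI A t d' x) Step.exI_r h₂)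

theorem exE {A C : Fm L} {d d' e e' : Ded L}
    (h₁ : ReducesTo d d') (h₂ : ReducesTo e e') :
    ReducesTo (.exE A C d e) (.exE A C d' e') :=
  (lift (f := fun x => .exE A C x e) Step.exE_l h₁).trans
    (lift (f := fun x => .exE A C d' x) Step.exE_r h₂)

theorem eqI {C : Fm L} {t : Tm L} {d d' e e' : Ded L}
    (h₁ : ReducesTo d d') (h₂ : ReducesTo e e') :
    ReducesTo (.eqI t C d e) (.eqI t C d' e') :=
  (lift (f := fun x => .eqI t C x e) Step.eqI_l h₁).trans
    (lift (f := fun x => .eqI t C d' x) Step.eqI_r h₂)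

theorem eqE {A : Fm L} {s t : Tm L} {d d' e e' : Ded L}
    (h₁ : ReducesTo d d') (h₂ : ReducesTo e e') :
    ReducesTo (.eqE A s t d e) (.eqE A s t d' e') :=
  (lift (f := fun x => .eqE A s t x e) Step.eqE_l h₁).trans
    (lift (f := fun x => .eqE A s t d' x) Step.eqE_r h₂)

theorem ad {A : Fm L} {r : Tm L} {d d' : Ded L}
    (h₁ : ReducesTo d d') :
    ReducesTo (.ad A r d) (.ad A r d') :=
  lift (f := fun x => .ad A r x) Step.ad h₁

theorem iotaI {F : Fm L} {t : Tm L} {d d' e e' f f' : Ded L}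
    (h₁ : ReducesTo d d') (h₂ : ReducesTo e e') (h₃ : ReducesTo f f') :
    ReducesTo (.iotaI F t d e f) (.iotaI F t d' e' f') :=
  ((lift (f := fun x => .iotaI F t x e f) Step.iotaI_l h₁).trans
    (lift (f := fun x => .iotaI F t d' x f) Step.iotaI_m h₂)).trans
    (lift (f := fun x => .iotaI F t d' e' x) Step.iotaI_r h₃)

theorem iotaE₁ {F : Fm L} {t w : Tm L} {d d' e e' : Ded L}
    (h₁ : ReducesTo d d') (h₂ : ReducesTo e e') :
    ReducesTo (.iotaE₁ F t w d e) (.iotaE₁ F t w d' e') :=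
  (lift (f := fun x => .iotaE₁ F t w x e) Step.iotaE₁_l h₁).trans
    (lift (f := fun x => .iotaE₁ F t w d' x) Step.iotaE₁_r h₂)

theorem iotaE₂ {F : Fm L} {t w : Tm L} {d d' e e' f f' : Ded L}
    (h₁ : ReducesTo d d') (h₂ : ReducesTo e e') (h₃ : ReducesTo f f') :
    ReducesTo (.iotaE₂ F t w d e f) (.iotaE₂ F t w d' e' f') :=
  ((lift (f := fun x => .iotaE₂ F t w x e f) Step.iotaE₂_l h₁).trans
    (lift (f := fun x => .iotaE₂ F t w d' x f) Step.iotaE₂_m h₂)).trans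
    (lift (f := fun x => .iotaE₂ F t w d' e' x) Step.iotaE₂_r h₃)

theorem iotaE₃ {F : Fm L} {t : Tm L} {d d' : Ded L}
    (h₁ : ReducesTo d d') :
    ReducesTo (.iotaE₃ F t d) (.iotaE₃ F t d') :=
  lift (f := fun x => .iotaE₃ F t x) Step.iotaE₃ h₁

end ReducesTo

/-! ### Deductions in which identity is eliminated from arguments only -/

/-- `PlainProves Γ D A`: `D` is a correct deduction of `A` from `Γ` in whose applications of `eqE`
terms are replaced only where they are arguments of the atomic formula. -/
inductive PlainProves : List (Fm L) → Ded L → Fm L → Prop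
  | hyp {Γ i A} : Γ[i]? = some A → PlainProves Γ (.hyp i) A
  | andI {Γ d e A B} : PlainProves Γ d A → PlainProves Γ e B → PlainProves Γ (.andI d e) (.and A B)
  | andE₁ {Γ d A B} : PlainProves Γ d (.and A B) → PlainProves Γ (.andE₁ A B d) A
  | andE₂ {Γ d A B} : PlainProves Γ d (.and A B) → PlainProves Γ (.andE₂ A B d) B
  | orI₁ {Γ d A B} : PlainProves Γ d A → PlainProves Γ (.orI₁ B d) (.or A B)
  | orI₂ {Γ d A B} : PlainProves Γ d B → PlainProves Γ (.orI₂ A d) (.or A B)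
  | orE {Γ d e₁ e₂ A B C} : PlainProves Γ d (.or A B) → PlainProves (A :: Γ) e₁ C →
      PlainProves (B :: Γ) e₂ C → PlainProves Γ (.orE A B C d e₁ e₂) C
  | impI {Γ d A B} : PlainProves (A :: Γ) d B → PlainProves Γ (.impI A d) (.imp A B)
  | impE {Γ d e A B} : PlainProves Γ d (.imp A B) → PlainProves Γ e A →
      PlainProves Γ (.impE A B d e) B
  | botE {Γ d A} : A.IsPrime → PlainProves Γ d .bot → PlainProves Γ (.botE A d) A
  | allI {Γ d A} : PlainProves (.exist (.var 0) :: Γ.map Fm.shift) d A →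
      PlainProves Γ (.allI A d) (.all A)
  | allE {Γ d e A t} : t.IsAtomic → PlainProves Γ d (.all A) → PlainProves Γ e (.exist t) →
      PlainProves Γ (.allE A t d e) (A.inst t)
  | exI {Γ d e A t} : t.IsAtomic → PlainProves Γ d (A.inst t) → PlainProves Γ e (.exist t) →
      PlainProves Γ (.exI A t d e) (.ex A)
  | exE {Γ d e A C} : PlainProves Γ d (.ex A) →
      PlainProves (.exist (.var 0) :: A :: Γ.map Fm.shift) e C.shift →
        PlainProves Γ (.exE A C d e) C
  | eqI {Γ d e t C} : PlainProves Γ d (.exist t) →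
      PlainProves (.eq (.var 0) t.shift :: Γ.map Fm.shift) e C.shift →
        PlainProves Γ (.eqI t C d e) C
  | eqE {Γ d e A s t} : A.IsPlainIn → PlainProves Γ d (.eq s t) → PlainProves Γ e (A.inst s) →
      PlainProves Γ (.eqE A s t d e) (A.inst t)
  | ad {Γ d A r} : A.DenotesAD r → PlainProves Γ d A → PlainProves Γ (.ad A r d) (.exist r)
  | iotaI {Γ d e f F t} : t.IsAtomic → PlainProves Γ d (.exist t) →
      PlainProves (.eq (.var 0) t.shift :: Γ.map Fm.shift) e F →
      PlainProves (.exist (.var 0) :: F :: Γ.map Fm.shift) f (.eq (.var 0) t.shift) →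
      PlainProves Γ (.iotaI F t d e f) (.eq (.iota F) t)
  | iotaE₁ {Γ d e F t w} : t.IsAtomic → w.IsAtomic → PlainProves Γ d (.eq (.iota F) t) →
      PlainProves Γ e (.eq w t) → PlainProves Γ (.iotaE₁ F t w d e) (F.inst w)
  | iotaE₂ {Γ d e f F t w} : t.IsAtomic → w.IsAtomic → PlainProves Γ d (.eq (.iota F) t) →
      PlainProves Γ e (F.inst w) → PlainProves Γ f (.exist w) →
      PlainProves Γ (.iotaE₂ F t w d e f) (.eq w t)
  | iotaE₃ {Γ d F t} : PlainProves Γ d (.eq (.iota F) t) → PlainProves Γ (.iotaE₃ F t d) (.exist t)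

theorem PlainProves.proves {Γ : List (Fm L)} {D : Ded L} {A : Fm L} (h : PlainProves Γ D A) :
    Proves Γ D A := by
  induction h with
  | hyp h0 => exact .hyp h0
  | andI _ _ ih0 ih1 => exact .andI ih0 ih1
  | andE₁ _ ih0 => exact .andE₁ ih0
  | andE₂ _ ih0 => exact .andE₂ ih0
  | orI₁ _ ih0 => exact .orI₁ ih0
  | orI₂ _ ih0 => exact .orI₂ ih0
  | orE _ _ _ ih0 ih1 ih2 => exact .orE ih0 ih1 ih2
  | impI _ ih0 => exact .impI ih0
  | impE _ _ ih0 ih1 => exact .impE ih0 ih1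
  | botE h0 _ ih1 => exact .botE h0 ih1
  | allI _ ih0 => exact .allI ih0
  | allE h0 _ _ ih1 ih2 => exact .allE h0 ih1 ih2
  | exI h0 _ _ ih1 ih2 => exact .exI h0 ih1 ih2
  | exE _ _ ih0 ih1 => exact .exE ih0 ih1
  | eqI _ _ ih0 ih1 => exact .eqI ih0 ih1
  | eqE h0 _ _ ih1 ih2 => exact .eqE h0.isAtomic ih1 ih2
  | ad h0 _ ih1 => exact .ad h0 ih1
  | iotaI h0 _ _ _ ih1 ih2 ih3 => exact .iotaI h0 ih1 ih2 ih3
  | iotaE₁ h0 h1 _ _ ih2 ih3 => exact .iotaE₁ h0 h1 ih2 ih3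
  | iotaE₂ h0 h1 _ _ _ ih2 ih3 ih4 => exact .iotaE₂ h0 h1 ih2 ih3 ih4
  | iotaE₃ _ ih0 => exact .iotaE₃ ih0

/-! ### Occurrences of subdeductions -/

theorem Occurs.of_premise {D e d : Ded L} {r j k} (h : (r, j, e) ∈ D.premises)
    (h' : e.Occurs k d) : D.Occurs (j + k) d := by
  induction h' with
  | root => simpa using Occurs.premise .root h
  | premise _ h₂ ih => rw [← Nat.add_assoc]; exact .premise ih h₂

theorem PlainEqE.of_premise {D e : Ded L} {r j} (hD : D.PlainEqE) (h : (r, j, e) ∈ D.premises) :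
    e.PlainEqE := fun _ _ _ _ _ _ h' => hD _ _ _ _ _ _ (h'.of_premise h)

theorem Proves.plainProves {Γ : List (Fm L)} {D : Ded L} {A : Fm L} (h : Proves Γ D A)
    (hD : D.PlainEqE) : PlainProves Γ D A := by
  -- The condition is inherited by the first, the second and the third immediate subdeduction.
  have p₁ {D d : Ded L} {r j l} (hD : D.PlainEqE) (h : D.premises = (r, j, d) :: l := by rfl) :
      d.PlainEqE := hD.of_premise (r := r) (j := j) (by simp [h])
  have p₂ {D d : Ded L} {x r j l} (hD : D.PlainEqE)
      (h : D.premises = x :: (r, j, d) :: l := by rfl) : d.PlainEqE :=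
    hD.of_premise (r := r) (j := j) (by simp [h])
  have p₃ {D d : Ded L} {x y r j l} (hD : D.PlainEqE)
      (h : D.premises = x :: y :: (r, j, d) :: l := by rfl) : d.PlainEqE :=
    hD.of_premise (r := r) (j := j) (by simp [h])
  induction h with
  | hyp g0 => exact .hyp g0
  | andI _ _ ih0 ih1 => exact .andI (ih0 (p₁ hD)) (ih1 (p₂ hD))
  | andE₁ _ ih0 => exact .andE₁ (ih0 (p₁ hD))
  | andE₂ _ ih0 => exact .andE₂ (ih0 (p₁ hD))
  | orI₁ _ ih0 => exact .orI₁ (ih0 (p₁ hD))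
  | orI₂ _ ih0 => exact .orI₂ (ih0 (p₁ hD))
  | orE _ _ _ ih0 ih1 ih2 => exact .orE (ih0 (p₁ hD)) (ih1 (p₂ hD)) (ih2 (p₃ hD))
  | impI _ ih0 => exact .impI (ih0 (p₁ hD))
  | impE _ _ ih0 ih1 => exact .impE (ih0 (p₁ hD)) (ih1 (p₂ hD))
  | botE g0 _ ih0 => exact .botE g0 (ih0 (p₁ hD))
  | allI _ ih0 => exact .allI (ih0 (p₁ hD))
  | allE g0 _ _ ih0 ih1 => exact .allE g0 (ih0 (p₁ hD)) (ih1 (p₂ hD))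
  | exI g0 _ _ ih0 ih1 => exact .exI g0 (ih0 (p₁ hD)) (ih1 (p₂ hD))
  | exE _ _ ih0 ih1 => exact .exE (ih0 (p₁ hD)) (ih1 (p₂ hD))
  | eqI _ _ ih0 ih1 => exact .eqI (ih0 (p₁ hD)) (ih1 (p₂ hD))
  | eqE _ _ _ ih0 ih1 => exact .eqE (hD 0 _ _ _ _ _ .root) (ih0 (p₁ hD)) (ih1 (p₂ hD))
  | ad g0 _ ih0 => exact .ad g0 (ih0 (p₁ hD))
  | iotaI g0 _ _ _ ih0 ih1 ih2 => exact .iotaI g0 (ih0 (p₁ hD)) (ih1 (p₂ hD)) (ih2 (p₃ hD))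
  | iotaE₁ g0 g1 _ _ ih0 ih1 => exact .iotaE₁ g0 g1 (ih0 (p₁ hD)) (ih1 (p₂ hD))
  | iotaE₂ g0 g1 _ _ _ ih0 ih1 ih2 => exact .iotaE₂ g0 g1 (ih0 (p₁ hD)) (ih1 (p₂ hD)) (ih2 (p₃ hD))
  | iotaE₃ _ ih0 => exact .iotaE₃ (ih0 (p₁ hD))

/-! ### Contexts -/

/-- A change of contexts from `Γ` to `Δ`: the parameters are replaced by atomic terms and the
assumption classes are renamed. -/
structure Mor (Γ Δ : List (Fm L)) (σ : ℕ → Tm L) (ρ : ℕ → ℕ) : Prop where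
  atomic : AtomicSub σ
  map : ∀ {i B}, Γ[i]? = some B → Δ[ρ i]? = some (B.subst σ)

namespace Mor

variable {Γ Δ Θ : List (Fm L)} {σ σ' : ℕ → Tm L} {ρ ρ' : ℕ → ℕ}

theorem refl (Γ : List (Fm L)) : Mor Γ Γ .var id := ⟨atomicSub_var, by simp⟩

theorem comp (h' : Mor Δ Θ σ' ρ') (h : Mor Γ Δ σ ρ) :
    Mor Γ Θ (fun i => (σ i).subst σ') (fun i => ρ' (ρ i)) :=
  ⟨h'.atomic.comp h.atomic, fun hB => by rw [h'.map (h.map hB), Fm.subst_subst]⟩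

theorem cons (h : Mor Γ Δ σ ρ) (A : Fm L) : Mor (A :: Γ) (A.subst σ :: Δ) σ (upRen ρ) :=
  ⟨h.atomic, fun {i _} hB => by
    cases i with
    | zero => simp at hB; subst hB; rfl
    | succ i => exact h.map hB⟩

theorem weaken (h : Mor Γ Δ σ ρ) (A : Fm L) : Mor Γ (A :: Δ) σ (fun i => ρ i + 1) :=
  ⟨h.atomic, fun hB => h.map hB⟩

theorem up (h : Mor Γ Δ σ ρ) : Mor (Γ.map Fm.shift) (Δ.map Fm.shift) (upSub σ) ρ :=
  ⟨h.atomic.upSub, fun {i B} hB => by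
    rw [List.getElem?_map] at hB ⊢
    obtain ⟨B, hB', rfl⟩ := Option.map_eq_some_iff.1 hB
    rw [h.map hB', Fm.shift_subst_upSub]; rfl⟩

theorem shift (Γ : List (Fm L)) : Mor Γ (Γ.map Fm.shift) (fun i => .var (i + 1)) id :=
  ⟨atomicSub_var_comp _, fun {i B} hB => by
    simp [List.getElem?_map, hB, Fm.shift_eq_subst]⟩

end Mor

/-- Replace the parameters by terms and rename the assumption classes. -/
def act (σ : ℕ → Tm L) (ρ : ℕ → ℕ) (d : Ded L) : Ded L := (d.psubst σ).hrename ρ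

theorem act_eq_sub (σ : ℕ → Tm L) (ρ : ℕ → ℕ) (d : Ded L) :
    d.act σ ρ = d.sub σ (fun i => hyp (ρ i)) := hrename_eq_hsubst _ _

theorem act_act (σ' σ : ℕ → Tm L) (ρ' ρ : ℕ → ℕ) (d : Ded L) :
    (d.act σ ρ).act σ' ρ' = d.act (fun i => (σ i).subst σ') (fun i => ρ' (ρ i)) := by
  simp only [act, psubst_hrename, psubst_psubst, hrename_hrename]

@[simp] theorem act_var_id (d : Ded L) : d.act .var id = d := by
  rw [act_eq_sub]; exact sub_var_hyp d

theorem PlainProves.act {Γ : List (Fm L)} {D : Ded L} {A : Fm L} (h : PlainProves Γ D A)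
    {Δ σ ρ} (m : Mor Γ Δ σ ρ) : PlainProves Δ (D.act σ ρ) (A.subst σ) := by
  induction h generalizing Δ σ ρ with
  | hyp h => exact .hyp (m.map h)
  | andI _ _ ih₁ ih₂ => exact .andI (ih₁ m) (ih₂ m)
  | andE₁ _ ih => exact .andE₁ (ih m)
  | andE₂ _ ih => exact .andE₂ (ih m)
  | orI₁ _ ih => exact .orI₁ (ih m)
  | orI₂ _ ih => exact .orI₂ (ih m)
  | orE _ _ _ ih₁ ih₂ ih₃ => exact .orE (ih₁ m) (ih₂ (m.cons _)) (ih₃ (m.cons _))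
  | impI _ ih => exact .impI (ih (m.cons _))
  | impE _ _ ih₁ ih₂ => exact .impE (ih₁ m) (ih₂ m)
  | botE h _ ih => exact .botE (h.subst m.atomic) (ih m)
  | allI _ ih => exact .allI (ih (m.up.cons _))
  | allE h _ _ ih₁ ih₂ =>
    rw [Fm.inst_subst]; exact .allE (h.subst m.atomic) (ih₁ m) (ih₂ m)
  | exI h _ _ ih₁ ih₂ =>
    have h₁ := ih₁ m
    rw [Fm.inst_subst] at h₁
    exact .exI (h.subst m.atomic) h₁ (ih₂ m)
  | exE _ _ ih₁ ih₂ =>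
    have h₂ := ih₂ ((m.up.cons _).cons (.exist (.var 0)))
    rw [Fm.shift_subst_upSub] at h₂
    exact .exE (ih₁ m) h₂
  | @eqI Γ d e t C _ _ ih₁ ih₂ =>
    have h₂ := ih₂ (m.up.cons _)
    rw [Fm.shift_subst_upSub, Fm.subst, Tm.shift_subst_upSub] at h₂
    exact .eqI (ih₁ m) h₂
  | eqE h _ _ ih₁ ih₂ =>
    have h₂ := ih₂ m
    rw [Fm.inst_subst] at h₂ ⊢
    exact .eqE (h.subst _) (ih₁ m) h₂
  | ad h _ ih => exact .ad (h.subst m.atomic) (ih m)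
  | iotaI h _ _ _ ih₁ ih₂ ih₃ =>
    have h₂ := ih₂ (m.up.cons _)
    have h₃ := ih₃ ((m.up.cons _).cons (.exist (.var 0)))
    rw [Fm.subst, Tm.shift_subst_upSub] at h₂ h₃
    exact .iotaI (h.subst m.atomic) (ih₁ m) h₂ h₃
  | iotaE₁ h h' _ _ ih₁ ih₂ =>
    rw [Fm.inst_subst]; exact .iotaE₁ (h.subst m.atomic) (h'.subst m.atomic) (ih₁ m) (ih₂ m)
  | iotaE₂ h h' _ _ _ ih₁ ih₂ ih₃ =>
    have h₂ := ih₂ m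
    rw [Fm.inst_subst] at h₂
    exact .iotaE₂ (h.subst m.atomic) (h'.subst m.atomic) (ih₁ m) h₂ (ih₃ m)
  | iotaE₃ _ ih => exact .iotaE₃ (ih m)

end Ded

/-! ### Leibniz's law from replacement in arguments -/

/-- There is a deduction of `A` from `Γ` in which identity is eliminated from arguments only. -/
def Prov (Γ : List (Fm L)) (A : Fm L) : Prop := ∃ d, Ded.PlainProves Γ d A

namespace Prov

open Ded

variable {Γ Δ : List (Fm L)} {A B C : Fm L} {s t r : Tm L}

theorem hyp {i : ℕ} (h : Γ[i]? = some A) : Prov Γ A := ⟨_, .hyp h⟩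

theorem mor {σ ρ} (h : Prov Γ A) (m : Mor Γ Δ σ ρ) : Prov Δ (A.subst σ) :=
  h.elim fun _ h => ⟨_, h.act m⟩

theorem weaken (h : Prov Γ A) (B : Fm L) : Prov (B :: Γ) A := by
  simpa using h.mor ((Mor.refl Γ).weaken B)

theorem shift (h : Prov Γ A) : Prov (Γ.map Fm.shift) A.shift := by
  rw [Fm.shift_eq_subst]; exact h.mor (Mor.shift Γ)

theorem exist_left : Prov Γ (.eq s t) → Prov Γ (.exist s) := fun ⟨_, h⟩ =>
  ⟨_, .ad (A := .eq s t) (Or.inl rfl) h⟩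

theorem exist_right : Prov Γ (.eq s t) → Prov Γ (.exist t) := fun ⟨_, h⟩ => by
  cases s with
  | iota F => exact ⟨_, .iotaE₃ h⟩
  | var i => exact ⟨_, .ad (A := .eq (.var i) t) (Or.inr ⟨rfl, id⟩) h⟩
  | const c => exact ⟨_, .ad (A := .eq (.const c) t) (Or.inr ⟨rfl, id⟩) h⟩

theorem eqI : Prov Γ (.exist t) → Prov (.eq (.var 0) t.shift :: Γ.map Fm.shift) C.shift →
    Prov Γ C := fun ⟨_, h⟩ ⟨_, h'⟩ => ⟨_, .eqI h h'⟩

/-- Replacement in an atomic formula whose instances are given up to equality. -/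
theorem eqE (hA : A.IsPlainIn) (h : Prov Γ (.eq s t)) (h' : Prov Γ B) (hB : A.inst s = B)
    (hC : A.inst t = C) : Prov Γ C := by
  subst hB hC
  obtain ⟨_, h⟩ := h; obtain ⟨_, h'⟩ := h'
  exact ⟨_, .eqE hA h h'⟩

theorem plainIn_shift (r : Tm L) : r.shift.IsPlainIn := .inr ⟨r, rfl⟩

theorem eq_refl (h : Prov Γ (.exist s)) : Prov Γ (.eq s s) :=
  h.eqI (C := .eq s s) <| eqE (A := .eq (.var 0) s.shift.shift) ⟨.inl rfl, plainIn_shift _⟩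
    (hyp (i := 0) rfl) (hyp (i := 0) rfl) (by simp [Fm.inst, Fm.subst, Tm.subst, Tm.shift_inst])
    (by simp [Fm.inst, Fm.subst, Tm.subst, Tm.shift_inst]; rfl)

theorem eq_symm (h : Prov Γ (.eq s t)) : Prov Γ (.eq t s) :=
  eqE (A := .eq (.var 0) s.shift) ⟨.inl rfl, plainIn_shift _⟩ h h.exist_left.eq_refl
    (by simp [Fm.inst, Fm.subst, Tm.subst, Tm.shift_inst])
    (by simp [Fm.inst, Fm.subst, Tm.subst, Tm.shift_inst])

theorem eq_trans (h : Prov Γ (.eq s t)) (h' : Prov Γ (.eq t r)) : Prov Γ (.eq s r) :=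
  eqE (A := .eq s.shift (.var 0)) ⟨plainIn_shift _, .inl rfl⟩ h' h
    (by simp [Fm.inst, Fm.subst, Tm.subst, Tm.shift_inst])
    (by simp [Fm.inst, Fm.subst, Tm.subst, Tm.shift_inst])

/-- The values of two substitutions are provably identical. -/
def Link (Γ : List (Fm L)) (σ τ : ℕ → Tm L) : Prop := ∀ i, σ i = τ i ∨ Prov Γ (.eq (σ i) (τ i))

namespace Link

variable {σ τ : ℕ → Tm L}

theorem symm (h : Link Γ σ τ) : Link Γ τ σ := fun i => (h i).imp Eq.symm eq_symm

theorem weaken (h : Link Γ σ τ) (B : Fm L) : Link (B :: Γ) σ τ :=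
  fun i => (h i).imp_right fun h => h.weaken B

theorem shift (h : Link Γ σ τ) :
    Link (Γ.map Fm.shift) (fun i => (σ i).shift) (fun i => (τ i).shift) :=
  fun i => (h i).imp (congrArg _) fun h => h.shift

theorem up (h : Link Γ σ τ) : Link (Γ.map Fm.shift) (upSub σ) (upSub τ) := fun i => by
  cases i with
  | zero => exact .inl rfl
  | succ i => exact h.shift i

end Link

theorem rename_upRen_inst (A : Fm L) : (A.rename (upRen Nat.succ)).inst (.var 0) = A := by
  rw [Fm.inst, Fm.subst_rename]
  convert Fm.subst_var A using 2
  funext i; cases i <;> rfl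

/-- If replacement is derivable in the described formula, it is derivable in the description: the
new description denotes the term `t` that the old one denotes. -/
theorem iota_replace {F : Fm L} {σ τ : ℕ → Tm L}
    (ih : ∀ {Γ : List (Fm L)} {σ τ : ℕ → Tm L}, Link Γ σ τ → Prov Γ (F.subst σ) →
      Prov Γ (F.subst τ)) (hl : Link Γ σ τ) (ht : t.IsAtomic)
    (h : Prov Γ (.eq (.iota (F.subst (upSub σ))) t)) :
    Prov Γ (.eq (.iota (F.subst (upSub τ))) t) := by
  have hs : Prov (Γ.map Fm.shift)
      (.eq (.iota ((F.subst (upSub σ)).rename (upRen Nat.succ))) t.shift) := h.shift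
  have h₁ : Prov (.eq (.var 0) t.shift :: Γ.map Fm.shift) (F.subst (upSub τ)) := by
    refine ih (hl.up.weaken _) ?_
    rw [← rename_upRen_inst (F.subst (upSub σ))]
    obtain ⟨_, hs⟩ := hs.weaken (.eq (.var 0) t.shift)
    exact ⟨_, .iotaE₁ ht.shift id hs (.hyp (i := 0) rfl)⟩
  have h₂ : Prov (.exist (.var 0) :: F.subst (upSub τ) :: Γ.map Fm.shift)
      (.eq (.var 0) t.shift) := by
    have h := ih ((hl.up.symm.weaken (F.subst (upSub τ))).weaken (.exist (.var 0)))
      (hyp (i := 1) rfl)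
    rw [← rename_upRen_inst (F.subst (upSub σ))] at h
    obtain ⟨_, h⟩ := h
    obtain ⟨_, hs⟩ := (hs.weaken (F.subst (upSub τ))).weaken (.exist (.var 0))
    exact ⟨_, .iotaE₂ ht.shift id hs h (.hyp (i := 0) rfl)⟩
  obtain ⟨_, h₀⟩ := h.exist_right
  obtain ⟨_, h₁⟩ := h₁
  obtain ⟨_, h₂⟩ := h₂
  exact ⟨_, .iotaI ht h₀ h₁ h₂⟩

/-- The arguments are replaced one at a time, so that each is known to exist when its turn comes. -/
theorem pred_replace {P : L.Pred} {ss ts : Fin (L.arity P) → Tm L}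
    (hl : ∀ i, Prov Γ (.exist (ss i)) → Prov Γ (.eq (ss i) (ts i))) (h : Prov Γ (.pred P ss)) :
    Prov Γ (.pred P ts) := by
  have h' (k : ℕ) : Prov Γ (.pred P fun i => if i.1 < k then ts i else ss i) := by
    induction k with
    | zero => simpa using h
    | succ k ih =>
      by_cases hk : k < L.arity P
      · have he : Prov Γ (.exist (ss ⟨k, hk⟩)) := by
          obtain ⟨_, ih⟩ := ih
          exact ⟨_, .ad (A := .pred P _) (Exists.intro ⟨k, hk⟩ (by simp)) ih⟩
        refine eqE (A := .pred P fun i => if i.1 < k then (ts i).shift else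
          if i.1 = k then .var 0 else (ss i).shift) (fun i => ?_) (hl _ he) ih ?_ ?_
        · dsimp only
          split_ifs
          · exact plainIn_shift _
          · exact .inl rfl
          · exact plainIn_shift _
        all_goals
          simp only [Fm.inst, Fm.subst]
          refine congrArg _ (funext fun i => ?_)
          rcases lt_trichotomy i.1 k with hi | hi | hi
          · simp [hi, Nat.lt_succ_of_lt hi, Tm.shift_inst]
          · obtain rfl : i = ⟨k, hk⟩ := Fin.ext hi
            simp [Tm.subst]
          · simp [hi.not_gt, hi.ne', Tm.shift_inst, show ¬ i.1 < k + 1 by omega]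
      · convert ih using 3 with i
        have := i.2
        simp [show i.1 < k + 1 by omega, show i.1 < k by omega]
  simpa using h' (L.arity P)

end Prov

open Prov in
mutual
  /-- Leibniz's law for terms, in the presence of the existence of the first term. -/
  theorem Tm.prov_eq_of_link : ∀ (r : Tm L) {Γ : List (Fm L)} {σ τ : ℕ → Tm L}, Link Γ σ τ →
      Prov Γ (.exist (r.subst σ)) → Prov Γ (.eq (r.subst σ) (r.subst τ))
    | .var i, Γ, σ, τ, hl, h => by
        rcases hl i with h' | h'
        · have := h.eq_refl
          simp only [Tm.subst] at this ⊢
          rwa [← h']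
        · exact h'
    | .const c, Γ, σ, τ, hl, h => h.eq_refl
    | .iota F, Γ, σ, τ, hl, h => by
        -- The general introduction rule provides a parameter that the first description denotes.
        -- By `iota_replace` the second description denotes it, too.
        refine h.eqI (C := .eq _ _) ?_
        have h₁ : Prov (.eq (.var 0) ((Tm.iota F).subst σ).shift :: Γ.map Fm.shift)
          (.eq ((Tm.iota F).subst σ).shift (.var 0)) := (Prov.hyp (i := 0) rfl).eq_symm
        refine h₁.eq_trans (eq_symm ?_)
        rw [Tm.shift, Tm.rename_subst] at h₁ ⊢
        rw [Tm.rename_subst]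
        exact iota_replace (fun hl h => Fm.prov_of_link F hl h) (hl.shift.weaken _) id h₁
  /-- Leibniz's law for formulas of any form, with replacement inside descriptions. -/
  theorem Fm.prov_of_link : ∀ (A : Fm L) {Γ : List (Fm L)} {σ τ : ℕ → Tm L}, Link Γ σ τ →
      Prov Γ (A.subst σ) → Prov Γ (A.subst τ)
    | .bot, _, _, _, _, h => h
    | .pred P ts, _, _, _, hl, h => pred_replace (fun i => Tm.prov_eq_of_link (ts i) hl) h
    | .exist t, _, _, _, hl, h => (Tm.prov_eq_of_link t hl h).exist_right
    | .eq s t, _, _, _, hl, h =>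
        (Tm.prov_eq_of_link s hl h.exist_left).eq_symm.eq_trans
          (eq_trans h (Tm.prov_eq_of_link t hl h.exist_right))
    | .and A B, _, _, _, hl, ⟨_, h⟩ => by
        obtain ⟨_, h₁⟩ := Fm.prov_of_link A hl ⟨_, .andE₁ h⟩
        obtain ⟨_, h₂⟩ := Fm.prov_of_link B hl ⟨_, .andE₂ h⟩
        exact ⟨_, .andI h₁ h₂⟩
    | .or A B, _, _, _, hl, ⟨_, h⟩ => by
        obtain ⟨_, h₁⟩ := Fm.prov_of_link A (hl.weaken _) (Prov.hyp (i := 0) rfl)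
        obtain ⟨_, h₂⟩ := Fm.prov_of_link B (hl.weaken _) (Prov.hyp (i := 0) rfl)
        exact ⟨_, .orE h (.orI₁ h₁) (.orI₂ h₂)⟩
    | .imp A B, _, _, τ, hl, h => by
        obtain ⟨_, h₁⟩ := Fm.prov_of_link A (hl.symm.weaken (A.subst τ)) (Prov.hyp (i := 0) rfl)
        obtain ⟨_, h⟩ := h.weaken (A.subst τ)
        obtain ⟨_, h₂⟩ := Fm.prov_of_link B (hl.weaken _) ⟨_, .impE h h₁⟩
        exact ⟨_, .impI h₂⟩
    | .all A, _, _, _, hl, h => by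
        obtain ⟨_, h⟩ := h.shift.weaken (.exist (.var 0))
        have h₁ := Ded.PlainProves.allE (Tm.isAtomic_var 0) h (.hyp (i := 0) rfl)
        rw [rename_upRen_inst] at h₁
        obtain ⟨_, h₂⟩ := Fm.prov_of_link A (hl.up.weaken _) ⟨_, h₁⟩
        exact ⟨_, .allI h₂⟩
    | .ex A, Γ, σ, τ, hl, ⟨_, h⟩ => by
        obtain ⟨d, h₁⟩ := Fm.prov_of_link A
          ((hl.up.weaken (A.subst (upSub σ))).weaken (.exist (.var 0))) (Prov.hyp (i := 1) rfl)
        rw [← rename_upRen_inst (A.subst (upSub τ))] at h₁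
        exact ⟨_, .exE h (.exI id h₁ (.hyp (i := 0) rfl))⟩
end

/-- Applications of `eqE` that replace terms inside description terms can be eliminated. -/
theorem Prov.of_proves {Γ : List (Fm L)} {D : Ded L} {A : Fm L} (h : Proves Γ D A) : Prov Γ A := by
  induction h with
  | eqE _ _ _ ih₁ ih₂ =>
    refine Fm.prov_of_link _ (fun i => ?_) ih₂
    cases i with
    | zero => exact .inr ih₁
    | succ i => exact .inl rfl
  | hyp g0 => exact ⟨_, .hyp g0⟩
  | andI _ _ ih1 ih2 => obtain ⟨_, h1⟩ := ih1; obtain ⟨_, h2⟩ := ih2; exact ⟨_, .andI h1 h2⟩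
  | andE₁ _ ih1 => obtain ⟨_, h1⟩ := ih1; exact ⟨_, .andE₁ h1⟩
  | andE₂ _ ih1 => obtain ⟨_, h1⟩ := ih1; exact ⟨_, .andE₂ h1⟩
  | orI₁ _ ih1 => obtain ⟨_, h1⟩ := ih1; exact ⟨_, .orI₁ h1⟩
  | orI₂ _ ih1 => obtain ⟨_, h1⟩ := ih1; exact ⟨_, .orI₂ h1⟩
  | orE _ _ _ ih1 ih2 ih3 =>
    obtain ⟨_, h1⟩ := ih1
    obtain ⟨_, h2⟩ := ih2
    obtain ⟨_, h3⟩ := ih3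
    exact ⟨_, .orE h1 h2 h3⟩
  | impI _ ih1 => obtain ⟨_, h1⟩ := ih1; exact ⟨_, .impI h1⟩
  | impE _ _ ih1 ih2 => obtain ⟨_, h1⟩ := ih1; obtain ⟨_, h2⟩ := ih2; exact ⟨_, .impE h1 h2⟩
  | botE g0 _ ih1 => obtain ⟨_, h1⟩ := ih1; exact ⟨_, .botE g0 h1⟩
  | allI _ ih1 => obtain ⟨_, h1⟩ := ih1; exact ⟨_, .allI h1⟩
  | allE g0 _ _ ih1 ih2 => obtain ⟨_, h1⟩ := ih1; obtain ⟨_, h2⟩ := ih2; exact ⟨_, .allE g0 h1 h2⟩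
  | exI g0 _ _ ih1 ih2 => obtain ⟨_, h1⟩ := ih1; obtain ⟨_, h2⟩ := ih2; exact ⟨_, .exI g0 h1 h2⟩
  | exE _ _ ih1 ih2 => obtain ⟨_, h1⟩ := ih1; obtain ⟨_, h2⟩ := ih2; exact ⟨_, .exE h1 h2⟩
  | eqI _ _ ih1 ih2 => obtain ⟨_, h1⟩ := ih1; obtain ⟨_, h2⟩ := ih2; exact ⟨_, .eqI h1 h2⟩
  | ad g0 _ ih1 => obtain ⟨_, h1⟩ := ih1; exact ⟨_, .ad g0 h1⟩
  | iotaI g0 _ _ _ ih1 ih2 ih3 =>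
    obtain ⟨_, h1⟩ := ih1
    obtain ⟨_, h2⟩ := ih2
    obtain ⟨_, h3⟩ := ih3
    exact ⟨_, .iotaI g0 h1 h2 h3⟩
  | iotaE₁ g0 g1 _ _ ih1 ih2 =>
    obtain ⟨_, h1⟩ := ih1
    obtain ⟨_, h2⟩ := ih2
    exact ⟨_, .iotaE₁ g0 g1 h1 h2⟩
  | iotaE₂ g0 g1 _ _ _ ih1 ih2 ih3 =>
    obtain ⟨_, h1⟩ := ih1
    obtain ⟨_, h2⟩ := ih2
    obtain ⟨_, h3⟩ := ih3
    exact ⟨_, .iotaE₂ g0 g1 h1 h2 h3⟩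
  | iotaE₃ _ ih1 => obtain ⟨_, h1⟩ := ih1; exact ⟨_, .iotaE₃ h1⟩

namespace Ded

/-! ### Frames -/

namespace Frame

/-- Replace the parameters of a frame by terms and rename its assumption classes. -/
def act (σ : ℕ → Tm L) (ρ : ℕ → ℕ) (E : Frame L) : Frame L := (E.psubst σ).hrename ρ

theorem plug_act (E : Frame L) (σ : ℕ → Tm L) (ρ : ℕ → ℕ) (d : Ded L) :
    (E.plug d).act σ ρ = (E.act σ ρ).plug (d.act σ ρ) := by
  cases E <;> rfl

theorem concl_act (E : Frame L) (σ : ℕ → Tm L) (ρ : ℕ → ℕ) :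
    (E.act σ ρ).concl = E.concl.subst σ := by
  cases E <;> first | rfl | exact (Fm.inst_subst _ _ _).symm

theorem act_act (σ' σ : ℕ → Tm L) (ρ' ρ : ℕ → ℕ) (E : Frame L) :
    (E.act σ ρ).act σ' ρ' = E.act (fun i => (σ i).subst σ') (fun i => ρ' (ρ i)) := by
  cases E <;>
    simp only [act, psubst, hrename, Ded.psubst_hrename, Ded.psubst_psubst, Ded.hrename_hrename,
      Fm.subst_subst, Tm.subst_subst, upSub_comp_subst, Ded.upRen_comp_upRen]

@[simp] theorem psubst_var (E : Frame L) : E.psubst .var = E := by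
  cases E <;> simp only [psubst, Fm.subst_var, Tm.subst_var, upSub_var, Ded.psubst_var]

theorem hshift_eq_act (E : Frame L) (n : ℕ) : E.hshift n = E.act .var (fun i => i + n) := by
  rw [act, psubst_var]; rfl

theorem pshift_hshift_eq_act (E : Frame L) (n : ℕ) :
    E.pshift.hshift n = E.act (fun i => .var (i + 1)) (fun i => i + n) := rfl

end Frame

/-! ### Deductions that are normal up to the general introduction rule for identity -/

/-- Classification of the last rule of a deduction: a rule that repeats its minor premise, another
introduction rule, the elimination rule for identity, or none of these. -/
inductive Kind
  | del
  | intro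
  | eqE
  | other

/-- The class of the last rule. -/
def kind : Ded L → Kind
  | orE .. | exE .. | eqI .. => .del
  | andI .. | orI₁ .. | orI₂ .. | impI .. | allI .. | exI .. | iotaI .. => .intro
  | eqE .. => .eqE
  | _ => .other

/-- The last rule is neither an introduction rule nor one that repeats its minor premise. -/
def Neutral (d : Ded L) : Prop := d.kind = .eqE ∨ d.kind = .other

/-- Normality apart from the conditions that concern the general introduction rule for identity,
as a condition on the leftmost premise of every rule: this premise is not concluded by a rule that
repeats its minor premise, nor by an introduction rule when the former rule is an elimination rule
other than `eqE`; no `∃! r` is inferred from the conclusion of `eqE`; and `eqE` neither replaces a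
term by itself nor concludes a formula `∃! r`.  The conclusion of `iotaI` is allowed as the
premise of `eqE`, and of `ad`, which infers from it that the description denotes. -/
def Pre : Ded L → Prop
  | hyp _ => True
  | andI d e => d.Pre ∧ e.Pre
  | andE₁ _ _ d => d.Pre ∧ d.Neutral
  | andE₂ _ _ d => d.Pre ∧ d.Neutral
  | orI₁ _ d => d.Pre
  | orI₂ _ d => d.Pre
  | orE _ _ _ d e₁ e₂ => (d.Pre ∧ d.Neutral) ∧ e₁.Pre ∧ e₂.Pre
  | impI _ d => d.Pre
  | impE _ _ d e => (d.Pre ∧ d.Neutral) ∧ e.Pre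
  | botE _ d => d.Pre ∧ d.Neutral
  | allI _ d => d.Pre
  | allE _ _ d e => (d.Pre ∧ d.Neutral) ∧ e.Pre
  | exI _ _ d e => d.Pre ∧ e.Pre
  | exE _ _ d e => (d.Pre ∧ d.Neutral) ∧ e.Pre
  | eqI _ _ d e => (d.Pre ∧ d.Neutral) ∧ e.Pre
  | eqE A s t d e => (d.Pre ∧ d.kind ≠ .del) ∧ e.Pre ∧ s ≠ t ∧ ∀ w, A ≠ .exist w
  | ad _ _ d => d.Pre ∧ (d.kind = .intro ∨ d.kind = .other)
  | iotaI _ _ d e f => d.Pre ∧ e.Pre ∧ f.Pre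
  | iotaE₁ _ _ _ d e => (d.Pre ∧ d.Neutral) ∧ e.Pre
  | iotaE₂ _ _ _ d e f => (d.Pre ∧ d.Neutral) ∧ e.Pre ∧ f.Pre
  | iotaE₃ _ _ d => d.Pre ∧ d.kind = .other

theorem kind_act (σ : ℕ → Tm L) (ρ : ℕ → ℕ) (d : Ded L) : (d.act σ ρ).kind = d.kind := by
  cases d <;> rfl

/-! ### Inferring existence from normal deductions -/

/-- From `A`, in all changes of contexts, the frame `E` infers `∃! r` by atomic denotation or by the
third elimination rule for descriptions. -/
def DenotesFrame (A : Fm L) (r : Tm L) (E : Frame L) : Prop :=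
  E.concl = .exist r ∧ ∀ {σ : ℕ → Tm L}, AtomicSub σ → ∀ ρ e,
    Denotes (A.subst σ) (r.subst σ) e ((E.act σ ρ).plug e)

theorem Denotes.exists_frame {A : Fm L} {r : Tm L} {d D : Ded L} (h : Denotes A r d D) :
    ∃ E : Frame L, D = E.plug d ∧ DenotesFrame A r E := by
  cases h with
  | ad h => exact ⟨.ad A r, rfl, rfl, fun hσ _ _ => .ad (h.subst hσ)⟩
  | iotaE₃ => exact ⟨.iotaE₃ _ _, rfl, rfl, fun _ _ _ => .iotaE₃⟩

theorem Denotes.plainProves {Γ : List (Fm L)} {A : Fm L} {r : Tm L} {d D : Ded L}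
    (h : Denotes A r d D) (hd : PlainProves Γ d A) : PlainProves Γ D (.exist r) := by
  cases h with
  | ad h => exact .ad h hd
  | iotaE₃ => exact .iotaE₃ hd

theorem Denotes.pre {A : Fm L} {r : Tm L} {d D : Ded L} (h : Denotes A r d D) (hd : d.Pre)
    (hk : d.kind = .other) : D.Pre := by
  cases h with
  | ad h => exact ⟨hd, .inr hk⟩
  | iotaE₃ => exact ⟨hd, hk⟩

/-- `A.HasArg r`: `r` is an argument of the predicate letter or of identity in `A`. -/
def _root_.FreeLogic.Fm.HasArg : Fm L → Tm L → Prop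
  | .pred _ ts, r => ∃ i, ts i = r
  | .eq s t, r => r = s ∨ r = t
  | _, _ => False

theorem _root_.FreeLogic.Fm.HasArg.exists_denotes {A : Fm L} {r : Tm L} (h : A.HasArg r)
    (d : Ded L) : ∃ D, Denotes A r d D := by
  cases A with
  | pred P ts => exact ⟨_, .ad (A := .pred P ts) h⟩
  | eq s t =>
    rcases h with rfl | rfl
    · exact ⟨_, .ad (A := .eq r t) (Or.inl rfl)⟩
    · cases s with
      | iota F => exact ⟨_, .iotaE₃⟩
      | var i => exact ⟨_, .ad (A := .eq (.var i) r) (Or.inr ⟨rfl, id⟩)⟩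
      | const c => exact ⟨_, .ad (A := .eq (.const c) r) (Or.inr ⟨rfl, id⟩)⟩
  | _ => exact h.elim

theorem Denotes.hasArg {A : Fm L} {r : Tm L} {d D : Ded L} (h : Denotes A r d D) :
    A.HasArg r := by
  cases h with
  | ad h =>
    cases A with
    | pred P ts => exact h
    | eq s t => exact Or.imp_right And.left h
    | _ => exact h.elim
  | iotaE₃ => exact Or.inr rfl

theorem _root_.FreeLogic.Tm.IsPlainIn.inst_eq {r : Tm L} (h : r.IsPlainIn) (s t : Tm L) :
    r.subst (scons t .var) = t ∨ r.subst (scons t .var) = r.subst (scons s .var) := by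
  rcases h with rfl | ⟨r, rfl⟩
  · exact .inl rfl
  · exact .inr (by rw [Tm.shift_inst, Tm.shift_inst])

/-- An argument of the conclusion of `eqE` is the replacing term or an argument of the minor
premise. -/
theorem _root_.FreeLogic.Fm.IsPlainIn.hasArg {A : Fm L} (hA : A.IsPlainIn) {s t r : Tm L}
    (h : (A.inst t).HasArg r) : r = t ∨ (A.inst s).HasArg r := by
  cases A with
  | pred P ts =>
    obtain ⟨i, rfl⟩ := h
    exact ((hA i).inst_eq s t).imp_right fun h => ⟨i, h.symm⟩
  | eq u w =>
    rcases h with rfl | rfl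
    · exact (hA.1.inst_eq s t).imp_right fun h => Or.inl h
    · exact (hA.2.inst_eq s t).imp_right fun h => Or.inr h
  | _ => exact h.elim

/-- If `∃! r` is inferred from the conclusion of a normal deduction, then the result can be brought
into normal form: the inference is moved into the minor premises of the rules that repeat them, from
the conclusion of `eqE` to one of its premises, and it is cancelled against the introduction of a
description. -/
theorem Denotes.exists_pre {Γ : List (Fm L)} {A : Fm L} {d : Ded L} (h : PlainProves Γ d A)
    (hd : d.Pre) {r : Tm L} {D : Ded L} (hD : Denotes A r d D) :
    ∃ D', ReducesTo D D' ∧ D'.Pre ∧ PlainProves Γ D' (.exist r) := by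
  induction h generalizing r D with
  | orE h _ _ _ ih₁ ih₂ =>
    obtain ⟨E, rfl, hE, hs⟩ := hD.exists_frame
    replace hs := hs atomicSub_var (fun i => i + 1)
    rw [Fm.subst_var, Tm.subst_var, ← E.hshift_eq_act] at hs
    obtain ⟨e₁, h₁, p₁, q₁⟩ := ih₁ hd.2.1 (hs _)
    obtain ⟨e₂, h₂, p₂, q₂⟩ := ih₂ hd.2.2 (hs _)
    refine ⟨_, (ReducesTo.reduct .perm_orE).trans (.orE (.refl _) h₁ h₂), ⟨hd.1, p₁, p₂⟩, ?_⟩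
    rw [hE]; exact .orE h q₁ q₂
  | exE h _ _ ih =>
    obtain ⟨E, rfl, hE, hs⟩ := hD.exists_frame
    replace hs := hs (atomicSub_var_comp (· + 1)) (fun i => i + 2)
    rw [← Fm.shift_eq_subst] at hs
    obtain ⟨e', h', p, q⟩ := ih hd.2 (hs _)
    refine ⟨_, (ReducesTo.reduct .perm_exE).trans (.exE (.refl _) h'), ⟨hd.1, p⟩, ?_⟩
    rw [hE]; rw [← Tm.shift_eq_subst] at q; exact .exE h q
  | eqI h _ _ ih =>
    obtain ⟨E, rfl, hE, hs⟩ := hD.exists_frame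
    replace hs := hs (atomicSub_var_comp (· + 1)) (fun i => i + 1)
    rw [← Fm.shift_eq_subst] at hs
    obtain ⟨e', h', p, q⟩ := ih hd.2 (hs _)
    refine ⟨_, (ReducesTo.reduct .perm_eqI).trans (.eqI (.refl _) h'), ⟨hd.1, p⟩, ?_⟩
    rw [hE]; rw [← Tm.shift_eq_subst] at q; exact .eqI h q
  | @eqE Γ d e A s t hA h h' ih₁ ih₂ =>
    rcases hA.hasArg (s := s) hD.hasArg with rfl | hr
    · obtain ⟨D₁, hD₁⟩ := Fm.HasArg.exists_denotes (A := .eq s r) (Or.inr rfl) d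
      obtain ⟨D', h₁, p⟩ := ih₁ hd.1.1 hD₁
      exact ⟨D', (ReducesTo.reduct (.eqE_major hD hD₁)).trans h₁, p⟩
    · obtain ⟨D₁, hD₁⟩ := hr.exists_denotes e
      obtain ⟨D', h₁, p⟩ := ih₂ hd.2.1 hD₁
      exact ⟨D', (ReducesTo.reduct (.eqE_minor hD hD₁)).trans h₁, p⟩
  | iotaI ht h₁ h₂ h₃ =>
    cases hD with
    | ad h => exact ⟨_, .refl _, ⟨hd, .inl rfl⟩, .ad h (.iotaI ht h₁ h₂ h₃)⟩
    | iotaE₃ => exact ⟨_, .reduct .iota₃, hd.1, h₁⟩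
  | andI | orI₁ | orI₂ | impI | allI | exI => cases hD with | ad h => exact h.elim
  | hyp h => exact ⟨_, .refl _, hD.pre hd rfl, hD.plainProves (.hyp h)⟩
  | andE₁ h => exact ⟨_, .refl _, hD.pre hd rfl, hD.plainProves (.andE₁ h)⟩
  | andE₂ h => exact ⟨_, .refl _, hD.pre hd rfl, hD.plainProves (.andE₂ h)⟩
  | impE h h' => exact ⟨_, .refl _, hD.pre hd rfl, hD.plainProves (.impE h h')⟩
  | botE h h' => exact ⟨_, .refl _, hD.pre hd rfl, hD.plainProves (.botE h h')⟩
  | allE h h₁ h₂ => exact ⟨_, .refl _, hD.pre hd rfl, hD.plainProves (.allE h h₁ h₂)⟩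
  | ad h h' => exact ⟨_, .refl _, hD.pre hd rfl, hD.plainProves (.ad h h')⟩
  | iotaE₁ h h' h₁ h₂ =>
    exact ⟨_, .refl _, hD.pre hd rfl, hD.plainProves (.iotaE₁ h h' h₁ h₂)⟩
  | iotaE₂ h h' h₁ h₂ h₃ =>
    exact ⟨_, .refl _, hD.pre hd rfl, hD.plainProves (.iotaE₂ h h' h₁ h₂ h₃)⟩
  | iotaE₃ h => exact ⟨_, .refl _, hD.pre hd rfl, hD.plainProves (.iotaE₃ h)⟩

end Ded

/-! ### Skeletons of formulas -/

/-- The logical structure of formulas on which reductions operate: an identity whose left term is a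
description counts as composed of the described formula; other atomic formulas have no structure. -/
inductive Skel
  | atom
  | and (a b : Skel)
  | or (a b : Skel)
  | imp (a b : Skel)
  | all (a : Skel)
  | ex (a : Skel)
  | iota (a : Skel)

mutual
  /-- The skeleton of identities with the given left term. -/
  def Tm.skel : Tm L → Skel
    | .var _ => .atom
    | .const _ => .atom
    | .iota F => .iota F.skel
  /-- The skeleton of a formula. -/
  def Fm.skel : Fm L → Skel
    | .bot => .atom
    | .pred _ _ => .atom
    | .exist _ => .atom
    | .eq s _ => s.skel
    | .and A B => .and A.skel B.skel
    | .or A B => .or A.skel B.skel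
    | .imp A B => .imp A.skel B.skel
    | .all A => .all A.skel
    | .ex A => .ex A.skel
end

theorem Tm.IsAtomic.skel_eq {t : Tm L} (ht : t.IsAtomic) : t.skel = .atom := by
  cases t with
  | iota F => exact (ht trivial).elim
  | _ => rfl

mutual
  theorem Tm.skel_subst : ∀ (t : Tm L) {σ : ℕ → Tm L}, AtomicSub σ → (t.subst σ).skel = t.skel
    | .var i, _, hσ => (hσ i).skel_eq
    | .const _, _, _ => rfl
    | .iota F, _, hσ => congrArg Skel.iota (Fm.skel_subst F hσ.upSub)
  theorem Fm.skel_subst : ∀ (A : Fm L) {σ : ℕ → Tm L}, AtomicSub σ → (A.subst σ).skel = A.skel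
    | .bot, _, _ | .pred _ _, _, _ | .exist _, _, _ => rfl
    | .eq s _, _, hσ => Tm.skel_subst s hσ
    | .and A B, _, hσ => congrArg₂ Skel.and (Fm.skel_subst A hσ) (Fm.skel_subst B hσ)
    | .or A B, _, hσ => congrArg₂ Skel.or (Fm.skel_subst A hσ) (Fm.skel_subst B hσ)
    | .imp A B, _, hσ => congrArg₂ Skel.imp (Fm.skel_subst A hσ) (Fm.skel_subst B hσ)
    | .all A, _, hσ => congrArg Skel.all (Fm.skel_subst A hσ.upSub)
    | .ex A, _, hσ => congrArg Skel.ex (Fm.skel_subst A hσ.upSub)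
end

theorem Fm.skel_shift (A : Fm L) : A.shift.skel = A.skel := by
  rw [A.shift_eq_subst]; exact A.skel_subst (atomicSub_var_comp _)

theorem Fm.skel_inst (A : Fm L) {t : Tm L} (ht : t.IsAtomic) : (A.inst t).skel = A.skel :=
  A.skel_subst (atomicSub_var.scons ht)

namespace Ded

/-! ### Computability -/

/-- Conditions on deductions of a formula in a context. -/
abbrev DedPred (L : Signature.{u, v}) := List (Fm L) → Fm L → Ded L → Prop

/-- Values: rules that repeat their minor premise, with normal neutral major premises, lead from
conclusions of normal neutral deductions and of deductions with the property `P` to the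
conclusion. -/
inductive Val (P : DedPred L) : DedPred L
  | neutral {Γ A d} : PlainProves Γ d A → d.Pre → d.Neutral → Val P Γ A d
  | intro {Γ A d} : P Γ A d → Val P Γ A d
  | orE {Γ A B C d e₁ e₂} : PlainProves Γ d (.or A B) → d.Pre → d.Neutral →
      Val P (A :: Γ) C e₁ → Val P (B :: Γ) C e₂ → Val P Γ C (.orE A B C d e₁ e₂)
  | exE {Γ A C d e} : PlainProves Γ d (.ex A) → d.Pre → d.Neutral →
      Val P (.exist (.var 0) :: A :: Γ.map Fm.shift) C.shift e → Val P Γ C (.exE A C d e)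
  | eqI {Γ t C d e} : PlainProves Γ d (.exist t) → d.Pre → d.Neutral →
      Val P (.eq (.var 0) t.shift :: Γ.map Fm.shift) C.shift e → Val P Γ C (.eqI t C d e)

/-- In all changes of contexts, the deduction reduces to a value.  The quantification over changes
of contexts is needed because substitution does not preserve normality: it can make the minor
premise and the conclusion of `eqE` identical. -/
def RedOf (P : DedPred L) (Γ : List (Fm L)) (A : Fm L) (d : Ded L) : Prop :=
  ∀ ⦃Δ σ ρ⦄, Mor Γ Δ σ ρ → ∃ d', ReducesTo (d.act σ ρ) d' ∧ Val P Δ (A.subst σ) d'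

/-- A deduction of `B` in the scope of an assumption class `A`: in all changes of contexts, using a
computable deduction to conclude the assumptions yields a computable deduction. -/
def Body (P Q : DedPred L) (Γ : List (Fm L)) (A B : Fm L) (e : Ded L) : Prop :=
  ∀ ⦃Δ σ ρ⦄, Mor Γ Δ σ ρ → ∀ ⦃p⦄, RedOf P Δ (A.subst σ) p →
    RedOf Q Δ (B.subst σ) (e.sub σ (scons p fun i => hyp (ρ i)))

/-- A deduction of `B` in the scope of an eigenparameter and of an assumption class `A`. -/
def BodyP (P Q : DedPred L) (Γ : List (Fm L)) (A B : Fm L) (e : Ded L) : Prop :=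
  ∀ ⦃Δ σ ρ⦄, Mor Γ Δ σ ρ → ∀ ⦃t : Tm L⦄, t.IsAtomic → ∀ ⦃p⦄,
    RedOf P Δ (A.subst (scons t σ)) p →
    RedOf Q Δ (B.subst (scons t σ)) (e.sub (scons t σ) (scons p fun i => hyp (ρ i)))

/-- A deduction of `B` in the scope of an eigenparameter `0` and of assumption classes `∃! 0` and
`A`. -/
def BodyPP (P₀ P Q : DedPred L) (Γ : List (Fm L)) (A B : Fm L) (e : Ded L) : Prop :=
  ∀ ⦃Δ σ ρ⦄, Mor Γ Δ σ ρ → ∀ ⦃t : Tm L⦄, t.IsAtomic → ∀ ⦃p₀ p⦄,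
    RedOf P₀ Δ (.exist t) p₀ → RedOf P Δ (A.subst (scons t σ)) p →
    RedOf Q Δ (B.subst (scons t σ))
      (e.sub (scons t σ) (scons p₀ (scons p fun i => hyp (ρ i))))

/-- Introductions with computable components, by recursion on the skeleton of the conclusion.  Of
atomic formulas other than identities with a description on the left there are no introductions, so
the components `∃! t` and `a = t` are computable with respect to the empty predicate. -/
def IC : Skel → DedPred L
  | .atom => fun _ _ _ => False
  | .and a b => fun Γ C d => ∃ A B d₁ d₂, C = .and A B ∧ d = .andI d₁ d₂ ∧
      RedOf (IC a) Γ A d₁ ∧ RedOf (IC b) Γ B d₂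
  | .or a b => fun Γ C d =>
      (∃ A B e, C = .or A B ∧ d = .orI₁ B e ∧ RedOf (IC a) Γ A e) ∨
      (∃ A B e, C = .or A B ∧ d = .orI₂ A e ∧ RedOf (IC b) Γ B e)
  | .imp a b => fun Γ C d => ∃ A B e, C = .imp A B ∧ d = .impI A e ∧
      Body (IC a) (IC b) Γ A B e
  | .all a => fun Γ C d => ∃ A e, C = .all A ∧ d = .allI A e ∧
      BodyP (fun _ _ _ => False) (IC a) Γ (.exist (.var 0)) A e
  | .ex a => fun Γ C d => ∃ A t e₁ e₂, C = .ex A ∧ d = .exI A t e₁ e₂ ∧ t.IsAtomic ∧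
      RedOf (IC a) Γ (A.inst t) e₁ ∧ RedOf (fun _ _ _ => False) Γ (.exist t) e₂
  | .iota a => fun Γ C d => ∃ F t d₀ e f, C = .eq (.iota F) t ∧ d = .iotaI F t d₀ e f ∧
      t.IsAtomic ∧ RedOf (fun _ _ _ => False) Γ (.exist t) d₀ ∧
      BodyP (fun _ _ _ => False) (IC a) Γ (.eq (.var 0) t.shift) F e ∧
      BodyPP (fun _ _ _ => False) (IC a) (fun _ _ _ => False) Γ F (.eq (.var 0) t.shift) f

section
variable {P P₀ Q : DedPred L} {Γ Δ : List (Fm L)} {A B C : Fm L} {d e : Ded L} {σ : ℕ → Tm L}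
  {ρ : ℕ → ℕ}

theorem RedOf.act (h : RedOf P Γ A d) (m : Mor Γ Δ σ ρ) :
    RedOf P Δ (A.subst σ) (d.act σ ρ) := fun Θ σ' ρ' m' => by
  rw [act_act, Fm.subst_subst]; exact h (m'.comp m)

theorem RedOf.exists_val (h : RedOf P Γ A d) : ∃ d', ReducesTo d d' ∧ Val P Γ A d' := by
  simpa using h (Mor.refl Γ)

/-- Assumptions are computable, which allows computable deductions to be opened in the scope of the
assumption classes they discharge. -/
theorem redOf_hyp {i : ℕ} (h : Γ[i]? = some A) : RedOf P Γ A (.hyp i) := fun _ _ _ m =>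
  ⟨_, .refl _, .neutral (.hyp (m.map h)) trivial (.inr rfl)⟩

theorem scons_hyp : scons (hyp 0) (fun i => (hyp (i + 1) : Ded L)) = hyp := by
  funext i; cases i <;> rfl

theorem scons_scons_hyp :
    scons (hyp 0) (scons (hyp 1) fun i => (hyp (i + 1 + 1) : Ded L)) = hyp := by
  funext i; rcases i with _ | _ | i <;> rfl

theorem Body.red (h : Body P Q Γ A B e) : RedOf Q (A :: Γ) B e := by
  have := h ((Mor.refl Γ).weaken A) (redOf_hyp (i := 0) (by simp))
  simp only [id, Fm.subst_var, scons_hyp, sub_var_hyp] at this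
  exact this

theorem BodyP.red (h : BodyP P Q Γ A B e) : RedOf Q (A :: Γ.map Fm.shift) B e := by
  have := h ((Mor.shift Γ).weaken A) (Tm.isAtomic_var 0)
    (redOf_hyp (i := 0) (by rw [scons_var_succ, Fm.subst_var]; rfl))
  simp only [id, scons_var_succ, Fm.subst_var, scons_hyp, sub_var_hyp] at this
  exact this

theorem BodyPP.red (h : BodyPP P₀ P Q Γ A B e) :
    RedOf Q (.exist (.var 0) :: A :: Γ.map Fm.shift) B e := by
  have := h (((Mor.shift Γ).weaken A).weaken (.exist (.var 0))) (Tm.isAtomic_var 0)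
    (redOf_hyp (i := 0) rfl) (redOf_hyp (i := 1) (by rw [scons_var_succ, Fm.subst_var]; rfl))
  simp only [id, scons_var_succ, Fm.subst_var, scons_scons_hyp, sub_var_hyp] at this
  exact this

theorem scons_hyp_comp_sub (σ : ℕ → Tm L) (τ : ℕ → Ded L) (p : Ded L) (ρ : ℕ → ℕ) :
    (fun i => (hyp (upRen ρ i) : Ded L).sub σ (scons p τ)) = scons p fun i => τ (ρ i) := by
  funext i; cases i <;> rfl

theorem Body.act (h : Body P Q Γ A B e) (m : Mor Γ Δ σ ρ) :
    Body P Q Δ (A.subst σ) (B.subst σ) (e.act σ (upRen ρ)) := fun Θ σ' ρ' m' p hp => by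
  rw [Fm.subst_subst] at hp ⊢
  rw [act_eq_sub, sub_sub, scons_hyp_comp_sub]
  exact h (m'.comp m) hp

theorem BodyP.act (h : BodyP P Q Γ A B e) (m : Mor Γ Δ σ ρ) :
    BodyP P Q Δ (A.subst (upSub σ)) (B.subst (upSub σ)) (e.act (upSub σ) (upRen ρ)) :=
  fun Θ σ' ρ' m' t ht p hp => by
    rw [Fm.subst_subst, upSub_comp_scons] at hp ⊢
    rw [act_eq_sub, sub_sub, scons_hyp_comp_sub, upSub_comp_scons]
    exact h (m'.comp m) ht hp

theorem BodyPP.act (h : BodyPP P₀ P Q Γ A B e) (m : Mor Γ Δ σ ρ) :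
    BodyPP P₀ P Q Δ (A.subst (upSub σ)) (B.subst (upSub σ))
      (e.act (upSub σ) (upRen (upRen ρ))) :=
  fun Θ σ' ρ' m' t ht p₀ p hp₀ hp => by
    rw [Fm.subst_subst, upSub_comp_scons] at hp ⊢
    rw [act_eq_sub, sub_sub, scons_hyp_comp_sub, upSub_comp_scons]
    have : (fun i => scons p (fun i => (hyp (ρ' i) : Ded L)) (upRen ρ i)) =
        scons p fun i => hyp (ρ' (ρ i)) := by
      funext i; cases i <;> rfl
    rw [this]
    exact h (m'.comp m) ht hp₀ hp

/-! ### Values reduce to normal deductions -/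

theorem Val.exists_pre
    (hP : ∀ {Γ A d}, P Γ A d →
      ∃ d', ReducesTo d d' ∧ PlainProves Γ d' A ∧ d'.Pre ∧ d'.kind = .intro)
    (h : Val P Γ A d) : ∃ d', ReducesTo d d' ∧ PlainProves Γ d' A ∧ d'.Pre := by
  induction h with
  | neutral h h' _ => exact ⟨_, .refl _, h, h'⟩
  | intro h => obtain ⟨d', h₁, h₂, h₃, _⟩ := hP h; exact ⟨d', h₁, h₂, h₃⟩
  | orE h h' h'' _ _ ih₁ ih₂ =>
    obtain ⟨_, r₁, h₁, p₁⟩ := ih₁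
    obtain ⟨_, r₂, h₂, p₂⟩ := ih₂
    exact ⟨_, .orE (.refl _) r₁ r₂, .orE h h₁ h₂, ⟨h', h''⟩, p₁, p₂⟩
  | exE h h' h'' _ ih =>
    obtain ⟨_, r₁, h₁, p₁⟩ := ih
    exact ⟨_, .exE (.refl _) r₁, .exE h h₁, ⟨h', h''⟩, p₁⟩
  | eqI h h' h'' _ ih =>
    obtain ⟨_, r₁, h₁, p₁⟩ := ih
    exact ⟨_, .eqI (.refl _) r₁, .eqI h h₁, ⟨h', h''⟩, p₁⟩

theorem RedOf.exists_pre_of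
    (hP : ∀ {Γ A d}, P Γ A d →
      ∃ d', ReducesTo d d' ∧ PlainProves Γ d' A ∧ d'.Pre ∧ d'.kind = .intro)
    (h : RedOf P Γ A d) : ∃ d', ReducesTo d d' ∧ PlainProves Γ d' A ∧ d'.Pre := by
  obtain ⟨d', h₁, h₂⟩ := h.exists_val
  obtain ⟨d'', h₃, h₄⟩ := h₂.exists_pre hP
  exact ⟨d'', h₁.trans h₃, h₄⟩

theorem IC.exists_pre {a : Skel} (h : IC a Γ A d) :
    ∃ d', ReducesTo d d' ∧ PlainProves Γ d' A ∧ d'.Pre ∧ d'.kind = .intro := by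
  have none {Γ : List (Fm L)} {A d} (h : RedOf (fun _ _ _ => False) Γ A d) :=
    h.exists_pre_of fun h => h.elim
  induction a generalizing Γ A d with
  | atom => exact h.elim
  | and a b iha ihb =>
    obtain ⟨A, B, d₁, d₂, rfl, rfl, h₁, h₂⟩ := h
    obtain ⟨_, r₁, q₁, p₁⟩ := h₁.exists_pre_of iha
    obtain ⟨_, r₂, q₂, p₂⟩ := h₂.exists_pre_of ihb
    exact ⟨_, .andI r₁ r₂, .andI q₁ q₂, ⟨p₁, p₂⟩, rfl⟩
  | or a b iha ihb =>
    rcases h with ⟨A, B, e, rfl, rfl, h⟩ | ⟨A, B, e, rfl, rfl, h⟩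
    · obtain ⟨_, r₁, q₁, p₁⟩ := h.exists_pre_of iha
      exact ⟨_, .orI₁ r₁, .orI₁ q₁, p₁, rfl⟩
    · obtain ⟨_, r₁, q₁, p₁⟩ := h.exists_pre_of ihb
      exact ⟨_, .orI₂ r₁, .orI₂ q₁, p₁, rfl⟩
  | imp a b iha ihb =>
    obtain ⟨A, B, e, rfl, rfl, h⟩ := h
    obtain ⟨_, r₁, q₁, p₁⟩ := h.red.exists_pre_of ihb
    exact ⟨_, .impI r₁, .impI q₁, p₁, rfl⟩
  | all a iha =>
    obtain ⟨A, e, rfl, rfl, h⟩ := h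
    obtain ⟨_, r₁, q₁, p₁⟩ := h.red.exists_pre_of iha
    exact ⟨_, .allI r₁, .allI q₁, p₁, rfl⟩
  | ex a iha =>
    obtain ⟨A, t, e₁, e₂, rfl, rfl, ht, h₁, h₂⟩ := h
    obtain ⟨_, r₁, q₁, p₁⟩ := h₁.exists_pre_of iha
    obtain ⟨_, r₂, q₂, p₂⟩ := none h₂
    exact ⟨_, .exI r₁ r₂, .exI ht q₁ q₂, ⟨p₁, p₂⟩, rfl⟩
  | iota a iha =>
    obtain ⟨F, t, d₀, e, f, rfl, rfl, ht, h₀, h₁, h₂⟩ := h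
    obtain ⟨_, r₀, q₀, p₀⟩ := none h₀
    obtain ⟨_, r₁, q₁, p₁⟩ := h₁.red.exists_pre_of iha
    obtain ⟨_, r₂, q₂, p₂⟩ := none h₂.red
    exact ⟨_, .iotaI r₀ r₁ r₂, .iotaI ht q₀ q₁ q₂, ⟨p₀, p₁, p₂⟩, rfl⟩

end

/-! ### Rules applied to values -/

/-- The deduction is computable with respect to the skeleton of its conclusion. -/
abbrev Red (Γ : List (Fm L)) (A : Fm L) (d : Ded L) : Prop := RedOf (IC A.skel) Γ A d

section
variable {Γ Δ : List (Fm L)} {A B C F : Fm L} {s t w r : Tm L} {d e e₁ e₂ f q p : Ded L}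
  {σ : ℕ → Tm L} {ρ : ℕ → ℕ}

theorem Red.act (h : Red Γ A d) (m : Mor Γ Δ σ ρ) : Red Δ (A.subst σ) (d.act σ ρ) := by
  rw [Red, A.skel_subst m.atomic]; exact RedOf.act h m

theorem Red.exists_pre (h : Red Γ A d) :
    ∃ d', ReducesTo d d' ∧ PlainProves Γ d' A ∧ d'.Pre := h.exists_pre_of IC.exists_pre

theorem ReducesTo.plug {d d' : Ded L} (h : ReducesTo d d') (E : Frame L) :
    ReducesTo (E.plug d) (E.plug d') := by
  cases E with
  | andE₁ => exact h.andE₁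
  | andE₂ => exact h.andE₂
  | orE => exact h.orE (.refl _) (.refl _)
  | impE => exact h.impE (.refl _)
  | botE => exact h.botE
  | allE => exact h.allE (.refl _)
  | exE => exact h.exE (.refl _)
  | eqI => exact h.eqI (.refl _)
  | eqE => exact h.eqE (.refl _)
  | ad => exact h.ad
  | iotaE₁ => exact h.iotaE₁ (.refl _)
  | iotaE₂ => exact h.iotaE₂ (.refl _) (.refl _)
  | iotaE₃ => exact h.iotaE₃

/-- Values that are not concluded by a rule that repeats its minor premise. -/
def Leaf (Γ : List (Fm L)) (A : Fm L) (d : Ded L) : Prop :=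
  IC A.skel Γ A d ∨ (PlainProves Γ d A ∧ d.Pre ∧ d.Neutral)

/-- The frame sends leaves to deductions that reduce to values. -/
def FrameLeaf (Γ : List (Fm L)) (A : Fm L) (E : Frame L) : Prop :=
  ∀ ⦃d⦄, Leaf Γ A d → ∃ D', ReducesTo (E.plug d) D' ∧ Val (IC E.concl.skel) Γ E.concl D'

/-- In all changes of contexts, the frame sends leaves to deductions that reduce to values. -/
def FrameRed (Γ : List (Fm L)) (A : Fm L) (E : Frame L) : Prop :=
  ∀ ⦃Δ σ ρ⦄, Mor Γ Δ σ ρ → FrameLeaf Δ (A.subst σ) (E.act σ ρ)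

theorem FrameRed.act {E : Frame L} (h : FrameRed Γ A E) (m : Mor Γ Δ σ ρ) :
    FrameRed Δ (A.subst σ) (E.act σ ρ) := fun _ _ _ m' => by
  rw [Fm.subst_subst, Frame.act_act]; exact h (m'.comp m)

theorem FrameRed.frameLeaf {E : Frame L} (h : FrameRed Γ A E) : FrameLeaf Γ A E := by
  have := h (Mor.refl Γ)
  rwa [Fm.subst_var, show E.act .var id = E by
    rw [Frame.act, Frame.psubst_var]; exact (E.hshift_eq_act 0).trans (by
      rw [Frame.act, Frame.psubst_var]; cases E <;>
        simp [Frame.hrename, hrename_eq_hsubst, ← upH_hyp_comp])] at this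

/-- A frame is permuted upwards until it is applied to the leaves. -/
theorem FrameRed.exists_val {P : DedPred L} (h : Val P Γ A d) (hP : P = IC A.skel) {E : Frame L}
    (hE : FrameRed Γ A E) :
    ∃ D', ReducesTo (E.plug d) D' ∧ Val (IC E.concl.skel) Γ E.concl D' := by
  induction h generalizing E with
  | neutral h h' h'' => exact hE.frameLeaf (.inr ⟨h, h', h''⟩)
  | intro h => subst hP; exact hE.frameLeaf (.inl h)
  | @orE Γ A B C d e₁ e₂ h h' h'' _ _ ih₁ ih₂ =>
    have hs (A) : FrameRed (A :: Γ) C (E.hshift 1) ∧ (E.hshift 1).concl = E.concl := by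
      rw [E.hshift_eq_act, Frame.concl_act, Fm.subst_var]
      exact ⟨by simpa using hE.act ((Mor.refl Γ).weaken A), rfl⟩
    obtain ⟨D₁, r₁, v₁⟩ := ih₁ hP (hs A).1
    obtain ⟨D₂, r₂, v₂⟩ := ih₂ hP (hs B).1
    rw [(hs A).2] at v₁ v₂
    exact ⟨_, (ReducesTo.reduct .perm_orE).trans (.orE (.refl _) r₁ r₂), .orE h h' h'' v₁ v₂⟩
  | @exE Γ A C d e h h' h'' _ ih =>
    have hs : FrameRed (.exist (.var 0) :: A :: Γ.map Fm.shift) C.shift (E.pshift.hshift 2) := by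
      have := hE.act (((Mor.shift Γ).weaken A).weaken (.exist (.var 0)))
      rwa [← Fm.shift_eq_subst] at this
    obtain ⟨D₁, r₁, v₁⟩ := ih (by rw [Fm.skel_shift, hP]) hs
    rw [E.pshift_hshift_eq_act, Frame.concl_act, ← Fm.shift_eq_subst, Fm.skel_shift] at v₁
    exact ⟨_, (ReducesTo.reduct .perm_exE).trans (.exE (.refl _) r₁), .exE h h' h'' v₁⟩
  | @eqI Γ t C d e h h' h'' _ ih =>
    have hs : FrameRed (.eq (.var 0) t.shift :: Γ.map Fm.shift) C.shift (E.pshift.hshift 1) := by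
      have := hE.act ((Mor.shift Γ).weaken (.eq (.var 0) t.shift))
      rwa [← Fm.shift_eq_subst] at this
    obtain ⟨D₁, r₁, v₁⟩ := ih (by rw [Fm.skel_shift, hP]) hs
    rw [E.pshift_hshift_eq_act, Frame.concl_act, ← Fm.shift_eq_subst, Fm.skel_shift] at v₁
    exact ⟨_, (ReducesTo.reduct .perm_eqI).trans (.eqI (.refl _) r₁), .eqI h h' h'' v₁⟩

theorem Red.plug {E : Frame L} (h : Red Γ A d) (hE : FrameRed Γ A E) :
    Red Γ E.concl (E.plug d) := fun Δ σ ρ m => by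
  obtain ⟨d', r, hv⟩ := h m
  obtain ⟨D', r', hv'⟩ := FrameRed.exists_val hv (by rw [A.skel_subst m.atomic]) (hE.act m)
  rw [Frame.concl_act, Fm.skel_subst _ m.atomic] at hv'
  rw [Frame.plug_act]
  exact ⟨D', (r.plug _).trans r', hv'⟩

/-- Every normal deduction of a formula `∃! r` is a value, because no introduction rule other than
the general one for identity concludes such a formula. -/
theorem val_of_pre {P : DedPred L} (h : PlainProves Γ d A) (hd : d.Pre) (hA : A = .exist r) :
    Val P Γ A d := by
  induction h generalizing r with
  | orE h _ _ _ ih₁ ih₂ => exact .orE h hd.1.1 hd.1.2 (ih₁ hd.2.1 hA) (ih₂ hd.2.2 hA)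
  | exE h _ _ ih =>
    exact .exE h hd.1.1 hd.1.2 (ih hd.2 (r := r.shift) (by rw [hA]; rfl))
  | eqI h _ _ ih =>
    exact .eqI h hd.1.1 hd.1.2 (ih hd.2 (r := r.shift) (by rw [hA]; rfl))
  | andI | orI₁ | orI₂ | impI | allI | exI | iotaI => cases hA
  | eqE h h₁ h₂ => exact .neutral (.eqE h h₁ h₂) hd (.inl rfl)
  | hyp h => exact .neutral (.hyp h) hd (.inr rfl)
  | andE₁ h => exact .neutral (.andE₁ h) hd (.inr rfl)
  | andE₂ h => exact .neutral (.andE₂ h) hd (.inr rfl)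
  | impE h h' => exact .neutral (.impE h h') hd (.inr rfl)
  | botE h h' => exact .neutral (.botE h h') hd (.inr rfl)
  | allE h h₁ h₂ => exact .neutral (.allE h h₁ h₂) hd (.inr rfl)
  | ad h h' => exact .neutral (.ad h h') hd (.inr rfl)
  | iotaE₁ h h' h₁ h₂ => exact .neutral (.iotaE₁ h h' h₁ h₂) hd (.inr rfl)
  | iotaE₂ h h' h₁ h₂ h₃ => exact .neutral (.iotaE₂ h h' h₁ h₂ h₃) hd (.inr rfl)
  | iotaE₃ h => exact .neutral (.iotaE₃ h) hd (.inr rfl)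

theorem Leaf.exists_pre (h : Leaf Γ A d) :
    ∃ d', ReducesTo d d' ∧ PlainProves Γ d' A ∧ d'.Pre ∧ d'.kind ≠ .del := by
  rcases h with h | ⟨h, h', h''⟩
  · obtain ⟨d', h₁, h₂, h₃, h₄⟩ := h.exists_pre
    exact ⟨d', h₁, h₂, h₃, by simp [h₄]⟩
  · exact ⟨d, .refl _, h, h', by rcases h'' with h | h <;> simp [h]⟩

theorem Body.inst {P Q : DedPred L} (h : Body P Q Γ A B e) (hp : RedOf P Γ A p) :
    RedOf Q Γ B (e.hinst p) := by
  have := h (Mor.refl Γ) (p := p) (by simpa using hp)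
  simp only [id, sub, psubst_var, Fm.subst_var] at this
  exact this

theorem BodyP.inst {P Q : DedPred L} (h : BodyP P Q Γ A B e) (ht : t.IsAtomic)
    (hp : RedOf P Γ (A.inst t) p) : RedOf Q Γ (B.inst t) ((e.pinst t).hinst p) :=
  h (Mor.refl Γ) ht hp

theorem BodyPP.inst {P₀ P Q : DedPred L} (h : BodyPP P₀ P Q Γ A B e) (ht : t.IsAtomic)
    (hp : RedOf P₀ Γ (.exist t) p) (hq : RedOf P Γ (A.inst t) q) :
    RedOf Q Γ (B.inst t) ((e.pinst t).hinst₂ p q) :=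
  h (Mor.refl Γ) ht hp hq

/-! ### Elimination rules preserve computability -/

theorem red_andE₁ (h : Red Γ (.and A B) d) : Red Γ A (.andE₁ A B d) := by
  refine h.plug (E := .andE₁ A B) fun Δ σ ρ m d hd => ?_
  rcases hd with ⟨_, _, d₁, d₂, hC, rfl, h₁, h₂⟩ | ⟨h, h', h''⟩
  · cases hC
    obtain ⟨d', r, hv⟩ := h₁.exists_val
    exact ⟨d', (ReducesTo.reduct .and₁).trans r, hv⟩
  · exact ⟨_, .refl _, .neutral (.andE₁ h) ⟨h', h''⟩ (.inr rfl)⟩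

theorem red_andE₂ (h : Red Γ (.and A B) d) : Red Γ B (.andE₂ A B d) := by
  refine h.plug (E := .andE₂ A B) fun Δ σ ρ m d hd => ?_
  rcases hd with ⟨_, _, d₁, d₂, hC, rfl, h₁, h₂⟩ | ⟨h, h', h''⟩
  · cases hC
    obtain ⟨d', r, hv⟩ := h₂.exists_val
    exact ⟨d', (ReducesTo.reduct .and₂).trans r, hv⟩
  · exact ⟨_, .refl _, .neutral (.andE₂ h) ⟨h', h''⟩ (.inr rfl)⟩

theorem red_impE (h : Red Γ (.imp A B) d) (he : Red Γ A e) : Red Γ B (.impE A B d e) := by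
  refine h.plug (E := .impE A B e) fun Δ σ ρ m d hd => ?_
  replace he := he.act m
  rcases hd with ⟨_, _, e', hC, rfl, h⟩ | ⟨h, h', h''⟩
  · cases hC
    obtain ⟨d', r, hv⟩ := (h.inst he).exists_val
    exact ⟨d', (ReducesTo.reduct .imp).trans r, hv⟩
  · obtain ⟨e', r, he', pe⟩ := he.exists_pre
    exact ⟨_, .impE (.refl _) r, .neutral (.impE h he') ⟨⟨h', h''⟩, pe⟩ (.inr rfl)⟩

theorem red_orE (h : Red Γ (.or A B) d) (h₁ : Body (IC A.skel) (IC C.skel) Γ A C e₁)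
    (h₂ : Body (IC B.skel) (IC C.skel) Γ B C e₂) : Red Γ C (.orE A B C d e₁ e₂) := by
  refine h.plug (E := .orE A B C e₁ e₂) fun Δ σ ρ m d hd => ?_
  replace h₁ := h₁.act m
  replace h₂ := h₂.act m
  rw [← A.skel_subst m.atomic, ← C.skel_subst m.atomic] at h₁
  rw [← B.skel_subst m.atomic, ← C.skel_subst m.atomic] at h₂
  rcases hd with (⟨_, _, e', hC, rfl, h⟩ | ⟨_, _, e', hC, rfl, h⟩) | ⟨h, h', h''⟩
  · cases hC
    obtain ⟨d', r, hv⟩ := (h₁.inst h).exists_val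
    exact ⟨d', (ReducesTo.reduct .or₁).trans r, hv⟩
  · cases hC
    obtain ⟨d', r, hv⟩ := (h₂.inst h).exists_val
    exact ⟨d', (ReducesTo.reduct .or₂).trans r, hv⟩
  · obtain ⟨_, r₁, v₁⟩ := h₁.red.exists_val
    obtain ⟨_, r₂, v₂⟩ := h₂.red.exists_val
    exact ⟨_, .orE (.refl _) r₁ r₂, .orE h h' h'' v₁ v₂⟩

theorem red_botE (hA : A.IsPrime) (h : Red Γ .bot d) : Red Γ A (.botE A d) := by
  refine h.plug (E := .botE A) fun Δ σ ρ m d hd => ?_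
  rcases hd with h | ⟨h, h', h''⟩
  · exact h.elim
  · exact ⟨_, .refl _, .neutral (.botE (hA.subst m.atomic) h) ⟨h', h''⟩ (.inr rfl)⟩

theorem red_allE (ht : t.IsAtomic) (h : Red Γ (.all A) d) (he : Red Γ (.exist t) e) :
    Red Γ (A.inst t) (.allE A t d e) := by
  refine h.plug (E := .allE A t e) fun Δ σ ρ m d hd => ?_
  replace he := he.act m
  replace ht := ht.subst m.atomic
  rcases hd with ⟨_, e', hC, rfl, h⟩ | ⟨h, h', h''⟩
  · cases hC
    obtain ⟨d', r, hv⟩ := (h.inst ht he).exists_val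
    rw [← Fm.skel_inst _ ht] at hv
    exact ⟨d', (ReducesTo.reduct .all).trans r, hv⟩
  · obtain ⟨e', r, he', pe⟩ := he.exists_pre
    exact ⟨_, .allE (.refl _) r, .neutral (.allE ht h he') ⟨⟨h', h''⟩, pe⟩ (.inr rfl)⟩

theorem red_exE (h : Red Γ (.ex A) d)
    (he : BodyPP (IC .atom) (IC A.skel) (IC C.skel) Γ A C.shift e) :
    Red Γ C (.exE A C d e) := by
  refine h.plug (E := .exE A C e) fun Δ σ ρ m d hd => ?_
  replace he := he.act m
  rw [← A.skel_subst m.atomic.upSub, ← C.skel_subst m.atomic, Fm.shift_subst_upSub] at he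
  rcases hd with ⟨_, t, e₁, e₂, hC, rfl, ht, h₁, h₂⟩ | ⟨h, h', h''⟩
  · cases hC
    obtain ⟨d', r, hv⟩ := (he.inst ht h₂ h₁).exists_val
    rw [Fm.shift_inst] at hv
    exact ⟨d', (ReducesTo.reduct .ex).trans r, hv⟩
  · obtain ⟨_, r₁, v₁⟩ := he.red.exists_val
    exact ⟨_, .exE (.refl _) r₁, .exE h h' h'' v₁⟩

theorem red_eqI (h : Red Γ (.exist t) d)
    (he : BodyP (IC .atom) (IC C.skel) Γ (.eq (.var 0) t.shift) C.shift e) :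
    Red Γ C (.eqI t C d e) := by
  refine h.plug (E := .eqI t C e) fun Δ σ ρ m d hd => ?_
  replace he := he.act m
  rw [← C.skel_subst m.atomic, Fm.shift_subst_upSub, Fm.subst, Tm.shift_subst_upSub] at he
  rcases hd with h | ⟨h, h', h''⟩
  · exact h.elim
  · obtain ⟨_, r₁, v₁⟩ := he.red.exists_val
    exact ⟨_, .eqI (.refl _) r₁, .eqI h h' h'' v₁⟩

/-- An inference of `∃! r` from a leaf reduces to a normal deduction by `Denotes.exists_pre`, and
normal deductions of `∃! r` are values by `val_of_pre`. -/
theorem red_denotes {D : Ded L} (h : Red Γ A d) (hD : Denotes A r d D) : Red Γ (.exist r) D := by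
  obtain ⟨E, rfl, hE, hD⟩ := hD.exists_frame
  rw [← hE]
  refine h.plug (E := E) fun Δ σ ρ m d hd => ?_
  obtain ⟨d', r₁, hd', pd, -⟩ := hd.exists_pre
  obtain ⟨D', r₂, pD, hD'⟩ := Denotes.exists_pre hd' pd (hD m.atomic ρ d')
  rw [Frame.concl_act, hE]
  exact ⟨D', (r₁.plug _).trans r₂, val_of_pre hD' pD rfl⟩

theorem red_eqE (hA : A.IsPlainIn) (h : Red Γ (.eq s t) d) (he : Red Γ (A.inst s) e) :
    Red Γ (A.inst t) (.eqE A s t d e) := by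
  refine h.plug (E := .eqE A s t e) fun Δ σ ρ m d hd => ?_
  replace he := he.act m
  rw [Fm.inst_subst] at he
  replace hA := hA.subst σ
  rw [Frame.concl_act, Frame.concl, Fm.inst_subst]
  change ∃ D', ReducesTo (.eqE (A.subst (upSub σ)) (s.subst σ) (t.subst σ) d (e.act σ ρ)) D' ∧ _
  change Leaf Δ (.eq (s.subst σ) (t.subst σ)) d at hd
  generalize A.subst (upSub σ) = A at *
  generalize s.subst σ = s at *
  generalize t.subst σ = t at *
  generalize e.act σ ρ = e at *
  -- Applications with identical minor premise and conclusion are dropped, and those that conclude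
  -- `∃! t` are replaced by an inference from the major premise.  All others are neutral.
  by_cases hst : A.inst s = A.inst t
  · obtain ⟨d', r, hv⟩ := he.exists_val
    rw [hst] at hv
    exact ⟨d', (ReducesTo.reduct (.drop_eqE hst)).trans r, hv⟩
  obtain ⟨d', r₁, hd', pd, hk⟩ := hd.exists_pre
  obtain ⟨e', r₂, he', pe⟩ := he.exists_pre
  have r₃ := ReducesTo.eqE (A := A) (s := s) (t := t) r₁ r₂
  by_cases hw : ∃ w, A = .exist w
  · obtain ⟨w, rfl⟩ := hw
    rcases hA with rfl | ⟨w, rfl⟩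
    · obtain ⟨D₁, hD₁⟩ := Fm.HasArg.exists_denotes (A := .eq s t) (r := t) (Or.inr rfl) d'
      obtain ⟨D', r₄, pD, hD⟩ := hD₁.exists_pre hd' pd
      exact ⟨D', (r₃.trans (.reduct (.eqE_exist hD₁))).trans r₄, val_of_pre hD pD rfl⟩
    · exact (hst (by rw [Fm.inst, Fm.inst, Fm.subst, Fm.subst, Tm.shift_inst, Tm.shift_inst])).elim
  · exact ⟨_, r₃, .neutral (.eqE hA hd' he')
      ⟨⟨pd, hk⟩, pe, fun h => hst (h ▸ rfl), fun w h => hw ⟨w, h⟩⟩ (.inl rfl)⟩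

theorem red_iotaE₁ (ht : t.IsAtomic) (hw : w.IsAtomic) (h : Red Γ (.eq (.iota F) t) d)
    (he : Red Γ (.eq w t) e) : Red Γ (F.inst w) (.iotaE₁ F t w d e) := by
  refine h.plug (E := .iotaE₁ F t w e) fun Δ σ ρ m d hd => ?_
  replace he := he.act m
  replace ht := ht.subst m.atomic
  replace hw := hw.subst m.atomic
  rcases hd with ⟨_, _, d₀, e', f, hC, rfl, -, -, h, -⟩ | ⟨h, h', h''⟩
  · cases hC
    have he' : RedOf (IC .atom) Δ (Fm.inst (.eq (.var 0) (t.subst σ).shift) (w.subst σ))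
        (e.act σ ρ) := by
      rw [← hw.skel_eq, Fm.inst, Fm.subst, Tm.shift_inst]; exact he
    obtain ⟨d', r, hv⟩ := (h.inst hw he').exists_val
    rw [← Fm.skel_inst _ hw] at hv
    exact ⟨d', (ReducesTo.reduct .iota₁).trans r, hv⟩
  · obtain ⟨e', r, he', pe⟩ := he.exists_pre
    exact ⟨_, .iotaE₁ (.refl _) r, .neutral (.iotaE₁ ht hw h he') ⟨⟨h', h''⟩, pe⟩ (.inr rfl)⟩

theorem red_iotaE₂ (ht : t.IsAtomic) (hw : w.IsAtomic) (h : Red Γ (.eq (.iota F) t) d)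
    (hq : Red Γ (F.inst w) q) (hp : Red Γ (.exist w) p) :
    Red Γ (.eq w t) (.iotaE₂ F t w d q p) := by
  refine h.plug (E := .iotaE₂ F t w q p) fun Δ σ ρ m d hd => ?_
  replace hp := hp.act m
  replace hq := hq.act m
  replace ht := ht.subst m.atomic
  replace hw := hw.subst m.atomic
  rw [Fm.inst_subst] at hq
  rcases hd with ⟨_, _, d₀, e', f, hC, rfl, -, -, -, h⟩ | ⟨h, h', h''⟩
  · cases hC
    rw [Red, Fm.skel_inst _ hw] at hq
    obtain ⟨d', r, hv⟩ := (h.inst hw hp hq).exists_val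
    rw [Fm.inst, Fm.subst, Tm.shift_inst] at hv
    refine ⟨d', (ReducesTo.reduct .iota₂).trans r, ?_⟩
    change Val (IC (w.subst σ).skel) Δ (.eq (w.subst σ) (t.subst σ)) d'
    rw [hw.skel_eq]; exact hv
  · obtain ⟨q', r₁, hq', pq⟩ := hq.exists_pre
    obtain ⟨p', r₂, hp', pp⟩ := hp.exists_pre
    exact ⟨_, .iotaE₂ (.refl _) r₁ r₂, .neutral (.iotaE₂ ht hw h hq' hp')
      ⟨⟨h', h''⟩, pq, pp⟩ (.inr rfl)⟩

/-! ### Introduction rules preserve computability -/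

/-- Introductions with computable components are computable. -/
theorem red_of_ic (h : ∀ ⦃Δ σ ρ⦄, Mor Γ Δ σ ρ → IC A.skel Δ (A.subst σ) (d.act σ ρ)) :
    Red Γ A d := fun _ _ _ m => ⟨_, .refl _, .intro (h m)⟩

theorem red_andI (h₁ : Red Γ A d) (h₂ : Red Γ B e) : Red Γ (.and A B) (.andI d e) :=
  red_of_ic fun _ _ _ m => ⟨_, _, _, _, rfl, rfl, RedOf.act h₁ m, RedOf.act h₂ m⟩

theorem red_orI₁ (h : Red Γ A d) : Red Γ (.or A B) (.orI₁ B d) :=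
  red_of_ic fun _ _ _ m => .inl ⟨_, _, _, rfl, rfl, RedOf.act h m⟩

theorem red_orI₂ (h : Red Γ B d) : Red Γ (.or A B) (.orI₂ A d) :=
  red_of_ic fun _ _ _ m => .inr ⟨_, _, _, rfl, rfl, RedOf.act h m⟩

theorem red_impI (h : Body (IC A.skel) (IC B.skel) Γ A B e) : Red Γ (.imp A B) (.impI A e) :=
  red_of_ic fun _ _ _ m => ⟨_, _, _, rfl, rfl, h.act m⟩

theorem red_allI (h : BodyP (IC .atom) (IC A.skel) Γ (.exist (.var 0)) A e) :
    Red Γ (.all A) (.allI A e) :=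
  red_of_ic fun _ _ _ m => ⟨_, _, rfl, rfl, h.act m⟩

theorem red_exI (ht : t.IsAtomic) (h₁ : Red Γ (A.inst t) d) (h₂ : Red Γ (.exist t) e) :
    Red Γ (.ex A) (.exI A t d e) :=
  red_of_ic fun _ _ _ m => ⟨_, _, _, _, rfl, rfl, ht.subst m.atomic, by
    rw [← Fm.inst_subst, ← A.skel_inst ht]; exact RedOf.act h₁ m, RedOf.act h₂ m⟩

theorem red_iotaI (ht : t.IsAtomic) (h₀ : Red Γ (.exist t) d)
    (h₁ : BodyP (IC .atom) (IC F.skel) Γ (.eq (.var 0) t.shift) F e)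
    (h₂ : BodyPP (IC .atom) (IC F.skel) (IC .atom) Γ F (.eq (.var 0) t.shift) f) :
    Red Γ (.eq (.iota F) t) (.iotaI F t d e f) :=
  red_of_ic fun _ σ _ m => ⟨_, _, _, _, _, rfl, rfl, ht.subst m.atomic, RedOf.act h₀ m, by
    have := h₁.act m
    rw [Fm.subst, Tm.shift_subst_upSub] at this; exact this, by
    have := h₂.act m
    rw [Fm.subst, Tm.shift_subst_upSub] at this; exact this⟩

end

/-! ### All deductions are computable -/

/-- Atomic terms for the parameters and computable deductions for the assumptions. -/
structure Env (Γ Δ : List (Fm L)) (σ : ℕ → Tm L) (τ : ℕ → Ded L) : Prop where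
  atomic : AtomicSub σ
  red : ∀ {i B}, Γ[i]? = some B → Red Δ (B.subst σ) (τ i)

section
variable {Γ Δ Θ : List (Fm L)} {σ σ' : ℕ → Tm L} {τ : ℕ → Ded L} {ρ' : ℕ → ℕ} {A B : Fm L}
  {t : Tm L} {p e : Ded L}

theorem Env.mor (h : Env Γ Δ σ τ) (m : Mor Δ Θ σ' ρ') :
    Env Γ Θ (fun i => (σ i).subst σ') (fun i => (τ i).act σ' ρ') :=
  ⟨m.atomic.comp h.atomic, fun hB => by
    have := (h.red hB).act m
    rwa [Fm.subst_subst] at this⟩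

theorem Env.cons (h : Env Γ Δ σ τ) (hp : Red Δ (A.subst σ) p) :
    Env (A :: Γ) Δ σ (scons p τ) :=
  ⟨h.atomic, fun {i B} hB => by
    cases i with
    | zero => simp at hB; subst hB; exact hp
    | succ i => exact h.red hB⟩

theorem Env.scons (h : Env Γ Δ σ τ) (ht : t.IsAtomic) :
    Env (Γ.map Fm.shift) Δ (scons t σ) τ :=
  ⟨h.atomic.scons ht, fun {i B} hB => by
    rw [List.getElem?_map] at hB
    obtain ⟨B, hB', rfl⟩ := Option.map_eq_some_iff.1 hB
    rw [Fm.shift_subst_scons]; exact h.red hB'⟩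

theorem Env.body (h : Env Γ Δ σ τ)
    (ih : ∀ {Δ σ τ}, Env (A :: Γ) Δ σ τ → Red Δ (B.subst σ) (e.sub σ τ)) :
    Body (IC (A.subst σ).skel) (IC (B.subst σ).skel) Δ (A.subst σ) (B.subst σ)
      (e.sub σ (upH τ)) := fun Θ σ' ρ m p hp => by
  rw [← Fm.skel_subst _ m.atomic, Fm.subst_subst] at hp
  rw [← Fm.skel_subst _ m.atomic, Fm.subst_subst, sub_sub, upH_comp_scons]
  have := ih ((h.mor m).cons hp)
  simpa only [act_eq_sub] using this

theorem Env.bodyP {P Q : DedPred L} (h : Env Γ Δ σ τ)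
    (ih : ∀ {Δ σ τ}, Env (A :: Γ.map Fm.shift) Δ σ τ → Red Δ (B.subst σ) (e.sub σ τ))
    (hP : ∀ {t σ}, t.IsAtomic → AtomicSub σ → P = IC (A.subst (FreeLogic.scons t σ)).skel)
    (hQ : Q = IC B.skel) :
    BodyP P Q Δ (A.subst (upSub σ)) (B.subst (upSub σ)) (e.sub (upSub σ) (upH (upP τ))) :=
  fun Θ σ' ρ m t ht p hp => by
    rw [Fm.subst_subst, upSub_comp_scons] at hp
    rw [Fm.subst_subst, sub_sub, upH_comp_scons, upP_comp_scons, upSub_comp_scons]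
    have hm := h.mor m
    rw [hP ht hm.atomic] at hp
    have := ih ((hm.scons ht).cons hp)
    rw [Red, Fm.skel_subst _ (hm.atomic.scons ht), ← hQ] at this
    simpa only [act_eq_sub] using this

theorem Env.bodyPP {Q : DedPred L} (h : Env Γ Δ σ τ)
    (ih : ∀ {Δ σ τ}, Env (.exist (.var 0) :: A :: Γ.map Fm.shift) Δ σ τ →
      Red Δ (B.subst σ) (e.sub σ τ))
    (hQ : ∀ {t σ}, t.IsAtomic → AtomicSub σ → Q = IC (B.subst (FreeLogic.scons t σ)).skel) :
    BodyPP (IC .atom) (IC (A.subst (upSub σ)).skel) Q Δ (A.subst (upSub σ)) (B.subst (upSub σ))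
      (e.sub (upSub σ) (upH (upH (upP τ)))) :=
  fun Θ σ' ρ m t ht p₀ p hp₀ hp => by
    rw [← Fm.skel_subst _ (m.atomic.scons ht), Fm.subst_subst, upSub_comp_scons] at hp
    rw [Fm.subst_subst, sub_sub, upH_comp_scons, upH_comp_scons, upP_comp_scons, upSub_comp_scons]
    have hm := h.mor m
    have := ih (((hm.scons ht).cons hp).cons (A := .exist (.var 0)) hp₀)
    rw [Red, ← hQ ht hm.atomic] at this
    simpa only [act_eq_sub] using this

end

/-- The fundamental theorem: substituting computable deductions for the assumptions of a deduction
yields a computable deduction. -/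
theorem PlainProves.red {Γ : List (Fm L)} {D : Ded L} {A : Fm L} (h : PlainProves Γ D A)
    {Δ : List (Fm L)} {σ : ℕ → Tm L} {τ : ℕ → Ded L} (hτ : Env Γ Δ σ τ) :
    Red Δ (A.subst σ) (D.sub σ τ) := by
  induction h generalizing Δ σ τ with
  | hyp h => exact hτ.red h
  | andI _ _ ih₁ ih₂ => exact red_andI (ih₁ hτ) (ih₂ hτ)
  | andE₁ _ ih => exact red_andE₁ (ih hτ)
  | andE₂ _ ih => exact red_andE₂ (ih hτ)
  | orI₁ _ ih => exact red_orI₁ (ih hτ)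
  | orI₂ _ ih => exact red_orI₂ (ih hτ)
  | orE _ _ _ ih₁ ih₂ ih₃ => exact red_orE (ih₁ hτ) (hτ.body ih₂) (hτ.body ih₃)
  | impI _ ih => exact red_impI (hτ.body ih)
  | impE _ _ ih₁ ih₂ => exact red_impE (ih₁ hτ) (ih₂ hτ)
  | botE h _ ih => exact red_botE (h.subst hτ.atomic) (ih hτ)
  | allI _ ih =>
    exact red_allI (hτ.bodyP ih (fun _ _ => rfl) (by rw [Fm.skel_subst _ hτ.atomic.upSub]))
  | allE h _ _ ih₁ ih₂ =>
    rw [Fm.inst_subst]; exact red_allE (h.subst hτ.atomic) (ih₁ hτ) (ih₂ hτ)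
  | exI h _ _ ih₁ ih₂ =>
    have h₁ := ih₁ hτ
    rw [Fm.inst_subst] at h₁
    exact red_exI (h.subst hτ.atomic) h₁ (ih₂ hτ)
  | @exE _ _ _ _ C _ _ ih₁ ih₂ =>
    refine red_exE (ih₁ hτ) ?_
    rw [← Fm.shift_subst_upSub]
    exact hτ.bodyPP ih₂ fun h h' => by
      rw [Fm.skel_subst _ hτ.atomic, Fm.skel_subst _ (h'.scons h), Fm.skel_shift]
  | @eqI _ _ _ t C _ _ ih₁ ih₂ =>
    refine red_eqI (ih₁ hτ) ?_
    rw [← Fm.shift_subst_upSub, ← Tm.shift_subst_upSub]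
    refine hτ.bodyP ih₂ (fun h _ => ?_) ?_
    · rw [← h.skel_eq]; rfl
    · rw [Fm.skel_subst _ hτ.atomic, Fm.skel_shift]
  | eqE h _ _ ih₁ ih₂ =>
    have h₂ := ih₂ hτ
    rw [Fm.inst_subst] at h₂ ⊢
    exact red_eqE (h.subst _) (ih₁ hτ) h₂
  | ad h _ ih => exact red_denotes (ih hτ) (.ad (h.subst hτ.atomic))
  | iotaI h _ _ _ ih₁ ih₂ ih₃ =>
    refine red_iotaI (h.subst hτ.atomic) (ih₁ hτ) ?_ ?_
    · rw [← Tm.shift_subst_upSub]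
      refine hτ.bodyP ih₂ (fun h _ => ?_) ?_
      · rw [← h.skel_eq]; rfl
      · rw [Fm.skel_subst _ hτ.atomic.upSub]
    · rw [← Tm.shift_subst_upSub]
      refine hτ.bodyPP ih₃ fun h _ => ?_
      rw [← h.skel_eq]; rfl
  | iotaE₁ h h' _ _ ih₁ ih₂ =>
    rw [Fm.inst_subst]
    exact red_iotaE₁ (h.subst hτ.atomic) (h'.subst hτ.atomic) (ih₁ hτ) (ih₂ hτ)
  | iotaE₂ h h' _ _ _ ih₁ ih₂ ih₃ =>
    have h₂ := ih₂ hτ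
    rw [Fm.inst_subst] at h₂
    exact red_iotaE₂ (h.subst hτ.atomic) (h'.subst hτ.atomic) (ih₁ hτ) h₂ (ih₃ hτ)
  | iotaE₃ _ ih => exact red_denotes (ih hτ) .iotaE₃

/-- Every deduction in which identity is eliminated from arguments only reduces to one that is
normal up to the conditions on the general introduction rule for identity. -/
theorem PlainProves.exists_pre {Γ : List (Fm L)} {D : Ded L} {A : Fm L} (h : PlainProves Γ D A) :
    ∃ D', ReducesTo D D' ∧ PlainProves Γ D' A ∧ D'.Pre := by
  have := h.red (Δ := Γ) (σ := .var) (τ := Ded.hyp)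
    ⟨atomicSub_var, fun {i B} hB => redOf_hyp (by rw [hB, Fm.subst_var])⟩
  rw [Fm.subst_var, sub_var_hyp] at this
  exact this.exists_pre

end Ded

/-! ### Injective renamings of parameters -/

theorem upRen_injective {f : ℕ → ℕ} (hf : f.Injective) : (upRen f).Injective := by
  intro i j h
  cases i <;> cases j <;> simp_all [upRen]
  exact hf h

theorem Tm.subst_var_comp_injective {f : ℕ → ℕ} (hf : f.Injective) :
    Function.Injective (Tm.subst fun i => (.var (f i) : Tm L)) := fun r s h => by
  have h' (r : Tm L) : (r.subst fun i => .var (f i)).subst (fun i => .var (f.invFun i)) = r := by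
    rw [Tm.subst_subst]
    convert Tm.subst_var r using 2
    funext i
    rw [Tm.subst, Function.leftInverse_invFun hf]
  rw [← h' r, ← h' s]; exact congrArg _ h

namespace Ded

theorem act_hyp_eq {σ : ℕ → Tm L} {ρ : ℕ → ℕ} {d : Ded L} {i : ℕ} (h : d.act σ ρ = hyp i) :
    ∃ j, d = hyp j ∧ ρ j = i := by
  cases d <;> simp [act, psubst, hrename] at h
  exact ⟨_, rfl, h⟩

/-- Normality is preserved by renaming parameters injectively.  Renamings that identify parameters
can make an application of `eqE` replace a term by itself. -/
theorem Pre.act {d : Ded L} (h : d.Pre) {f : ℕ → ℕ} (hf : f.Injective) (ρ : ℕ → ℕ) :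
    (d.act (fun i => .var (f i)) ρ).Pre := by
  have hk (d : Ded L) (σ : ℕ → Tm L) (ρ) : ((d.psubst σ).hrename ρ).kind = d.kind := kind_act σ ρ d
  have hw (A : Fm L) (h : ∀ w, A ≠ .exist w) (σ : ℕ → Tm L) (w) : A.subst σ ≠ .exist w := by
    cases A <;> simp_all [Fm.subst]
  induction d generalizing f ρ with
  | eqE A s t d e ih₁ ih₂ =>
    have h₁ := ih₁ h.1.1 hf ρ
    have h₂ := ih₂ h.2.1 hf ρ
    refine ⟨⟨h₁, ?_⟩, h₂, fun h' => h.2.2.1 (Tm.subst_var_comp_injective hf h'),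
      hw A h.2.2.2 _⟩
    rw [hk]; exact h.1.2
  | _ =>
    simp only [Pre, Ded.act, psubst, hrename, Neutral, hk, upSub_var_comp] at *
    try simp_all [upRen_injective hf]

/-! ### Assumptions discharged by the general introduction rule for identity -/

/-- From no assumption `s = r` in a class in `S` or discharged by the general introduction rule for
identity is it inferred that `∃! r`. -/
def Clean : (ℕ → Prop) → Ded L → Prop
  | _, hyp _ => True
  | S, andI d e => Clean S d ∧ Clean S e
  | S, andE₁ _ _ d => Clean S d
  | S, andE₂ _ _ d => Clean S d
  | S, orI₁ _ d => Clean S d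
  | S, orI₂ _ d => Clean S d
  | S, orE _ _ _ d e₁ e₂ => Clean S d ∧ Clean (scons False S) e₁ ∧ Clean (scons False S) e₂
  | S, impI _ d => Clean (scons False S) d
  | S, impE _ _ d e => Clean S d ∧ Clean S e
  | S, botE _ d => Clean S d
  | S, allI _ d => Clean (scons False S) d
  | S, allE _ _ d e => Clean S d ∧ Clean S e
  | S, exI _ _ d e => Clean S d ∧ Clean S e
  | S, exE _ _ d e => Clean S d ∧ Clean (scons False (scons False S)) e
  | S, eqI _ _ d e => Clean S d ∧ Clean (scons True S) e
  | S, eqE _ _ _ d e => Clean S d ∧ Clean S e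
  | S, ad A r d => (∀ i s, d = hyp i → A = .eq s r → ¬ S i) ∧ Clean S d
  | S, iotaI _ _ d e f =>
      Clean S d ∧ Clean (scons False S) e ∧ Clean (scons False (scons False S)) f
  | S, iotaE₁ _ _ _ d e => Clean S d ∧ Clean S e
  | S, iotaE₂ _ _ _ d e f => Clean S d ∧ Clean S e ∧ Clean S f
  | S, iotaE₃ _ _ d => (∀ i, d = hyp i → ¬ S i) ∧ Clean S d

theorem scons_comp_upRen {α : Type*} (a : α) (S : ℕ → α) (ρ : ℕ → ℕ) :
    (fun i => scons a S (upRen ρ i)) = scons a fun i => S (ρ i) := by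
  funext i; cases i <;> rfl

theorem Clean.act {d : Ded L} {S : ℕ → Prop} {ρ : ℕ → ℕ} (h : d.Clean fun i => S (ρ i))
    {f : ℕ → ℕ} (hf : f.Injective) : (d.act (fun i => .var (f i)) ρ).Clean S := by
  induction d generalizing f ρ S with
  | ad A r d ih =>
    refine ⟨fun i s hd hA => ?_, ih h.2 hf⟩
    obtain ⟨j, rfl, rfl⟩ := act_hyp_eq hd
    cases A <;> simp [Fm.subst] at hA
    obtain ⟨rfl, hA⟩ := hA
    rw [Tm.subst_var_comp_injective hf hA] at h
    exact h.1 j _ rfl rfl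
  | iotaE₃ F t d ih =>
    refine ⟨fun i hd => ?_, ih h.2 hf⟩
    obtain ⟨j, rfl, rfl⟩ := act_hyp_eq hd
    exact h.1 j rfl
  | hyp i => trivial
  | _ =>
    simp only [Clean, Ded.act, psubst, hrename, upSub_var_comp] at *
    simp_all [upRen_injective hf, scons_comp_upRen]

/-- Substitute `m` for the assumption class `k`, closing the gap. -/
def single (k : ℕ) (m : Ded L) (i : ℕ) : Ded L :=
  if i < k then hyp i else if i = k then m else hyp (i - 1)

theorem single_zero (m : Ded L) : single 0 m = scons m hyp := by
  funext i; cases i <;> rfl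

theorem upH_single (k : ℕ) (m : Ded L) : upH (single k m) = single (k + 1) (m.hshift 1) := by
  funext i
  cases i with
  | zero => simp [single, upH]
  | succ i =>
    rcases lt_trichotomy i k with h | rfl | h
    · simp [single, upH, h, hshift, hrename]
    · simp [single, upH]
    · simp [single, upH, h.not_gt, h.ne', hshift, hrename, show i - 1 + 1 = i by omega]

theorem upP_single (k : ℕ) (m : Ded L) : upP (single k m) = single k m.pshift := by
  funext i
  simp only [single, upP]
  split_ifs <;> rfl

/-- The result `R` of replacing in a deduction `e` of `A` some subdeductions of formulas `∃! r`. -/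
structure Replaced (Γ : List (Fm L)) (S : ℕ → Prop) (A : Fm L) (e R : Ded L) : Prop where
  proves : PlainProves Γ R A
  pre : R.Pre
  clean : R.Clean S
  head : (R.kind = e.kind ∧ ∀ i, R = hyp i → e = hyp i) ∨ ((∃ r, A = .exist r) ∧ R.Neutral)

theorem Replaced.neutral {Γ : List (Fm L)} {S : ℕ → Prop} {A : Fm L} {e R : Ded L}
    (h : Replaced Γ S A e R) (he : e.Neutral) : R.Neutral := by
  rcases h.head with ⟨h, -⟩ | ⟨-, h⟩
  · rwa [Neutral, h]
  · exact h

theorem Replaced.kind_ne {Γ : List (Fm L)} {S : ℕ → Prop} {A : Fm L} {e R : Ded L}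
    (h : Replaced Γ S A e R) (he : e.kind ≠ .del) : R.kind ≠ .del := by
  rcases h.head with ⟨h, -⟩ | ⟨-, h | h⟩
  · rwa [h]
  · simp [h]
  · simp [h]

/-- In `e'` there is a further assumption class, numbered `k` outside of the scope that is described
by the changes `u` of substitutions and `v` of sets of assumption classes.  Substituting for it the
inferences of `∃! r` from assumptions `s = r` yields `e`, while substituting a normal neutral
deduction yields a normal deduction without such inferences. -/
structure Marked (Γ : List (Fm L)) (k : ℕ) (s r : Tm L) (S : ℕ → Prop)
    (u : (ℕ → Ded L) → ℕ → Ded L) (v : (ℕ → Prop) → ℕ → Prop) (Γ' : List (Fm L)) (A : Fm L)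
    (e e' : Ded L) : Prop where
  eq : e'.hsubst (u (single k (ad (.eq s r) r (hyp k)))) = e
  replaced : ∀ ⦃m⦄, PlainProves Γ m (.exist r) → m.Pre → m.Neutral →
    m.Clean (fun i => S i ∨ i = k) →
    Replaced Γ' (v fun i => S i ∨ i = k) A e (e'.hsubst (u (single k m)))

section
variable {Γ Γ' : List (Fm L)} {k : ℕ} {s r : Tm L} {S : ℕ → Prop}
  {u : (ℕ → Ded L) → ℕ → Ded L} {v : (ℕ → Prop) → ℕ → Prop} {A B : Fm L} {e e' : Ded L}

theorem Marked.up {b : Prop} (h : Marked (B :: Γ) (k + 1) s r (scons b S) u v Γ' A e e') :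
    Marked Γ k s r S (fun τ => u (upH τ)) (fun S => v (scons b S)) Γ' A e e' := by
  refine ⟨by rw [upH_single]; exact h.eq, fun m h₁ h₂ h₃ h₄ => ?_⟩
  have hS : scons b (fun i => S i ∨ i = k) = fun i => scons b S i ∨ i = k + 1 := by
    funext i; cases i <;> simp
  have hm : m.hshift 1 = m.act (fun i => .var (id i)) Nat.succ := by
    simp only [hshift, Ded.act, id]; rw [psubst_var]
  rw [upH_single, hS, hm]
  refine h.replaced ?_ (h₂.act Function.injective_id _) ?_ ?_
  · simpa using h₁.act ((Mor.refl Γ).weaken B)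
  · rwa [Neutral, kind_act]
  · rw [← hS]; exact Clean.act h₄ Function.injective_id

theorem Marked.upP (h : Marked (Γ.map Fm.shift) k s.shift r.shift S u v Γ' A e e') :
    Marked Γ k s r S (fun τ => u (upP τ)) v Γ' A e e' := by
  have hr : ad (.eq s.shift r.shift) r.shift (hyp k) = (ad (.eq s r) r (hyp k)).pshift := by
    simp only [pshift, psubst, Fm.subst, Tm.shift_eq_subst]
  refine ⟨by rw [upP_single, ← hr]; exact h.eq, fun m h₁ h₂ h₃ h₄ => ?_⟩
  have hm : m.pshift = m.act (fun i => .var (i + 1)) id := by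
    rw [Ded.act, hrename_eq_hsubst]; exact (hsubst_hyp _).symm
  rw [upP_single, hm]
  refine h.replaced ?_ (h₂.act (add_left_injective 1) _) ?_ ?_
  · rw [show Fm.exist r.shift = (Fm.exist r).shift from rfl, Fm.shift_eq_subst]
    exact h₁.act (Mor.shift Γ)
  · rwa [Neutral, kind_act]
  · exact Clean.act h₄ (add_left_injective 1)

/-- The inferences of `∃! r` from the assumptions `s = r` of a class can be given an assumption
class of their own. -/
theorem PlainProves.exists_marked (h : PlainProves Γ e A) (hs : ¬ s.IsIota)
    (hk : Γ[k]? = some (.eq s r)) (hp : e.Pre) (hc : e.Clean S) :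
    ∃ e', Marked Γ k s r S id id Γ A e e' := by
  have hup {Γ : List (Fm L)} {k : ℕ} {s r : Tm L} (hk : Γ[k]? = some (Fm.eq s r)) :
      (Γ.map Fm.shift)[k]? = some (Fm.eq s.shift r.shift) := by
    rw [List.getElem?_map, hk]; rfl
  have hsu {s : Tm L} (hs : ¬ s.IsIota) : ¬ s.shift.IsIota := fun h => hs ((Tm.isIota_shift s).1 h)
  induction h generalizing k s r S with
  | @hyp Γ i A hi =>
    refine ⟨Ded.hyp (if i < k then i else i + 1), ?_, fun m _ _ _ _ => ?_⟩
    · by_cases h : i < k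
      · simp [hsubst, single, h]
      · simp [hsubst, single, h, show ¬ i + 1 < k by omega, show ¬ i + 1 = k by omega]
    · have : (Ded.hyp (if i < k then i else i + 1)).hsubst (id (single k m)) = Ded.hyp i := by
        by_cases h : i < k
        · simp [hsubst, single, h]
        · simp [hsubst, single, h, show ¬ i + 1 < k by omega, show ¬ i + 1 = k by omega]
      rw [this]
      exact ⟨.hyp hi, trivial, trivial, .inl ⟨rfl, fun _ h => h⟩⟩
  | @ad Γ d A t hA hd ih =>
    by_cases h : d = Ded.hyp k ∧ t = r
    · -- The inference of `∃! r` from an assumption in the class `k` is the new assumption itself.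
      obtain ⟨rfl, rfl⟩ := h
      cases hd with | hyp hi => ?_
      obtain rfl : A = .eq s t := by simpa [hk] using hi.symm
      refine ⟨Ded.hyp k, by simp [hsubst, single], fun m h₁ h₂ h₃ h₄ => ?_⟩
      simp only [id, hsubst, single, lt_irrefl, if_true, if_false]
      exact ⟨h₁, h₂, h₄, .inr ⟨⟨_, rfl⟩, h₃⟩⟩
    · obtain ⟨d', hd'⟩ := ih hs hk hp.1 hc.2
      refine ⟨.ad A t d', congrArg _ hd'.eq, fun m h₁ h₂ h₃ h₄ => ?_⟩
      have R := hd'.replaced h₁ h₂ h₃ h₄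
      obtain ⟨hkind, hhyp⟩ := R.head.resolve_right
        (by rintro ⟨⟨_, rfl⟩, -⟩; exact hA)
      refine ⟨.ad hA R.proves, ⟨R.pre, hkind ▸ hp.2⟩, ⟨fun i s' hi hA' => ?_, R.clean⟩,
        .inl ⟨rfl, fun _ h => nomatch h⟩⟩
      obtain rfl := hhyp i hi
      rintro (hS | rfl)
      · exact hc.1 i s' rfl hA' hS
      · cases hd with | hyp hi => ?_
        rw [hA', hk] at hi
        simp at hi
        exact h ⟨rfl, hi.2.symm⟩
  | @iotaE₃ Γ d F t hd ih =>
    obtain ⟨d', hd'⟩ := ih hs hk hp.1 hc.2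
    refine ⟨.iotaE₃ F t d', congrArg _ hd'.eq, fun m h₁ h₂ h₃ h₄ => ?_⟩
    have R := hd'.replaced h₁ h₂ h₃ h₄
    obtain ⟨hkind, hhyp⟩ := R.head.resolve_right (by rintro ⟨⟨_, h⟩, -⟩; cases h)
    refine ⟨.iotaE₃ R.proves, ⟨R.pre, hkind ▸ hp.2⟩, ⟨fun i hi => ?_, R.clean⟩,
      .inl ⟨rfl, fun _ h => nomatch h⟩⟩
    obtain rfl := hhyp i hi
    rintro (hS | rfl)
    · exact hc.1 i rfl hS
    · cases hd with | hyp hi => ?_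
      rw [hk] at hi
      simp at hi
      exact hs (hi.1 ▸ trivial)
  | andI _ _ ih₁ ih₂ =>
    obtain ⟨d₁, h₁⟩ := ih₁ hs hk hp.1 hc.1
    obtain ⟨d₂, h₂⟩ := ih₂ hs hk hp.2 hc.2
    refine ⟨.andI d₁ d₂, congrArg₂ _ h₁.eq h₂.eq, fun m p q n c => ?_⟩
    have R₁ := h₁.replaced p q n c
    have R₂ := h₂.replaced p q n c
    exact ⟨.andI R₁.proves R₂.proves, ⟨R₁.pre, R₂.pre⟩, ⟨R₁.clean, R₂.clean⟩,
      .inl ⟨rfl, fun _ h => nomatch h⟩⟩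
  | andE₁ _ ih₁ =>
    obtain ⟨d₁, h₁⟩ := ih₁ hs hk hp.1 hc
    refine ⟨.andE₁ _ _ d₁, congrArg _ h₁.eq, fun m p q n c => ?_⟩
    have R₁ := h₁.replaced p q n c
    exact ⟨.andE₁ R₁.proves, ⟨R₁.pre, R₁.neutral hp.2⟩, R₁.clean,
      .inl ⟨rfl, fun _ h => nomatch h⟩⟩
  | andE₂ _ ih₁ =>
    obtain ⟨d₁, h₁⟩ := ih₁ hs hk hp.1 hc
    refine ⟨.andE₂ _ _ d₁, congrArg _ h₁.eq, fun m p q n c => ?_⟩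
    have R₁ := h₁.replaced p q n c
    exact ⟨.andE₂ R₁.proves, ⟨R₁.pre, R₁.neutral hp.2⟩, R₁.clean,
      .inl ⟨rfl, fun _ h => nomatch h⟩⟩
  | orI₁ _ ih₁ =>
    obtain ⟨d₁, h₁⟩ := ih₁ hs hk hp hc
    refine ⟨.orI₁ _ d₁, congrArg _ h₁.eq, fun m p q n c => ?_⟩
    have R₁ := h₁.replaced p q n c
    exact ⟨.orI₁ R₁.proves, R₁.pre, R₁.clean,
      .inl ⟨rfl, fun _ h => nomatch h⟩⟩
  | orI₂ _ ih₁ =>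
    obtain ⟨d₁, h₁⟩ := ih₁ hs hk hp hc
    refine ⟨.orI₂ _ d₁, congrArg _ h₁.eq, fun m p q n c => ?_⟩
    have R₁ := h₁.replaced p q n c
    exact ⟨.orI₂ R₁.proves, R₁.pre, R₁.clean,
      .inl ⟨rfl, fun _ h => nomatch h⟩⟩
  | orE _ _ _ ih₁ ih₂ ih₃ =>
    obtain ⟨d₁, h₁⟩ := ih₁ hs hk hp.1.1 hc.1
    obtain ⟨d₂, h₂⟩ := ih₂ hs (k := k + 1) (by simpa using hk) hp.2.1 hc.2.1
    obtain ⟨d₃, h₃⟩ := ih₃ hs (k := k + 1) (by simpa using hk) hp.2.2 hc.2.2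
    replace h₂ := h₂.up
    replace h₃ := h₃.up
    refine ⟨.orE _ _ _ d₁ d₂ d₃,
      by simp only [hsubst]; exact congr (congrArg₂ _ h₁.eq h₂.eq) h₃.eq, fun m p q n c => ?_⟩
    have R₁ := h₁.replaced p q n c
    have R₂ := h₂.replaced p q n c
    have R₃ := h₃.replaced p q n c
    exact ⟨.orE R₁.proves R₂.proves R₃.proves, ⟨⟨R₁.pre, R₁.neutral hp.1.2⟩, R₂.pre, R₃.pre⟩,
      ⟨R₁.clean, R₂.clean, R₃.clean⟩,
      .inl ⟨rfl, fun _ h => nomatch h⟩⟩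
  | impI _ ih₁ =>
    obtain ⟨d₁, h₁⟩ := ih₁ hs (k := k + 1) (by simpa using hk) hp hc
    replace h₁ := h₁.up
    refine ⟨.impI _ d₁, congrArg _ h₁.eq, fun m p q n c => ?_⟩
    have R₁ := h₁.replaced p q n c
    exact ⟨.impI R₁.proves, R₁.pre, R₁.clean,
      .inl ⟨rfl, fun _ h => nomatch h⟩⟩
  | impE _ _ ih₁ ih₂ =>
    obtain ⟨d₁, h₁⟩ := ih₁ hs hk hp.1.1 hc.1
    obtain ⟨d₂, h₂⟩ := ih₂ hs hk hp.2 hc.2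
    refine ⟨.impE _ _ d₁ d₂, congrArg₂ _ h₁.eq h₂.eq, fun m p q n c => ?_⟩
    have R₁ := h₁.replaced p q n c
    have R₂ := h₂.replaced p q n c
    exact ⟨.impE R₁.proves R₂.proves, ⟨⟨R₁.pre, R₁.neutral hp.1.2⟩, R₂.pre⟩, ⟨R₁.clean, R₂.clean⟩,
      .inl ⟨rfl, fun _ h => nomatch h⟩⟩
  | botE g₁ _ ih₁ =>
    obtain ⟨d₁, h₁⟩ := ih₁ hs hk hp.1 hc
    refine ⟨.botE _ d₁, congrArg _ h₁.eq, fun m p q n c => ?_⟩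
    have R₁ := h₁.replaced p q n c
    exact ⟨.botE g₁ R₁.proves, ⟨R₁.pre, R₁.neutral hp.2⟩, R₁.clean,
      .inl ⟨rfl, fun _ h => nomatch h⟩⟩
  | allI _ ih₁ =>
    obtain ⟨d₁, h₁⟩ := ih₁ (hsu hs) (k := k + 1) (by simpa using hup hk) hp hc
    replace h₁ := h₁.up.upP
    refine ⟨.allI _ d₁, congrArg _ h₁.eq, fun m p q n c => ?_⟩
    have R₁ := h₁.replaced p q n c
    exact ⟨.allI R₁.proves, R₁.pre, R₁.clean,
      .inl ⟨rfl, fun _ h => nomatch h⟩⟩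
  | allE g₁ _ _ ih₁ ih₂ =>
    obtain ⟨d₁, h₁⟩ := ih₁ hs hk hp.1.1 hc.1
    obtain ⟨d₂, h₂⟩ := ih₂ hs hk hp.2 hc.2
    refine ⟨.allE _ _ d₁ d₂, congrArg₂ _ h₁.eq h₂.eq, fun m p q n c => ?_⟩
    have R₁ := h₁.replaced p q n c
    have R₂ := h₂.replaced p q n c
    exact ⟨.allE g₁ R₁.proves R₂.proves, ⟨⟨R₁.pre, R₁.neutral hp.1.2⟩, R₂.pre⟩,
      ⟨R₁.clean, R₂.clean⟩,
      .inl ⟨rfl, fun _ h => nomatch h⟩⟩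
  | exI g₁ _ _ ih₁ ih₂ =>
    obtain ⟨d₁, h₁⟩ := ih₁ hs hk hp.1 hc.1
    obtain ⟨d₂, h₂⟩ := ih₂ hs hk hp.2 hc.2
    refine ⟨.exI _ _ d₁ d₂, congrArg₂ _ h₁.eq h₂.eq, fun m p q n c => ?_⟩
    have R₁ := h₁.replaced p q n c
    have R₂ := h₂.replaced p q n c
    exact ⟨.exI g₁ R₁.proves R₂.proves, ⟨R₁.pre, R₂.pre⟩, ⟨R₁.clean, R₂.clean⟩,
      .inl ⟨rfl, fun _ h => nomatch h⟩⟩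
  | exE _ _ ih₁ ih₂ =>
    obtain ⟨d₁, h₁⟩ := ih₁ hs hk hp.1.1 hc.1
    obtain ⟨d₂, h₂⟩ := ih₂ (hsu hs) (k := k + 2) (by simpa using hup hk) hp.2 hc.2
    replace h₂ := h₂.up.up.upP
    refine ⟨.exE _ _ d₁ d₂, congrArg₂ _ h₁.eq h₂.eq, fun m p q n c => ?_⟩
    have R₁ := h₁.replaced p q n c
    have R₂ := h₂.replaced p q n c
    exact ⟨.exE R₁.proves R₂.proves, ⟨⟨R₁.pre, R₁.neutral hp.1.2⟩, R₂.pre⟩, ⟨R₁.clean, R₂.clean⟩,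
      .inl ⟨rfl, fun _ h => nomatch h⟩⟩
  | eqI _ _ ih₁ ih₂ =>
    obtain ⟨d₁, h₁⟩ := ih₁ hs hk hp.1.1 hc.1
    obtain ⟨d₂, h₂⟩ := ih₂ (hsu hs) (k := k + 1) (by simpa using hup hk) hp.2 hc.2
    replace h₂ := h₂.up.upP
    refine ⟨.eqI _ _ d₁ d₂, congrArg₂ _ h₁.eq h₂.eq, fun m p q n c => ?_⟩
    have R₁ := h₁.replaced p q n c
    have R₂ := h₂.replaced p q n c
    exact ⟨.eqI R₁.proves R₂.proves, ⟨⟨R₁.pre, R₁.neutral hp.1.2⟩, R₂.pre⟩, ⟨R₁.clean, R₂.clean⟩,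
      .inl ⟨rfl, fun _ h => nomatch h⟩⟩
  | eqE g₁ _ _ ih₁ ih₂ =>
    obtain ⟨d₁, h₁⟩ := ih₁ hs hk hp.1.1 hc.1
    obtain ⟨d₂, h₂⟩ := ih₂ hs hk hp.2.1 hc.2
    refine ⟨.eqE _ _ _ d₁ d₂, congrArg₂ _ h₁.eq h₂.eq, fun m p q n c => ?_⟩
    have R₁ := h₁.replaced p q n c
    have R₂ := h₂.replaced p q n c
    exact ⟨.eqE g₁ R₁.proves R₂.proves, ⟨⟨R₁.pre, R₁.kind_ne hp.1.2⟩, R₂.pre, hp.2.2⟩,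
      ⟨R₁.clean, R₂.clean⟩,
      .inl ⟨rfl, fun _ h => nomatch h⟩⟩
  | iotaI g₁ _ _ _ ih₁ ih₂ ih₃ =>
    obtain ⟨d₁, h₁⟩ := ih₁ hs hk hp.1 hc.1
    obtain ⟨d₂, h₂⟩ := ih₂ (hsu hs) (k := k + 1) (by simpa using hup hk) hp.2.1 hc.2.1
    obtain ⟨d₃, h₃⟩ := ih₃ (hsu hs) (k := k + 2) (by simpa using hup hk) hp.2.2 hc.2.2
    replace h₂ := h₂.up.upP
    replace h₃ := h₃.up.up.upP
    refine ⟨.iotaI _ _ d₁ d₂ d₃,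
      by simp only [hsubst]; exact congr (congrArg₂ _ h₁.eq h₂.eq) h₃.eq, fun m p q n c => ?_⟩
    have R₁ := h₁.replaced p q n c
    have R₂ := h₂.replaced p q n c
    have R₃ := h₃.replaced p q n c
    exact ⟨.iotaI g₁ R₁.proves R₂.proves R₃.proves, ⟨R₁.pre, R₂.pre, R₃.pre⟩,
      ⟨R₁.clean, R₂.clean, R₃.clean⟩,
      .inl ⟨rfl, fun _ h => nomatch h⟩⟩
  | iotaE₁ g₁ g₂ _ _ ih₁ ih₂ =>
    obtain ⟨d₁, h₁⟩ := ih₁ hs hk hp.1.1 hc.1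
    obtain ⟨d₂, h₂⟩ := ih₂ hs hk hp.2 hc.2
    refine ⟨.iotaE₁ _ _ _ d₁ d₂, congrArg₂ _ h₁.eq h₂.eq, fun m p q n c => ?_⟩
    have R₁ := h₁.replaced p q n c
    have R₂ := h₂.replaced p q n c
    exact ⟨.iotaE₁ g₁ g₂ R₁.proves R₂.proves, ⟨⟨R₁.pre, R₁.neutral hp.1.2⟩, R₂.pre⟩,
      ⟨R₁.clean, R₂.clean⟩,
      .inl ⟨rfl, fun _ h => nomatch h⟩⟩
  | iotaE₂ g₁ g₂ _ _ _ ih₁ ih₂ ih₃ =>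
    obtain ⟨d₁, h₁⟩ := ih₁ hs hk hp.1.1 hc.1
    obtain ⟨d₂, h₂⟩ := ih₂ hs hk hp.2.1 hc.2.1
    obtain ⟨d₃, h₃⟩ := ih₃ hs hk hp.2.2 hc.2.2
    refine ⟨.iotaE₂ _ _ _ d₁ d₂ d₃,
      by simp only [hsubst]; exact congr (congrArg₂ _ h₁.eq h₂.eq) h₃.eq, fun m p q n c => ?_⟩
    have R₁ := h₁.replaced p q n c
    have R₂ := h₂.replaced p q n c
    have R₃ := h₃.replaced p q n c
    exact ⟨.iotaE₂ g₁ g₂ R₁.proves R₂.proves R₃.proves,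
      ⟨⟨R₁.pre, R₁.neutral hp.1.2⟩, R₂.pre, R₃.pre⟩, ⟨R₁.clean, R₂.clean, R₃.clean⟩,
      .inl ⟨rfl, fun _ h => nomatch h⟩⟩

end

/-- `D'` is a normal deduction to which `D` reduces and in which no existence is inferred from
assumptions discharged by the general introduction rule for identity. -/
structure Cleaned (Γ : List (Fm L)) (A : Fm L) (D D' : Ded L) : Prop where
  red : ReducesTo D D'
  proves : PlainProves Γ D' A
  pre : D'.Pre
  clean : D'.Clean fun _ => False
  kind : D'.kind = D.kind

theorem Cleaned.neutral {Γ : List (Fm L)} {A : Fm L} {D D' : Ded L} (h : Cleaned Γ A D D')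
    (hD : D.Neutral) : D'.Neutral := by rwa [Neutral, h.kind]

theorem scons_false : (scons False fun _ => False : ℕ → Prop) = fun _ => False := by
  funext i; cases i <;> rfl

/-- The inferences of `∃! t` from assumptions `a = t` discharged by the general introduction rule
for identity are replaced by the major premise `∃! t`, innermost applications first. -/
theorem PlainProves.exists_cleaned {Γ : List (Fm L)} {D : Ded L} {A : Fm L}
    (h : PlainProves Γ D A) (hp : D.Pre) : ∃ D', Cleaned Γ A D D' := by
  induction h with
  | hyp h => exact ⟨_, .refl _, .hyp h, trivial, trivial, rfl⟩
  | ad g _ ih =>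
    obtain ⟨_, h⟩ := ih hp.1
    exact ⟨_, .ad h.red, .ad g h.proves, ⟨h.pre, h.kind ▸ hp.2⟩, ⟨fun _ _ _ _ h => h, h.clean⟩, rfl⟩
  | iotaE₃ _ ih =>
    obtain ⟨_, h⟩ := ih hp.1
    exact ⟨_, .iotaE₃ h.red, .iotaE₃ h.proves, ⟨h.pre, h.kind ▸ hp.2⟩,
      ⟨fun _ _ h => h, h.clean⟩, rfl⟩
  | @eqI Γ d e t C _ _ ih₁ ih₂ =>
    obtain ⟨m, h₁⟩ := ih₁ hp.1.1
    obtain ⟨e', h₂⟩ := ih₂ hp.2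
    obtain ⟨e'', hm⟩ := h₂.proves.exists_marked (k := 0) (s := .var 0) (r := t.shift) id rfl
      h₂.pre h₂.clean
    have hact : m.pshift.hshift 1 = m.act (fun i => .var (i + 1)) Nat.succ := rfl
    have hS : (fun i => False ∨ i = 0) = scons True fun _ => False := by
      funext i; cases i <;> simp
    have R := hm.replaced (m := m.pshift.hshift 1)
      (by
        rw [show Fm.exist t.shift = (Fm.exist t).shift from rfl, Fm.shift_eq_subst, hact]
        exact h₁.proves.act ((Mor.shift Γ).weaken _))
      (h₁.pre.act (add_left_injective 1) _)
      (by rw [hact, Neutral, kind_act]; exact h₁.neutral hp.1.2)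
      (by rw [hS, hact]; exact Clean.act h₁.clean (add_left_injective 1))
    have hr := hm.eq
    rw [id, single_zero] at hr R
    rw [hS] at R
    refine ⟨Ded.eqI t C m _, (ReducesTo.eqI h₁.red h₂.red).trans ?_, .eqI h₁.proves R.proves,
      ⟨⟨h₁.pre, h₁.neutral hp.1.2⟩, R.pre⟩, ⟨h₁.clean, R.clean⟩, rfl⟩
    rw [← hr]
    exact .reduct .eqI_hyp
  | andI _ _ ih₁ ih₂ =>
    obtain ⟨_, h₁⟩ := ih₁ hp.1
    obtain ⟨_, h₂⟩ := ih₂ hp.2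
    exact ⟨_, .andI h₁.red h₂.red, .andI h₁.proves h₂.proves, ⟨h₁.pre, h₂.pre⟩,
      ⟨h₁.clean, h₂.clean⟩, rfl⟩
  | andE₁ _ ih₁ =>
    obtain ⟨_, h₁⟩ := ih₁ hp.1
    exact ⟨_, .andE₁ h₁.red, .andE₁ h₁.proves, ⟨h₁.pre, h₁.neutral hp.2⟩,
      h₁.clean, rfl⟩
  | andE₂ _ ih₁ =>
    obtain ⟨_, h₁⟩ := ih₁ hp.1
    exact ⟨_, .andE₂ h₁.red, .andE₂ h₁.proves, ⟨h₁.pre, h₁.neutral hp.2⟩,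
      h₁.clean, rfl⟩
  | orI₁ _ ih₁ =>
    obtain ⟨_, h₁⟩ := ih₁ hp
    exact ⟨_, .orI₁ h₁.red, .orI₁ h₁.proves, h₁.pre,
      h₁.clean, rfl⟩
  | orI₂ _ ih₁ =>
    obtain ⟨_, h₁⟩ := ih₁ hp
    exact ⟨_, .orI₂ h₁.red, .orI₂ h₁.proves, h₁.pre,
      h₁.clean, rfl⟩
  | orE _ _ _ ih₁ ih₂ ih₃ =>
    obtain ⟨_, h₁⟩ := ih₁ hp.1.1
    obtain ⟨_, h₂⟩ := ih₂ hp.2.1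
    obtain ⟨_, h₃⟩ := ih₃ hp.2.2
    exact ⟨_, .orE h₁.red h₂.red h₃.red, .orE h₁.proves h₂.proves h₃.proves,
      ⟨⟨h₁.pre, h₁.neutral hp.1.2⟩, h₂.pre, h₃.pre⟩,
      ⟨h₁.clean, by simpa only [scons_false] using h₂.clean,
        by simpa only [scons_false] using h₃.clean⟩, rfl⟩
  | impI _ ih₁ =>
    obtain ⟨_, h₁⟩ := ih₁ hp
    exact ⟨_, .impI h₁.red, .impI h₁.proves, h₁.pre,
      by rw [Clean, scons_false]; exact h₁.clean, rfl⟩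
  | impE _ _ ih₁ ih₂ =>
    obtain ⟨_, h₁⟩ := ih₁ hp.1.1
    obtain ⟨_, h₂⟩ := ih₂ hp.2
    exact ⟨_, .impE h₁.red h₂.red, .impE h₁.proves h₂.proves, ⟨⟨h₁.pre, h₁.neutral hp.1.2⟩, h₂.pre⟩,
      ⟨h₁.clean, h₂.clean⟩, rfl⟩
  | botE g₁ _ ih₁ =>
    obtain ⟨_, h₁⟩ := ih₁ hp.1
    exact ⟨_, .botE h₁.red, .botE g₁ h₁.proves, ⟨h₁.pre, h₁.neutral hp.2⟩,
      h₁.clean, rfl⟩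
  | allI _ ih₁ =>
    obtain ⟨_, h₁⟩ := ih₁ hp
    exact ⟨_, .allI h₁.red, .allI h₁.proves, h₁.pre,
      by rw [Clean, scons_false]; exact h₁.clean, rfl⟩
  | allE g₁ _ _ ih₁ ih₂ =>
    obtain ⟨_, h₁⟩ := ih₁ hp.1.1
    obtain ⟨_, h₂⟩ := ih₂ hp.2
    exact ⟨_, .allE h₁.red h₂.red, .allE g₁ h₁.proves h₂.proves,
      ⟨⟨h₁.pre, h₁.neutral hp.1.2⟩, h₂.pre⟩,
      ⟨h₁.clean, h₂.clean⟩, rfl⟩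
  | exI g₁ _ _ ih₁ ih₂ =>
    obtain ⟨_, h₁⟩ := ih₁ hp.1
    obtain ⟨_, h₂⟩ := ih₂ hp.2
    exact ⟨_, .exI h₁.red h₂.red, .exI g₁ h₁.proves h₂.proves, ⟨h₁.pre, h₂.pre⟩,
      ⟨h₁.clean, h₂.clean⟩, rfl⟩
  | exE _ _ ih₁ ih₂ =>
    obtain ⟨_, h₁⟩ := ih₁ hp.1.1
    obtain ⟨_, h₂⟩ := ih₂ hp.2
    exact ⟨_, .exE h₁.red h₂.red, .exE h₁.proves h₂.proves, ⟨⟨h₁.pre, h₁.neutral hp.1.2⟩, h₂.pre⟩,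
      ⟨h₁.clean, by simpa only [scons_false] using h₂.clean⟩, rfl⟩
  | eqE g₁ _ _ ih₁ ih₂ =>
    obtain ⟨_, h₁⟩ := ih₁ hp.1.1
    obtain ⟨_, h₂⟩ := ih₂ hp.2.1
    exact ⟨_, .eqE h₁.red h₂.red, .eqE g₁ h₁.proves h₂.proves,
      ⟨⟨h₁.pre, h₁.kind ▸ hp.1.2⟩, h₂.pre, hp.2.2⟩,
      ⟨h₁.clean, h₂.clean⟩, rfl⟩
  | iotaI g₁ _ _ _ ih₁ ih₂ ih₃ =>
    obtain ⟨_, h₁⟩ := ih₁ hp.1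
    obtain ⟨_, h₂⟩ := ih₂ hp.2.1
    obtain ⟨_, h₃⟩ := ih₃ hp.2.2
    exact ⟨_, .iotaI h₁.red h₂.red h₃.red, .iotaI g₁ h₁.proves h₂.proves h₃.proves,
      ⟨h₁.pre, h₂.pre, h₃.pre⟩,
      ⟨h₁.clean, by simpa only [scons_false] using h₂.clean,
        by simpa only [scons_false] using h₃.clean⟩, rfl⟩
  | iotaE₁ g₁ g₂ _ _ ih₁ ih₂ =>
    obtain ⟨_, h₁⟩ := ih₁ hp.1.1
    obtain ⟨_, h₂⟩ := ih₂ hp.2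
    exact ⟨_, .iotaE₁ h₁.red h₂.red, .iotaE₁ g₁ g₂ h₁.proves h₂.proves,
      ⟨⟨h₁.pre, h₁.neutral hp.1.2⟩, h₂.pre⟩,
      ⟨h₁.clean, h₂.clean⟩, rfl⟩
  | iotaE₂ g₁ g₂ _ _ _ ih₁ ih₂ ih₃ =>
    obtain ⟨_, h₁⟩ := ih₁ hp.1.1
    obtain ⟨_, h₂⟩ := ih₂ hp.2.1
    obtain ⟨_, h₃⟩ := ih₃ hp.2.2
    exact ⟨_, .iotaE₂ h₁.red h₂.red h₃.red, .iotaE₂ g₁ g₂ h₁.proves h₂.proves h₃.proves,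
      ⟨⟨h₁.pre, h₁.neutral hp.1.2⟩, h₂.pre, h₃.pre⟩,
      ⟨h₁.clean, h₂.clean, h₃.clean⟩, rfl⟩

/-! ### Existence inferred from an identity that is introduced from existence -/

/-- All deductions that occur in `D` have the property `p`. -/
def Hereditarily (p : Ded L → Prop) (D : Ded L) : Prop := ∀ ⦃k c⦄, D.Occurs k c → p c

theorem hereditarily_of_premises {p : Ded L → Prop} {D : Ded L} (hD : p D)
    (h : ∀ x ∈ D.premises, x.2.2.Hereditarily p) : D.Hereditarily p := by
  intro k c hc
  have : c = D ∨ ∃ x ∈ D.premises, ∃ k, x.2.2.Occurs k c := by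
    clear hD h
    induction hc with
    | root => exact .inl rfl
    | premise _ h ih =>
      rcases ih with rfl | ⟨x, hx, k, hk⟩
      · exact .inr ⟨_, h, 0, .root⟩
      · exact .inr ⟨x, hx, _, hk.premise h⟩
  rcases this with rfl | ⟨x, hx, k, hk⟩
  · exact hD
  · exact h x hx hk

/-- The last rule is not a general introduction of `t = t` from `∃! t` as inferred from an identity
`u = u`. -/
def NoExist : Ded L → Prop
  | eqI t C m _ => C = .eq t t → ∀ u d, ¬ Denotes (.eq u u) u d m
  | _ => True

/-- `D'` is a normal deduction to which `D` reduces, and in which no existence is inferred from an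
identity that is in turn introduced from that existence. -/
structure Collapsed (Γ : List (Fm L)) (A : Fm L) (D D' : Ded L) : Prop where
  red : ReducesTo D D'
  proves : PlainProves Γ D' A
  pre : D'.Pre
  clean : ∀ {S}, D.Clean S → D'.Clean S
  noExist : D'.Hereditarily NoExist
  head : D.kind ≠ .del → D'.kind = D.kind ∧ ∀ i, D' = hyp i → D = hyp i

theorem Neutral.kind_ne {D : Ded L} (h : D.Neutral) : D.kind ≠ .del := by
  rcases h with h | h <;> simp [h]

theorem Collapsed.neutral {Γ : List (Fm L)} {A : Fm L} {D D' : Ded L} (h : Collapsed Γ A D D')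
    (hD : D.Neutral) : D'.Neutral := by rwa [Neutral, (h.head hD.kind_ne).1]

/-- A general introduction of `t = t` from `∃! t` as inferred from `t = t` is replaced by the
deduction of the latter identity, innermost applications first.  The replaced deductions are
nowhere leftmost premises, because normality excludes that the general introduction rule concludes
a leftmost premise. -/
theorem PlainProves.exists_collapsed {Γ : List (Fm L)} {D : Ded L} {A : Fm L}
    (h : PlainProves Γ D A) (hp : D.Pre) : ∃ D', Collapsed Γ A D D' := by
  induction h with
  | @hyp _ i _ h =>
    exact ⟨Ded.hyp i, .refl _, .hyp h, trivial, id,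
      hereditarily_of_premises trivial (by simp [premises]), fun _ => ⟨rfl, fun _ h => h⟩⟩
  | @ad _ _ _ _ g _ ih =>
    obtain ⟨_, h⟩ := ih hp.1
    have hk := h.head (by rcases hp.2 with h | h <;> simp [h])
    exact ⟨_, .ad h.red, .ad g h.proves, ⟨h.pre, hk.1 ▸ hp.2⟩,
      fun c => ⟨fun i s hi => c.1 i s (hk.2 i hi), h.clean c.2⟩,
      hereditarily_of_premises trivial (by simpa [premises] using h.noExist),
      fun _ => ⟨rfl, fun _ h => nomatch h⟩⟩
  | iotaE₃ _ ih =>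
    obtain ⟨_, h⟩ := ih hp.1
    have hk := h.head (by simp [hp.2])
    exact ⟨_, .iotaE₃ h.red, .iotaE₃ h.proves, ⟨h.pre, hk.1 ▸ hp.2⟩,
      fun c => ⟨fun i hi => c.1 i (hk.2 i hi), h.clean c.2⟩,
      hereditarily_of_premises trivial (by simpa [premises] using h.noExist),
      fun _ => ⟨rfl, fun _ h => nomatch h⟩⟩
  | @eqI Γ d e t C _ _ ih₁ ih₂ =>
    obtain ⟨m, h₁⟩ := ih₁ hp.1.1
    obtain ⟨e', h₂⟩ := ih₂ hp.2
    have hr := ReducesTo.eqI (t := t) (C := C) h₁.red h₂.red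
    by_cases hC : C = .eq t t ∧ ∃ u d, Denotes (.eq u u) u d m
    · obtain ⟨rfl, u, d', hD⟩ := hC
      have hm : PlainProves Γ d' (.eq u u) ∧ u = t ∧ d'.Pre ∧ (∀ {S}, m.Clean S → d'.Clean S) ∧
          d'.Hereditarily NoExist := by
        have hq := h₁.proves
        have hpm := h₁.pre
        have hnm := h₁.noExist
        cases hD with
        | ad h =>
          cases hq with | ad _ hq => ?_
          exact ⟨hq, rfl, hpm.1, fun c => c.2, fun k c hc => hnm (hc.of_premise (.head _))⟩
        | iotaE₃ =>
          cases hq with | iotaE₃ hq => ?_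
          exact ⟨hq, rfl, hpm.1, fun c => c.2, fun k c hc => hnm (hc.of_premise (.head _))⟩
      obtain ⟨hd, rfl, hpd, hcd, hnd⟩ := hm
      exact ⟨d', hr.trans (.reduct (.denotes_eqI hD)), hd, hpd, fun c => hcd (h₁.clean c.1), hnd,
        fun h => (h rfl).elim⟩
    · exact ⟨_, hr, .eqI h₁.proves h₂.proves, ⟨⟨h₁.pre, h₁.neutral hp.1.2⟩, h₂.pre⟩,
        fun c => ⟨h₁.clean c.1, h₂.clean c.2⟩,
        hereditarily_of_premises (fun h u d h' => hC ⟨h, u, d, h'⟩)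
          (by simpa [premises] using ⟨h₁.noExist, h₂.noExist⟩), fun h => (h rfl).elim⟩
  | andI _ _ ih₁ ih₂ =>
    obtain ⟨_, h₁⟩ := ih₁ hp.1
    obtain ⟨_, h₂⟩ := ih₂ hp.2
    exact ⟨_, .andI h₁.red h₂.red, .andI h₁.proves h₂.proves, ⟨h₁.pre, h₂.pre⟩,
      fun c => ⟨h₁.clean c.1, h₂.clean c.2⟩, hereditarily_of_premises trivial
        (by simpa [premises] using ⟨h₁.noExist, h₂.noExist⟩), fun _ => ⟨rfl, fun _ h => nomatch h⟩⟩
  | andE₁ _ ih₁ =>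
    obtain ⟨_, h₁⟩ := ih₁ hp.1
    exact ⟨_, .andE₁ h₁.red, .andE₁ h₁.proves, ⟨h₁.pre, h₁.neutral hp.2⟩,
      fun c => h₁.clean c, hereditarily_of_premises trivial
        (by simpa [premises] using h₁.noExist), fun _ => ⟨rfl, fun _ h => nomatch h⟩⟩
  | andE₂ _ ih₁ =>
    obtain ⟨_, h₁⟩ := ih₁ hp.1
    exact ⟨_, .andE₂ h₁.red, .andE₂ h₁.proves, ⟨h₁.pre, h₁.neutral hp.2⟩,
      fun c => h₁.clean c, hereditarily_of_premises trivial
        (by simpa [premises] using h₁.noExist), fun _ => ⟨rfl, fun _ h => nomatch h⟩⟩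
  | orI₁ _ ih₁ =>
    obtain ⟨_, h₁⟩ := ih₁ hp
    exact ⟨_, .orI₁ h₁.red, .orI₁ h₁.proves, h₁.pre,
      fun c => h₁.clean c, hereditarily_of_premises trivial
        (by simpa [premises] using h₁.noExist), fun _ => ⟨rfl, fun _ h => nomatch h⟩⟩
  | orI₂ _ ih₁ =>
    obtain ⟨_, h₁⟩ := ih₁ hp
    exact ⟨_, .orI₂ h₁.red, .orI₂ h₁.proves, h₁.pre,
      fun c => h₁.clean c, hereditarily_of_premises trivial
        (by simpa [premises] using h₁.noExist), fun _ => ⟨rfl, fun _ h => nomatch h⟩⟩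
  | orE _ _ _ ih₁ ih₂ ih₃ =>
    obtain ⟨_, h₁⟩ := ih₁ hp.1.1
    obtain ⟨_, h₂⟩ := ih₂ hp.2.1
    obtain ⟨_, h₃⟩ := ih₃ hp.2.2
    exact ⟨_, .orE h₁.red h₂.red h₃.red, .orE h₁.proves h₂.proves h₃.proves,
      ⟨⟨h₁.pre, h₁.neutral hp.1.2⟩, h₂.pre, h₃.pre⟩,
      fun c => ⟨h₁.clean c.1, h₂.clean c.2.1, h₃.clean c.2.2⟩, hereditarily_of_premises trivial
        (by simpa [premises] using ⟨h₁.noExist, h₂.noExist, h₃.noExist⟩), fun h => (h rfl).elim⟩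
  | impI _ ih₁ =>
    obtain ⟨_, h₁⟩ := ih₁ hp
    exact ⟨_, .impI h₁.red, .impI h₁.proves, h₁.pre,
      fun c => h₁.clean c, hereditarily_of_premises trivial
        (by simpa [premises] using h₁.noExist), fun _ => ⟨rfl, fun _ h => nomatch h⟩⟩
  | impE _ _ ih₁ ih₂ =>
    obtain ⟨_, h₁⟩ := ih₁ hp.1.1
    obtain ⟨_, h₂⟩ := ih₂ hp.2
    exact ⟨_, .impE h₁.red h₂.red, .impE h₁.proves h₂.proves, ⟨⟨h₁.pre, h₁.neutral hp.1.2⟩, h₂.pre⟩,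
      fun c => ⟨h₁.clean c.1, h₂.clean c.2⟩, hereditarily_of_premises trivial
        (by simpa [premises] using ⟨h₁.noExist, h₂.noExist⟩), fun _ => ⟨rfl, fun _ h => nomatch h⟩⟩
  | botE g₁ _ ih₁ =>
    obtain ⟨_, h₁⟩ := ih₁ hp.1
    exact ⟨_, .botE h₁.red, .botE g₁ h₁.proves, ⟨h₁.pre, h₁.neutral hp.2⟩,
      fun c => h₁.clean c, hereditarily_of_premises trivial
        (by simpa [premises] using h₁.noExist), fun _ => ⟨rfl, fun _ h => nomatch h⟩⟩
  | allI _ ih₁ =>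
    obtain ⟨_, h₁⟩ := ih₁ hp
    exact ⟨_, .allI h₁.red, .allI h₁.proves, h₁.pre,
      fun c => h₁.clean c, hereditarily_of_premises trivial
        (by simpa [premises] using h₁.noExist), fun _ => ⟨rfl, fun _ h => nomatch h⟩⟩
  | allE g₁ _ _ ih₁ ih₂ =>
    obtain ⟨_, h₁⟩ := ih₁ hp.1.1
    obtain ⟨_, h₂⟩ := ih₂ hp.2
    exact ⟨_, .allE h₁.red h₂.red, .allE g₁ h₁.proves h₂.proves,
      ⟨⟨h₁.pre, h₁.neutral hp.1.2⟩, h₂.pre⟩,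
      fun c => ⟨h₁.clean c.1, h₂.clean c.2⟩, hereditarily_of_premises trivial
        (by simpa [premises] using ⟨h₁.noExist, h₂.noExist⟩), fun _ => ⟨rfl, fun _ h => nomatch h⟩⟩
  | exI g₁ _ _ ih₁ ih₂ =>
    obtain ⟨_, h₁⟩ := ih₁ hp.1
    obtain ⟨_, h₂⟩ := ih₂ hp.2
    exact ⟨_, .exI h₁.red h₂.red, .exI g₁ h₁.proves h₂.proves, ⟨h₁.pre, h₂.pre⟩,
      fun c => ⟨h₁.clean c.1, h₂.clean c.2⟩, hereditarily_of_premises trivial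
        (by simpa [premises] using ⟨h₁.noExist, h₂.noExist⟩), fun _ => ⟨rfl, fun _ h => nomatch h⟩⟩
  | exE _ _ ih₁ ih₂ =>
    obtain ⟨_, h₁⟩ := ih₁ hp.1.1
    obtain ⟨_, h₂⟩ := ih₂ hp.2
    exact ⟨_, .exE h₁.red h₂.red, .exE h₁.proves h₂.proves, ⟨⟨h₁.pre, h₁.neutral hp.1.2⟩, h₂.pre⟩,
      fun c => ⟨h₁.clean c.1, h₂.clean c.2⟩, hereditarily_of_premises trivial
        (by simpa [premises] using ⟨h₁.noExist, h₂.noExist⟩), fun h => (h rfl).elim⟩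
  | eqE g₁ _ _ ih₁ ih₂ =>
    obtain ⟨_, h₁⟩ := ih₁ hp.1.1
    obtain ⟨_, h₂⟩ := ih₂ hp.2.1
    exact ⟨_, .eqE h₁.red h₂.red, .eqE g₁ h₁.proves h₂.proves,
      ⟨⟨h₁.pre, (h₁.head hp.1.2).1 ▸ hp.1.2⟩, h₂.pre, hp.2.2⟩,
      fun c => ⟨h₁.clean c.1, h₂.clean c.2⟩, hereditarily_of_premises trivial
        (by simpa [premises] using ⟨h₁.noExist, h₂.noExist⟩), fun _ => ⟨rfl, fun _ h => nomatch h⟩⟩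
  | iotaI g₁ _ _ _ ih₁ ih₂ ih₃ =>
    obtain ⟨_, h₁⟩ := ih₁ hp.1
    obtain ⟨_, h₂⟩ := ih₂ hp.2.1
    obtain ⟨_, h₃⟩ := ih₃ hp.2.2
    exact ⟨_, .iotaI h₁.red h₂.red h₃.red, .iotaI g₁ h₁.proves h₂.proves h₃.proves,
      ⟨h₁.pre, h₂.pre, h₃.pre⟩,
      fun c => ⟨h₁.clean c.1, h₂.clean c.2.1, h₃.clean c.2.2⟩, hereditarily_of_premises trivial
        (by simpa [premises] using ⟨h₁.noExist, h₂.noExist, h₃.noExist⟩),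
          fun _ => ⟨rfl, fun _ h => nomatch h⟩⟩
  | iotaE₁ g₁ g₂ _ _ ih₁ ih₂ =>
    obtain ⟨_, h₁⟩ := ih₁ hp.1.1
    obtain ⟨_, h₂⟩ := ih₂ hp.2
    exact ⟨_, .iotaE₁ h₁.red h₂.red, .iotaE₁ g₁ g₂ h₁.proves h₂.proves,
      ⟨⟨h₁.pre, h₁.neutral hp.1.2⟩, h₂.pre⟩,
      fun c => ⟨h₁.clean c.1, h₂.clean c.2⟩, hereditarily_of_premises trivial
        (by simpa [premises] using ⟨h₁.noExist, h₂.noExist⟩), fun _ => ⟨rfl, fun _ h => nomatch h⟩⟩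
  | iotaE₂ g₁ g₂ _ _ _ ih₁ ih₂ ih₃ =>
    obtain ⟨_, h₁⟩ := ih₁ hp.1.1
    obtain ⟨_, h₂⟩ := ih₂ hp.2.1
    obtain ⟨_, h₃⟩ := ih₃ hp.2.2
    exact ⟨_, .iotaE₂ h₁.red h₂.red h₃.red, .iotaE₂ g₁ g₂ h₁.proves h₂.proves h₃.proves,
      ⟨⟨h₁.pre, h₁.neutral hp.1.2⟩, h₂.pre, h₃.pre⟩,
      fun c => ⟨h₁.clean c.1, h₂.clean c.2.1, h₃.clean c.2.2⟩, hereditarily_of_premises trivial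
        (by simpa [premises] using ⟨h₁.noExist, h₂.noExist, h₃.noExist⟩),
          fun _ => ⟨rfl, fun _ h => nomatch h⟩⟩

/-! ### Normal form -/

theorem Pre.of_occurs {D c : Ded L} {k : ℕ} (h : D.Pre) (hc : D.Occurs k c) : c.Pre := by
  induction hc with
  | root => exact h
  | @premise k j r d e _ he ih =>
    cases d <;> simp only [premises, List.mem_cons, List.not_mem_nil, or_false, Prod.mk.injEq] at he
    all_goals simp only [Pre] at ih
    all_goals
      first
      | exact he.elim
      | (obtain ⟨-, -, rfl⟩ := he; first | exact ih | exact ih.1; done)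
      | (rcases he with ⟨-, -, rfl⟩ | ⟨-, -, rfl⟩ <;>
          first | exact ih.1 | exact ih.1.1 | exact ih.2 | exact ih.2.1)
      | (rcases he with ⟨-, -, rfl⟩ | ⟨-, -, rfl⟩ | ⟨-, -, rfl⟩ <;>
          first | exact ih.1 | exact ih.1.1 | exact ih.2.1 | exact ih.2.2)

/-- Sets of assumption classes are carried along into the scope of further ones. -/
theorem Clean.of_occurs {D c : Ded L} {k : ℕ} {S : ℕ → Prop} (h : D.Clean S)
    (hc : D.Occurs k c) : ∃ S', c.Clean S' ∧ ∀ i, S i → S' (i + k) := by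
  induction hc with
  | root => exact ⟨S, h, fun _ h => h⟩
  | @premise k j r d e _ he ih =>
    obtain ⟨S', hd, hS⟩ := ih
    suffices h : ∃ S'', e.Clean S'' ∧ ∀ i, S' i → S'' (i + j) by
      obtain ⟨S'', h, h'⟩ := h
      exact ⟨S'', h, fun i hi => by rw [← Nat.add_assoc]; exact h' _ (hS i hi)⟩
    cases d <;> simp only [premises, List.mem_cons, List.not_mem_nil, or_false, Prod.mk.injEq] at he
    all_goals simp only [Clean] at hd
    all_goals
      first
      | exact he.elim
      | (obtain ⟨-, rfl, rfl⟩ := he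
         first | exact ⟨_, hd, fun _ h => h⟩ | exact ⟨_, hd.2, fun _ h => h⟩)
      | (rcases he with ⟨-, rfl, rfl⟩ | ⟨-, rfl, rfl⟩
         · exact ⟨_, hd.1, fun _ h => h⟩
         · exact ⟨_, hd.2, fun _ h => h⟩)
      | (rcases he with ⟨-, rfl, rfl⟩ | ⟨-, rfl, rfl⟩ | ⟨-, rfl, rfl⟩
         · exact ⟨_, hd.1, fun _ h => h⟩
         · exact ⟨_, hd.2.1, fun _ h => h⟩
         · exact ⟨_, hd.2.2, fun _ h => h⟩)

theorem endsInDel_iff {d : Ded L} : d.EndsInDel ↔ d.kind = .del := by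
  cases d <;> simp [EndsInDel, kind]

theorem EndsInIntro.not_neutral {d : Ded L} (h : d.EndsInIntro) : ¬ d.Neutral := by
  cases d <;> simp_all [EndsInIntro, Neutral, kind]

theorem Segment.eq_of_kind_ne {l : List (Ded L)} {n : ℕ} {d : Ded L} (h : Segment l n d)
    (hd : d.kind ≠ .del) : l = [d] ∧ n = 0 := by
  cases h with
  | first => exact ⟨rfl, rfl⟩
  | next h => exact (hd (endsInDel_iff.1 h)).elim

theorem Segment.exists_occurs {l : List (Ded L)} {n : ℕ} {d c : Ded L} (h : Segment l n d)
    (hc : c ∈ l) : ∃ k, d.Occurs k c := by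
  induction h with
  | first => simp at hc; subst hc; exact ⟨0, .root⟩
  | next _ h _ ih =>
    rcases List.mem_append.1 hc with hc | hc
    · obtain ⟨k, hk⟩ := ih hc
      exact ⟨_, hk.of_premise h⟩
    · simp at hc; subst hc; exact ⟨0, .root⟩

theorem Pre.major {c d : Ded L} {j : ℕ} (h : c.Pre) (hc : c.EndsInElim)
    (hd : (.major, j, d) ∈ c.premises) :
    d.Neutral ∨ (d.kind ≠ .del ∧ c.EndsInEqE) := by
  cases c <;> simp [premises] at hd <;> simp only [EndsInElim] at hc <;> obtain ⟨-, rfl⟩ := hd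
  case eqE => exact .inr ⟨h.1.2, trivial⟩
  case iotaE₃ => exact .inl (.inr h.2)
  all_goals first | exact .inl h.2 | exact .inl h.1.2

theorem Pre.denotes {A : Fm L} {r : Tm L} {d c : Ded L} (h : c.Pre) (hc : Denotes A r d c) :
    d.kind ≠ .del ∧ d.kind ≠ .eqE := by
  cases hc with
  | ad => rcases h.2 with h | h <;> simp [h]
  | iotaE₃ => simp [h.2]

/-- The last segment of the sequence is the conclusion of `eqE`. -/
theorem EqESegment.exists_eqE {As : List (Fm L)} {d : Ded L} (h : EqESegment As d) :
    ∃ l k A s t m e, Segment l k d ∧ l.head? = some (.eqE A s t m e) ∧ A.inst t ∈ As := by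
  cases h with
  | two _ _ _ h h' => exact ⟨_, _, _, _, _, _, _, h, h', by simp⟩
  | more _ h h' => exact ⟨_, _, _, _, _, _, _, h, h', by simp⟩

/-- The local conditions exclude all maximal segments, because segments that end in a leftmost
premise have length one. -/
theorem Pre.isNormal {D : Ded L} (h : D.Pre) (hc : D.Clean fun _ => False)
    (he : D.Hereditarily NoExist) : D.IsNormal := by
  refine ⟨?_, ?_, ?_, ?_, ?_, ?_⟩
  · rintro ⟨k, c, j, d, l, n, hcD, hcE, hd, hl, hI⟩
    rcases (h.of_occurs hcD).major hcE hd with hd' | ⟨hd', hcE'⟩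
    · obtain ⟨rfl, -⟩ := hl.eq_of_kind_ne hd'.kind_ne
      exact (hI rfl).1.not_neutral hd'
    · obtain ⟨rfl, -⟩ := hl.eq_of_kind_ne hd'
      exact (hI rfl).2 hcE'
  · rintro ⟨k, c, t, d, l, n, hcD, hD, hl, e, hel, he'⟩
    have hd := ((h.of_occurs hcD).denotes hD).1
    obtain ⟨rfl, -⟩ := hl.eq_of_kind_ne hd
    simp at hel
    subst hel
    cases e <;> first | exact hd rfl | exact he'
  · rintro ⟨k, t, C, m, e, j, c, s, r, d, l, n, hD, hce, hc', hl, hh⟩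
    have hpe : e.Pre := (h.of_occurs hD).2
    obtain ⟨S, hS, -⟩ := hc.of_occurs hD
    obtain ⟨S', hS', hi⟩ := hS.2.of_occurs hce
    obtain ⟨rfl, rfl⟩ := hl.eq_of_kind_ne ((hpe.of_occurs hce).denotes hc').1
    simp at hh
    subst hh
    have hj : S' j := by simpa using hi 0 trivial
    cases hc' with
    | ad => exact hS'.1 j s rfl rfl hj
    | iotaE₃ => exact hS'.1 j rfl hj
  · rintro ⟨k, t, m, e, l, n, u, d, c, hD, hl, hh, hc'⟩
    obtain ⟨rfl, -⟩ := hl.eq_of_kind_ne (h.of_occurs hD).1.2.kind_ne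
    simp at hh
    subst hh
    exact he hD rfl u d hc'
  · rintro (⟨k, c, A, r, d, As, hcD, hD, hs⟩ | ⟨d, As, hd, hs, hA⟩)
    · obtain ⟨l, k', A', s, t, m, e, hl, hh, -⟩ := hs.exists_eqE
      have hd := (h.of_occurs hcD).denotes hD
      obtain ⟨rfl, -⟩ := hl.eq_of_kind_ne hd.1
      simp at hh
      subst hh
      exact hd.2 rfl
    · obtain ⟨l, k', A', s, t, m, e, hl, hh, hm⟩ := hs.exists_eqE
      have hpd : d.Pre := by
        rcases hd with rfl | ⟨k, c, r, j, hcD, hdc, -⟩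
        · exact h
        · exact h.of_occurs (hcD.premise hdc)
      obtain ⟨k, hk⟩ := hl.exists_occurs (List.mem_of_mem_head? hh)
      obtain ⟨r, hr⟩ := hA _ hm
      cases A' <;> simp [Fm.inst, Fm.subst] at hr
      exact (hpd.of_occurs hk).2.2.2 _ rfl
  · rintro ⟨k, A, t, d, e, hD⟩
    exact (h.of_occurs hD).2.2.1 rfl

/-- Deductions in which identity is eliminated from arguments only reduce to normal form. -/
theorem PlainProves.exists_isNormal {Γ : List (Fm L)} {D : Ded L} {A : Fm L}
    (h : PlainProves Γ D A) : ∃ D', ReducesTo D D' ∧ PlainProves Γ D' A ∧ D'.IsNormal := by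
  obtain ⟨D₁, r₁, h₁, p₁⟩ := h.exists_pre
  obtain ⟨D₂, h₂⟩ := h₁.exists_cleaned p₁
  obtain ⟨D₃, h₃⟩ := h₂.proves.exists_collapsed h₂.pre
  exact ⟨D₃, (r₁.trans h₂.red).trans h₃.red, h₃.proves,
    h₃.pre.isNormal (h₃.clean h₂.clean) h₃.noExist⟩

end Ded

end FreeLogic

theorem mainTheorem2 {L : FreeLogic.Signature} (Γ : List (FreeLogic.Fm L)) (A : FreeLogic.Fm L)
    (D : FreeLogic.Ded L) (hD : FreeLogic.Proves Γ D A) :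
    ∃ D' : FreeLogic.Ded L, FreeLogic.Proves Γ D' A ∧ D'.IsNormal ∧
      (D.PlainEqE → D.ReducesTo D') := by
  by_cases hp : D.PlainEqE
  · obtain ⟨D', r, h, hn⟩ := (FreeLogic.Ded.Proves.plainProves hD hp).exists_isNormal
    exact ⟨D', h.proves, hn, fun _ => r⟩
  · obtain ⟨D₁, h₁⟩ := FreeLogic.Prov.of_proves hD
    obtain ⟨D', -, h, hn⟩ := h₁.exists_isNormal
    exact ⟨D', h.proves, hn, fun h => (hp h).elim⟩
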